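/- Let $Q$ be a finite-dimensional smooth manifold without boundary, with canonical symplectic form $\omega_Q=\mathrm dq^i\wedge\mathrm dp_i$ on $T^*Q$, and let $\mathrm{pr}_1,\mathrm{pr}_2$ be the projections of $T^*Q\times T^*Q$; put $\Omega_{12}=\mathrm{pr}_2^*\omega_Q-\mathrm{pr}_1^*\omega_Q$. All submanifolds are smooth and embedded. *Optimal control problem.* Let $U$ be a subset of a finite-dimensional real vector space, and let $X(q,u)\in T_qQ$ and $F(q,u)\in\mathbb R$ be smooth for $q\in Q$, $u\in\operatorname{int}U$. Put $H(q,p,u)=\langle p,X(q,u)\rangle-F(q,u)$ and assume that $H$ is a Morse family over $T^*Q\times \operatorname{int}U\to T^*Q$: the differential of $\partial H/\partial u$ with respect to $(q,p,u)$ has maximal rank wherever $\partial H/\partial u=0$. Let $$\mathcal L_H=\{(q,p,\tfrac{\partial H}{\partial q},\tfrac{\partial H}{\partial p})(q,p,u) : u\in\operatorname{int}U,\ \tfrac{\partial H}{\partial u}(q,p,u)=0\}\subset T^*T^*Q,\qquad S_H=\{v\in TT^*Q : i_v\omega_Q\in\mathcal L_H\}.$$ Let $S^0_H=S_H$, $P^k_H=\tau_{T^*Q}(S^k_H)$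 and $S^{k+1}_H=TP^k_H\cap S^k_H$, where $\tau_{T^*Q}:TT^*Q\to T^*Q$ is the projection (and, for a subset $N$ of a manifold, $T_xN$ is the linear span of the velocities at $x$ of curves in $N$, i.e. the usual tangent space if $N$ is a submanifold). Suppose that $S_H^{k_f+1}=S_H^{k_f}$ for some $k_f$, that $S^f_H=S^{k_f}_H\subset TT^*Q$ and $P^f_H=P^{k_f}_H\subset T^*Q$ are submanifolds, of dimensions $r$ and $m$, and that the surjection $\tau_{T^*Q}:S^f_H\to P^f_H$ is a submersion. *Discretization.* Let $R_d=(R^1,R^2):D\to Q\times Q$ be a discretization map: $D\subset TQ$ is an open neighbourhood of the zero section, $R_d$ is smooth, $R_d(0_x)=(x,x)$ and $T_{0_x}R^2_x-T_{0_x}R^1_x=\mathrm{Id}_{T_xQ}$ for all $x\in Q$. Assume that $D$ is chosen so that $R_d$ is a diffeomorphism onto its open image. Let $R_d^{T^*}=\Phi^{-1}\circ (TR_d^{-1})^*\circ\alpha_Q$ be its cotangent lift, defined on the part of $TT^*Q$ that lies over $D$, where in bundle coordinates $\alpha_Q(q,p,\dot q,\dot p)=(q,\dot q,\dot p,p)$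 is the canonical isomorphism $TT^*Q\to T^*TQ$ and $\Phi(q_0,p_0;q_1,p_1)=(q_0,q_1,-p_0,p_1)$. Let $P^f_{H,d}\subset T^*Q\times T^*Q$ be the image under $R_d^{T^*}$ of the part of $TP^f_H$ in its domain, with inclusion $j_f^d$, and for $h\neq 0$ let the OCP geometric integrator be the relation $$\mathcal D_h=\{y=(q_k,p_k;q_{k+1},p_{k+1})\in P^f_{H,d} : \tfrac1h (R_d^{T^*})^{-1}(y)\in S^f_H\}.$$ **Proposition.** The OCP geometric integrator preserves the presymplectic 2-form $\Omega_{f,d}=(j_f^d)^*\Omega_{12}$. That is: 1. $P^f_{H,d}$ is a $2m$-dimensional submanifold of $T^*Q\times T^*Q$ and $\Omega_{f,d}$ is a presymplectic (smooth, closed) 2-form on it. 2. $\mathcal D_h$ is an $r$-dimensional Lagrangian submanifold of $(P^f_{H,d},\Omega_{f,d})$: it is an $r$-dimensional submanifold contained in $P^f_{H,d}$, the pullback of $\Omega_{f,d}$ to $\mathcal D_h$ vanishes, and for all $y\in\mathcal D_h$ $$r=\frac{\dim P^f_{H,d}-\dim\ker(\Omega_{f,d})_y}{2}+\dim\bigl(T_y\mathcal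 D_h\cap\ker(\Omega_{f,d})_y\bigr).$$ 3. Consequently, if $A\subset T^*Q$ and $\varphi:T^*Q\to T^*Q$ satisfy $(z,\varphi(z))\in\mathcal D_h$ for all $z\in A$, then at each $z\in A$ where $\varphi$ is differentiable, $(\varphi^*\omega_Q)_z(v,w)=(\omega_Q)_z(v,w)$ for all $v,w\in T_zA$. -/

import Mathlib

open Set Filter Topology Manifold Bundle
open scoped ContDiff

noncomputable section

/-! ### Two-forms, submanifolds and Lagrangian submanifolds -/

section Manifolds

variable {F : Type*} [NormedAddCommGroup F] [NormedSpace ℝ F]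
  {H : Type*} [TopologicalSpace H] (I : ModelWithCorners ℝ F H)
  {M : Type*} [TopologicalSpace M] [ChartedSpace H M]
  {F' : Type*} [NormedAddCommGroup F'] [NormedSpace ℝ F']
  {H' : Type*} [TopologicalSpace H'] (I' : ModelWithCorners ℝ F' H')
  {M' : Type*} [TopologicalSpace M'] [ChartedSpace H' M']

/-- A field of bilinear forms on the tangent spaces of `M`. -/
abbrev BilinearField (M : Type*) [TopologicalSpace M] [ChartedSpace H M] :=
  ∀ x : M, TangentSpace I x →L[ℝ] TangentSpace I x →L[ℝ] ℝ

/-- The bilinear form `(v, w) ↦ B (A v) (A w)`. -/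
def bilinPullback (B : F' →L[ℝ] F' →L[ℝ] ℝ) (A : F →L[ℝ] F') : F →L[ℝ] F →L[ℝ] ℝ :=
  B.bilinearComp A A

/-- The bilinear form `(v, w) ↦ B v w - B w v`. -/
def bilinAntisymm (B : F →L[ℝ] F →L[ℝ] ℝ) : F →L[ℝ] F →L[ℝ] ℝ :=
  B - B.flip

variable {I I'} in
/-- The pullback `f^* Ω`. -/
def BilinearField.pullback (Ω : BilinearField I' M') (f : M → M') : BilinearField I M :=
  fun x => bilinPullback (F := F) (F' := F') (Ω (f x)) (mfderiv I I' f x)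

/-- `T_x N` for a subset `N` of `M`: the linear span of the velocities at `x` of the curves in `N`
through `x`. If `N` is a submanifold this is its tangent space at `x ∈ N`. -/
def tangentSpaceOf (N : Set M) (x : M) : Submodule ℝ (TangentSpace I x) :=
  Submodule.span ℝ {v | ∃ γ : ℝ → M, γ 0 = x ∧ (∀ᶠ t in 𝓝 (0 : ℝ), γ t ∈ N) ∧
    MDifferentiableAt 𝓘(ℝ, ℝ) I γ 0 ∧
    (show F from mfderiv 𝓘(ℝ, ℝ) I γ 0 (show ℝ from 1)) = (show F from v)}

/-- `T N` as a subset of `T M`. -/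
def tangentBundleOf (N : Set M) : Set (TangentBundle I M) :=
  {w | w.proj ∈ N ∧ w.snd ∈ tangentSpaceOf I N w.proj}

/-- `N` is a smooth embedded `d`-dimensional submanifold of `M`: locally it is the zero set of
`dim M - d` smooth functions with linearly independent differentials. -/
def IsSubmanifold (d : ℕ) (N : Set M) : Prop :=
  ∀ x ∈ N, ∃ (c : ℕ) (O : Set M) (g : M → (Fin c → ℝ)),
    c + d = Module.finrank ℝ F ∧ IsOpen O ∧ x ∈ O ∧
    ContMDiffOn I 𝓘(ℝ, Fin c → ℝ) ∞ g O ∧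
    Function.Surjective (mfderiv I 𝓘(ℝ, Fin c → ℝ) g x) ∧
    ∀ y ∈ O, y ∈ N ↔ g y = 0

variable {I}

/-- The restriction of `Ω` to the submanifold `P` is a presymplectic form, i.e. a smooth closed
2-form. Smoothness and closedness are expressed in all smooth parametrizations `c` with values in
`P`: the function `y ↦ (c^* Ω)_y(a, b)` is smooth for constant `a`, `b`, and `d(c^* Ω) = 0`, where
`d(c^* Ω)(a₁, a₂, a₃)` is the cyclic sum of the derivatives of `(c^* Ω)(a₂, a₃)` along `a₁`. -/
structure IsPresymplecticOn (Ω : BilinearField I M) (P : Set M) : Prop where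
  alternating : ∀ x ∈ P, ∀ v ∈ tangentSpaceOf I P x, Ω x v v = 0
  smooth : ∀ (k : ℕ) (O : Set (Fin k → ℝ)) (c : (Fin k → ℝ) → M), IsOpen O →
    ContMDiffOn 𝓘(ℝ, Fin k → ℝ) I ∞ c O → MapsTo c O P → ∀ a b : Fin k → ℝ,
      ContDiffOn ℝ ∞
        (fun y => (Ω.pullback c : BilinearField 𝓘(ℝ, Fin k → ℝ) (Fin k → ℝ)) y a b) O
  closed : ∀ (k : ℕ) (O : Set (Fin k → ℝ)) (c : (Fin k → ℝ) → M), IsOpen O →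
    ContMDiffOn 𝓘(ℝ, Fin k → ℝ) I ∞ c O → MapsTo c O P → ∀ y ∈ O, ∀ a₁ a₂ a₃ : Fin k → ℝ,
      fderiv ℝ
          (fun y => (Ω.pullback c : BilinearField 𝓘(ℝ, Fin k → ℝ) (Fin k → ℝ)) y a₂ a₃) y a₁
        + fderiv ℝ
          (fun y => (Ω.pullback c : BilinearField 𝓘(ℝ, Fin k → ℝ) (Fin k → ℝ)) y a₃ a₁) y a₂
        + fderiv ℝ
          (fun y => (Ω.pullback c : BilinearField 𝓘(ℝ, Fin k → ℝ) (Fin k → ℝ)) y a₁ a₂) y a₃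
        = 0

/-- The kernel at `x ∈ P` of the pullback of `Ω` to the submanifold `P`. -/
def kerOn (Ω : BilinearField I M) (P : Set M) (x : M) : Submodule ℝ (TangentSpace I x) where
  carrier := {v | v ∈ tangentSpaceOf I P x ∧ ∀ w ∈ tangentSpaceOf I P x, Ω x v w = 0}
  add_mem' := fun {a b} ha hb =>
    ⟨add_mem ha.1 hb.1, fun w hw => by simp [ha.2 w hw, hb.2 w hw]⟩
  zero_mem' := ⟨zero_mem _, fun w _ => by simp⟩
  smul_mem' := fun c a ha => ⟨Submodule.smul_mem _ c ha.1, fun w hw => by simp [ha.2 w hw]⟩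

/-- `L` is an `r`-dimensional Lagrangian submanifold of the presymplectic manifold `(P, j^* Ω)`,
where `j : P → M` is the inclusion of a submanifold. -/
structure IsLagrangianIn (Ω : BilinearField I M) (P L : Set M) (r : ℕ) : Prop where
  subset : L ⊆ P
  isSubmanifold : IsSubmanifold I r L
  isotropic : ∀ x ∈ L, ∀ v ∈ tangentSpaceOf I L x, ∀ w ∈ tangentSpaceOf I L x, Ω x v w = 0
  dim_eq : ∀ x ∈ L, (r : ℝ) =
    ((Module.finrank ℝ (tangentSpaceOf I P x) : ℝ) - Module.finrank ℝ (kerOn Ω P x)) / 2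
      + Module.finrank ℝ (tangentSpaceOf I L x ⊓ kerOn Ω P x : Submodule ℝ (TangentSpace I x))

end Manifolds

/-! ### The cotangent bundle and its canonical symplectic form -/

section Cotangent

variable {F : Type*} [NormedAddCommGroup F] [NormedSpace ℝ F]
  {H : Type*} [TopologicalSpace H] (I : ModelWithCorners ℝ F H)
  (M : Type*) [TopologicalSpace M] [ChartedSpace H M]

/-- The cotangent bundle `T^* M`; it carries Mathlib's smooth structure on bundles of
continuous linear maps. -/
abbrev CotangentBundle :=
  TotalSpace (F →L[ℝ] ℝ) (fun x : M => TangentSpace I x →L[ℝ] Trivial M ℝ x)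

/-- The model with corners of the manifold `T^* M`. -/
abbrev cotangentModel : ModelWithCorners ℝ (F × (F →L[ℝ] ℝ)) (ModelProd H (F →L[ℝ] ℝ)) :=
  I.prod 𝓘(ℝ, F →L[ℝ] ℝ)

variable (F) in
/-- `dq ∧ dp` on `F × F^*`: `((a, α), (b, β)) ↦ β a - α b`. -/
def standardForm : (F × (F →L[ℝ] ℝ)) →L[ℝ] (F × (F →L[ℝ] ℝ)) →L[ℝ] ℝ :=
  bilinAntisymm ((ContinuousLinearMap.apply ℝ ℝ : F →L[ℝ] (F →L[ℝ] ℝ) →L[ℝ] ℝ).bilinearComp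
    (ContinuousLinearMap.fst ℝ F (F →L[ℝ] ℝ)) (ContinuousLinearMap.snd ℝ F (F →L[ℝ] ℝ)))

theorem standardForm_apply (v w : F × (F →L[ℝ] ℝ)) :
    standardForm F v w = w.2 v.1 - v.2 w.1 := rfl

variable [IsManifold I ∞ M]

/-- The canonical symplectic form `ω = dq^i ∧ dp_i` of `T^* M`. A tangent vector at `z` is an
element of `F × F^*`, its coordinates in the preferred chart of `T^* M` at `z`; this chart is the
canonical bundle chart `(q, p)` induced by the preferred chart of `M` at the base point of `z`. -/
def canonicalForm : BilinearField (cotangentModel I) (CotangentBundle I M) :=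
  fun _ => standardForm F

end Cotangent

/-! ### Discretization maps and their cotangent lifts -/

section Discretization

variable {E : Type*} [NormedAddCommGroup E] [NormedSpace ℝ E]
  {Q : Type*} [TopologicalSpace Q] [ChartedSpace E Q] [IsManifold 𝓘(ℝ, E) ∞ Q]

/-- `R = (R¹, R²)`, defined on the open neighbourhood `D` of the zero section of `T Q`, is a
discretization map on `Q` (the values of `R` outside of `D` are irrelevant). -/
structure IsDiscretizationMap (D : Set (TangentBundle 𝓘(ℝ, E) Q))
    (R : TangentBundle 𝓘(ℝ, E) Q → Q × Q) : Prop where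
  isOpen : IsOpen D
  zero_mem : ∀ x : Q, (⟨x, 0⟩ : TangentBundle 𝓘(ℝ, E) Q) ∈ D
  smooth : ContMDiffOn 𝓘(ℝ, E).tangent (𝓘(ℝ, E).prod 𝓘(ℝ, E)) ∞ R D
  map_zero : ∀ x : Q, R ⟨x, 0⟩ = (x, x)
  deriv_zero : ∀ (x : Q) (v : E),
    (show E from mfderiv 𝓘(ℝ, E) 𝓘(ℝ, E)
        (fun w : E => (R (⟨x, w⟩ : TangentBundle 𝓘(ℝ, E) Q)).2) 0 v)
      - (show E from mfderiv 𝓘(ℝ, E) 𝓘(ℝ, E)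
        (fun w : E => (R (⟨x, w⟩ : TangentBundle 𝓘(ℝ, E) Q)).1) 0 v) = v

/-- `R` is a diffeomorphism from the open set `D` onto its (open) image. -/
def IsDiffeoOntoImage (D : Set (TangentBundle 𝓘(ℝ, E) Q))
    (R : TangentBundle 𝓘(ℝ, E) Q → Q × Q) : Prop :=
  IsOpen D ∧ ContMDiffOn 𝓘(ℝ, E).tangent (𝓘(ℝ, E).prod 𝓘(ℝ, E)) ∞ R D ∧ InjOn R D ∧
    ∀ ξ ∈ D, Function.Bijective (mfderiv 𝓘(ℝ, E).tangent (𝓘(ℝ, E).prod 𝓘(ℝ, E)) R ξ)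

/-- `T (T^* Q)`. -/
abbrev TTStar (E : Type*) [NormedAddCommGroup E] [NormedSpace ℝ E]
    (Q : Type*) [TopologicalSpace Q] [ChartedSpace E Q] [IsManifold 𝓘(ℝ, E) ∞ Q] :=
  TangentBundle (cotangentModel 𝓘(ℝ, E)) (CotangentBundle 𝓘(ℝ, E) Q)

/-- The canonical isomorphism `T T^* Q → T^* T Q`, `(q, p, q̇, ṗ) ↦ (q, q̇, ṗ, p)` in bundle
coordinates: the covector `(δq, δv) ↦ ṗ(δq) + p(δv)` at the point `(q, q̇)` of `T Q`. All tangent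
vectors are given by their coordinates in the bundle charts induced by the preferred chart of
`Q` at `q`. -/
def tulczyjew (w : TTStar E Q) : CotangentBundle 𝓘(ℝ, E).tangent (TangentBundle 𝓘(ℝ, E) Q) :=
  let z : CotangentBundle 𝓘(ℝ, E) Q := w.proj
  let p : E →L[ℝ] ℝ := z.snd
  let dot : E × (E →L[ℝ] ℝ) := w.snd
  ⟨⟨z.proj, dot.1⟩,
    (show E × E →L[ℝ] ℝ from
      dot.2.comp (ContinuousLinearMap.fst ℝ E E) + p.comp (ContinuousLinearMap.snd ℝ E E))⟩

/-- The cotangent lift `(T R⁻¹)^* : T^* T Q → T^* (Q × Q)` of `R` (over the points where the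
differential of `R` is invertible). -/
def hatLift (R : TangentBundle 𝓘(ℝ, E) Q → Q × Q)
    (α : CotangentBundle 𝓘(ℝ, E).tangent (TangentBundle 𝓘(ℝ, E) Q)) :
    CotangentBundle (𝓘(ℝ, E).prod 𝓘(ℝ, E)) (Q × Q) :=
  ⟨R α.proj, ContinuousLinearMap.comp (α.snd : E × E →L[ℝ] ℝ)
    (ContinuousLinearMap.inverse
      (show E × E →L[ℝ] E × E from
        mfderiv 𝓘(ℝ, E).tangent (𝓘(ℝ, E).prod 𝓘(ℝ, E)) R α.proj))⟩

/-- `Φ⁻¹ : T^* (Q × Q) → T^* Q × T^* Q`, where `Φ(q₀, p₀; q₁, p₁) = (q₀, q₁, -p₀, p₁)`. -/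
def phiInv (β : CotangentBundle (𝓘(ℝ, E).prod 𝓘(ℝ, E)) (Q × Q)) :
    CotangentBundle 𝓘(ℝ, E) Q × CotangentBundle 𝓘(ℝ, E) Q :=
  (⟨β.proj.1, (show E →L[ℝ] ℝ from
      -((show E × E →L[ℝ] ℝ from β.snd).comp (ContinuousLinearMap.inl ℝ E E)))⟩,
   ⟨β.proj.2, (show E →L[ℝ] ℝ from
      (show E × E →L[ℝ] ℝ from β.snd).comp (ContinuousLinearMap.inr ℝ E E))⟩)

/-- The cotangent lift `R_d^{T^*} = Φ⁻¹ ∘ (T R_d⁻¹)^* ∘ α_Q` of a discretization map `R`. -/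
def cotangentLift (R : TangentBundle 𝓘(ℝ, E) Q → Q × Q) (w : TTStar E Q) :
    CotangentBundle 𝓘(ℝ, E) Q × CotangentBundle 𝓘(ℝ, E) Q :=
  phiInv (hatLift R (tulczyjew w))

/-- The domain of `R_d^{T^*}` when `R_d` has domain `D`. -/
def cotangentLiftDomain (D : Set (TangentBundle 𝓘(ℝ, E) Q)) : Set (TTStar E Q) :=
  {w | (tulczyjew w).proj ∈ D}

/-- The model with corners of `T^* Q × T^* Q`. -/
abbrev pairModel (E : Type*) [NormedAddCommGroup E] [NormedSpace ℝ E] :=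
  (cotangentModel 𝓘(ℝ, E)).prod (cotangentModel 𝓘(ℝ, E))

/-- `Ω₁₂ = pr₂^* ω_Q - pr₁^* ω_Q` on `T^* Q × T^* Q`. -/
def Omega12 (E : Type*) [NormedAddCommGroup E] [NormedSpace ℝ E]
    (Q : Type*) [TopologicalSpace Q] [ChartedSpace E Q] [IsManifold 𝓘(ℝ, E) ∞ Q] :
    BilinearField (pairModel E) (CotangentBundle 𝓘(ℝ, E) Q × CotangentBundle 𝓘(ℝ, E) Q) :=
  fun y => (canonicalForm 𝓘(ℝ, E) Q).pullback Prod.snd y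
    - (canonicalForm 𝓘(ℝ, E) Q).pullback Prod.fst y

/-- The image `P_d = R_d^{T^*}(T P)` of the part of `T P` in the domain of `R_d^{T^*}`. -/
def discretePhaseSpace (D : Set (TangentBundle 𝓘(ℝ, E) Q))
    (R : TangentBundle 𝓘(ℝ, E) Q → Q × Q) (P : Set (CotangentBundle 𝓘(ℝ, E) Q)) :
    Set (CotangentBundle 𝓘(ℝ, E) Q × CotangentBundle 𝓘(ℝ, E) Q) :=
  cotangentLift R ''
    (tangentBundleOf (cotangentModel 𝓘(ℝ, E)) P ∩ cotangentLiftDomain D)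

/-- The integrator with step `h` for the dynamics `S ⊆ T T^* Q` over `P`, as the relation
formed by the pairs `(q_k, p_k; q_{k+1}, p_{k+1}) ∈ P_d` such that
`(1/h) (R_d^{T^*})⁻¹(q_k, p_k; q_{k+1}, p_{k+1})` belongs to (the fibre over its base point of)
`S`. -/
def integrator (D : Set (TangentBundle 𝓘(ℝ, E) Q)) (R : TangentBundle 𝓘(ℝ, E) Q → Q × Q)
    (P : Set (CotangentBundle 𝓘(ℝ, E) Q)) (S : Set (TTStar E Q)) (h : ℝ) :
    Set (CotangentBundle 𝓘(ℝ, E) Q × CotangentBundle 𝓘(ℝ, E) Q) :=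
  {y | y ∈ discretePhaseSpace D R P ∧ ∃ w ∈ cotangentLiftDomain D, cotangentLift R w = y ∧
    (⟨w.proj, h⁻¹ • w.snd⟩ : TTStar E Q) ∈ S}

end Discretization

/-! ### Optimal control problems and the integrability algorithm -/

section OptimalControl

/-- An optimal control problem on `Q` with a set `U` of admissible controls in the vector space
`W`: the control equation `q̇ = X(q, u)` and the running cost `F(q, u)`, both smooth for controls
in the interior of `U`. -/
structure OptimalControlProblem
    (E : Type*) [NormedAddCommGroup E] [NormedSpace ℝ E]
    (Q : Type*) [TopologicalSpace Q] [ChartedSpace E Q] [IsManifold 𝓘(ℝ, E) ∞ Q]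
    (W : Type*) [NormedAddCommGroup W] [NormedSpace ℝ W] where
  U : Set W
  X : ∀ q : Q, W → TangentSpace 𝓘(ℝ, E) q
  F : Q → W → ℝ
  smooth_X : ContMDiffOn (𝓘(ℝ, E).prod 𝓘(ℝ, W)) 𝓘(ℝ, E).tangent ∞
    (fun y : Q × W => (⟨y.1, X y.1 y.2⟩ : TangentBundle 𝓘(ℝ, E) Q)) (univ ×ˢ interior U)
  smooth_F : ContMDiffOn (𝓘(ℝ, E).prod 𝓘(ℝ, W)) 𝓘(ℝ, ℝ) ∞
    (fun y : Q × W => F y.1 y.2) (univ ×ˢ interior U)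

namespace OptimalControlProblem

variable {E : Type*} [NormedAddCommGroup E] [NormedSpace ℝ E]
  {Q : Type*} [TopologicalSpace Q] [ChartedSpace E Q] [IsManifold 𝓘(ℝ, E) ∞ Q]
  {W : Type*} [NormedAddCommGroup W] [NormedSpace ℝ W] (O : OptimalControlProblem E Q W)

/-- Pontryagin's Hamiltonian `H(q, p, u) = ⟨p, X(q, u)⟩ - F(q, u)`. -/
def hamiltonian (z : CotangentBundle 𝓘(ℝ, E) Q) (u : W) : ℝ :=
  z.snd (O.X z.proj u) - O.F z.proj u

/-- The partial differential `∂H/∂u`. -/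
def controlDeriv (z : CotangentBundle 𝓘(ℝ, E) Q) (u : W) : W →L[ℝ] ℝ :=
  fderiv ℝ (O.hamiltonian z) u

/-- `H` is a Morse family over the projection `T^* Q × U → T^* Q`: the differential of `∂H/∂u`
with respect to `(q, p, u)` has maximal rank where `∂H/∂u = 0`. -/
def IsMorseFamily : Prop :=
  ∀ (z : CotangentBundle 𝓘(ℝ, E) Q), ∀ u ∈ interior O.U, O.controlDeriv z u = 0 →
    Function.Surjective
      (mfderiv ((cotangentModel 𝓘(ℝ, E)).prod 𝓘(ℝ, W)) 𝓘(ℝ, W →L[ℝ] ℝ)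
        (fun y : CotangentBundle 𝓘(ℝ, E) Q × W => O.controlDeriv y.1 y.2) (z, u))

/-- `L_H ⊆ T^* T^* Q`: the covectors `(∂H/∂q, ∂H/∂p)` at the points where `∂H/∂u = 0`. -/
def lagrangianSet :
    Set (CotangentBundle (cotangentModel 𝓘(ℝ, E)) (CotangentBundle 𝓘(ℝ, E) Q)) :=
  {α | ∃ u ∈ interior O.U, O.controlDeriv α.proj u = 0 ∧
    α.snd = mfderiv (cotangentModel 𝓘(ℝ, E)) 𝓘(ℝ, ℝ) (fun z => O.hamiltonian z u) α.proj}

/-- `S_H = {v ∈ T T^* Q | i_v ω_Q ∈ L_H}`. -/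
def dynamics : Set (TTStar E Q) :=
  {v | (⟨v.proj, canonicalForm 𝓘(ℝ, E) Q v.proj v.snd⟩ :
    CotangentBundle (cotangentModel 𝓘(ℝ, E)) (CotangentBundle 𝓘(ℝ, E) Q)) ∈ O.lagrangianSet}

/-- The sets `S_H^k` of the integrability algorithm: `S_H^0 = S_H` and
`S_H^{k+1} = T P_H^k ∩ S_H^k`, with `P_H^k` the projection of `S_H^k` to `T^* Q`. -/
def S : ℕ → Set (TTStar E Q)
  | 0 => O.dynamics
  | k + 1 => tangentBundleOf (cotangentModel 𝓘(ℝ, E)) (TotalSpace.proj '' S k) ∩ S k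

/-- `P_H^k = τ_{T^* Q}(S_H^k)`. -/
def P (k : ℕ) : Set (CotangentBundle 𝓘(ℝ, E) Q) :=
  TotalSpace.proj '' O.S k

end OptimalControlProblem

end OptimalControl

end

/-! The tangent lift of `dq ∧ dp` to `T T^*Q` is `dq̇ ∧ dp + dq ∧ dṗ` (`liftedForm`). Three facts
about it carry the proof.

The final set `S^f` is isotropic for it. Formally, along `S_H` the form `i_v ω` equals `dH` for a
control that is critical for `H`, so its pullback to a submanifold of `S_H` is the exact form `d(H ∘
(ζ, u))`, and the exterior derivative of that pullback, the lifted form up to sign, vanishes. The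
obstacle is that a submanifold contained in the set `S_H` need not come with a smooth, or even
continuous, choice of the control `u`. The Morse condition makes `(ζ, u) ↦ (ζ, dH)` an immersion at
critical points, so countably many smooth local left inverses suffice. By Baire's theorem one of
them yields a smooth control on some open subset of any given ball. Isotropy therefore holds at a
dense set of points and, by continuity, everywhere (`isotropic_of_morse`,
`OptimalControlProblem.liftedForm_eq_zero`).

The cotangent lift `Ψ = R_d^{T^*}` pulls `Ω₁₂` back to the lifted form (`pairForm_cotangentLift`).
With `θ = p dq`, the sign in `Φ` turns `θ₂ - θ₁` into the tautological form of `T^*(Q × Q)`,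
cotangent lifts preserve tautological forms, and `α_Q` pulls the one of `T^*TQ` back to `ṗ dq + p
dq̇`. Since the lifted form is nondegenerate, the differential of `Ψ` is invertible. As `Ψ` is also
injective, it carries submanifolds to submanifolds of the same dimension.

Stabilization gives `S^f ⊆ TP^f`, and the fibres of `TP^f` are linear, so the integrator is the
image under `Ψ` of the part of `h · S^f` in the domain (`integrator_eq_image`). Scaling the fibres
by `h` multiplies the lifted form by `h`, so the integrator is isotropic. For the dimension formula,
the submersion hypothesis writes each tangent vector of `TP^f` as a tangent vector of `h · S^f` plus
a vertical vector. Vertical vectors are isotropic as well, and an isotropic subspace with an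
isotropic supplement satisfies the formula by rank counting (`finrank_lagrangian`,
`isLagrangianIn_integrator`).

Finally, if the graph of `φ` over `A` lies in the integrator, then `z ↦ (z, φ z)` maps `T_zA` into
its tangent space, and vanishing of `Ω₁₂ = pr₂^*ω - pr₁^*ω` there says `φ^*ω = ω` on `T_zA`
(`canonicalForm_preserved`). -/

noncomputable section

/-! ### Calculus in normed spaces: local inverses, and isotropy from Morse families. -/

section Calculus

variable {X X' Y Z W V : Type*} [NormedAddCommGroup X] [NormedSpace ℝ X]
  [NormedAddCommGroup X'] [NormedSpace ℝ X']
  [NormedAddCommGroup Y] [NormedSpace ℝ Y] [NormedAddCommGroup Z] [NormedSpace ℝ Z]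
  [NormedAddCommGroup W] [NormedSpace ℝ W] [NormedAddCommGroup V] [NormedSpace ℝ V]

/-- The inverse function theorem, with a smooth inverse on an open set. -/
theorem ContDiffOn.exists_openPartialHomeomorph [CompleteSpace X] {O : Set X} (hO : IsOpen O)
    {f : X → X'} (hf : ContDiffOn ℝ ∞ f O) {x : X} (hx : x ∈ O) (f' : X ≃L[ℝ] X')
    (hf' : fderiv ℝ f x = f') :
    ∃ e : OpenPartialHomeomorph X X', x ∈ e.source ∧ e.source ⊆ O ∧ ⇑e = f ∧
      ContDiffOn ℝ ∞ e.symm e.target := by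
  have hfx : ContDiffAt ℝ ∞ f x := hf.contDiffAt (hO.mem_nhds hx)
  have hd : HasFDerivAt f (f' : X →L[ℝ] X') x :=
    hf' ▸ (hfx.differentiableAt (by simp)).hasFDerivAt
  let e₀ := hfx.toOpenPartialHomeomorph f hd (by simp)
  -- Invertibility of the derivative is an open condition; restricting the source to it makes the
  -- inverse smooth at every point of the target, not only at `f x`.
  let U : Set X := {y ∈ O | fderiv ℝ f y ∈ range ((↑) : (X ≃L[ℝ] X') → X →L[ℝ] X')}
  have hU : IsOpen U := (hf.continuousOn_fderiv_of_isOpen hO (by simp)).isOpen_inter_preimage hO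
    ContinuousLinearEquiv.isOpen
  have hxU : x ∈ U := ⟨hx, f', hf'.symm⟩
  refine ⟨e₀.restrOpen U hU, ⟨hfx.mem_toOpenPartialHomeomorph_source hd (by simp), hxU⟩,
    fun y hy => hy.2.1, rfl, fun y hy => ?_⟩
  have hy' : (e₀.restrOpen U hU).symm y ∈ U := ((e₀.restrOpen U hU).map_target hy).2
  obtain ⟨A, hA⟩ := hy'.2
  have hc : ContDiffAt ℝ ∞ f ((e₀.restrOpen U hU).symm y) := hf.contDiffAt (hO.mem_nhds hy'.1)
  exact ((e₀.restrOpen U hU).contDiffAt_symm hy (f₀' := A)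
    (hA ▸ (hc.differentiableAt (by simp)).hasFDerivAt) hc).contDiffWithinAt

/-- An immersion has local smooth left inverses. -/
theorem ContDiffOn.exists_smooth_leftInverse [FiniteDimensional ℝ X] [FiniteDimensional ℝ Y]
    {O : Set X} (hO : IsOpen O) {G : X → Y} (hG : ContDiffOn ℝ ∞ G O) {x : X} (hx : x ∈ O)
    (hinj : Function.Injective (fderiv ℝ G x)) :
    ∃ N ∈ 𝓝 x, ∃ T : Set Y, IsOpen T ∧ ∃ g : Y → X, ContDiffOn ℝ ∞ g T ∧
      ∀ y ∈ N, G y ∈ T ∧ g (G y) = y := by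
  obtain ⟨A, hA⟩ := (fderiv ℝ G x : X →ₗ[ℝ] Y).exists_leftInverse_of_injective
    (LinearMap.ker_eq_bot.2 hinj)
  let A' : Y →L[ℝ] X := LinearMap.toContinuousLinearMap A
  have hGx : DifferentiableAt ℝ G x :=
    (hG.contDiffAt (hO.mem_nhds hx)).differentiableAt (by simp)
  -- For a linear left inverse `A'` of the differential, `A' ∘ G` has derivative the identity at
  -- `x`; its local inverse composed with `A'` is the left inverse of `G`.
  obtain ⟨e, hxe, heO, hef, hes⟩ := ContDiffOn.exists_openPartialHomeomorph hO
    (A'.contDiff.comp_contDiffOn hG) hx (ContinuousLinearEquiv.refl ℝ X) (by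
      rw [fderiv_comp x A'.differentiableAt hGx, A'.fderiv]
      ext v
      exact LinearMap.congr_fun hA v)
  refine ⟨e.source, e.open_source.mem_nhds hxe, A' ⁻¹' e.target,
    e.open_target.preimage A'.continuous, e.symm ∘ A',
    hes.comp A'.contDiff.contDiffOn (fun _ h => h), fun y hy => ⟨?_, ?_⟩⟩
  · have := e.map_source hy
    rwa [hef] at this
  · have := e.left_inv hy
    rwa [hef] at this

theorem ContDiffAt.fderiv_fderiv_comm {f : X → Y} {x : X} (hf : ContDiffAt ℝ ∞ f x) (a b : X) :
    fderiv ℝ (fderiv ℝ f) x a b = fderiv ℝ (fderiv ℝ f) x b a :=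
  (hf.isSymmSndFDerivAt (by simpa using WithTop.coe_le_coe.2 (le_top : (2 : ℕ∞) ≤ ⊤))) a b

/-- If the one-form `σ(v, dζ)` is exact, then its exterior derivative vanishes. -/
theorem isotropic_of_exact {σ : Z →L[ℝ] Z →L[ℝ] ℝ} {B : Set V} (hB : IsOpen B)
    {ζ v : V → Z} (hζ : ContDiffOn ℝ ∞ ζ B) (hv : ContDiffOn ℝ ∞ v B) {f : V → ℝ}
    (hf : ∀ y ∈ B, HasFDerivAt f ((σ (v y)).comp (fderiv ℝ ζ y)) y) {y : V} (hy : y ∈ B)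
    (a b : V) :
    σ (fderiv ℝ v y a) (fderiv ℝ ζ y b) = σ (fderiv ℝ v y b) (fderiv ℝ ζ y a) := by
  have hBy := hB.mem_nhds hy
  have hζ1 : DifferentiableAt ℝ (fderiv ℝ ζ) y :=
    ((hζ.contDiffAt hBy).fderiv_right (m := ∞) (by simp)).differentiableAt (by simp)
  have hv1 : DifferentiableAt ℝ v y := (hv.contDiffAt hBy).differentiableAt (by simp)
  have hσ : HasFDerivAt (fun y => σ (v y)) (σ.comp (fderiv ℝ v y)) y :=
    σ.hasFDerivAt.comp y hv1.hasFDerivAt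
  have h2 := hσ.clm_comp hζ1.hasFDerivAt
  -- The derivative of `df = σ(v, dζ)` has two terms. The one with the second derivative of `ζ` is
  -- symmetric by itself, so symmetry of the second derivative of `f` leaves the claim.
  have hsymm := second_derivative_symmetric_of_eventually
    (eventually_of_mem hBy hf) h2 a b
  have hc := (hζ.contDiffAt hBy).fderiv_fderiv_comm a b
  simp only [add_apply, ContinuousLinearMap.comp_apply,
    ContinuousLinearMap.compL_apply, ContinuousLinearMap.flip_apply] at hsymm
  rw [hc] at hsymm
  linarith


/-- At a critical point of a Morse family `H`, the map `(ζ, u) ↦ (ζ, dH(ζ, u))` is an immersion. -/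
theorem injective_fderiv_of_morse [FiniteDimensional ℝ W] {H : Z × W → ℝ} {p : Z × W}
    (hH : ContDiffAt ℝ ∞ H p)
    (hM : Function.Surjective
      (fderiv ℝ (fun q => (fderiv ℝ H q).comp (ContinuousLinearMap.inr ℝ Z W)) p)) :
    Function.Injective (fderiv ℝ (fun q : Z × W => (q.1, fderiv ℝ H q)) p) := by
  have hd : DifferentiableAt ℝ (fderiv ℝ H) p :=
    (hH.fderiv_right (m := ∞) (by simp)).differentiableAt (by simp)
  have h1 : HasFDerivAt (fun q : Z × W => (q.1, fderiv ℝ H q))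
      ((ContinuousLinearMap.fst ℝ Z W).prod (fderiv ℝ (fderiv ℝ H) p)) p :=
    hasFDerivAt_fst.prodMk hd.hasFDerivAt
  have h2 : ∀ a w, fderiv ℝ (fun q => (fderiv ℝ H q).comp (ContinuousLinearMap.inr ℝ Z W)) p a w
      = fderiv ℝ (fderiv ℝ H) p a (0, w) := fun a w => by
    rw [(hd.hasFDerivAt.clm_comp (hasFDerivAt_const (ContinuousLinearMap.inr ℝ Z W) p)).fderiv]
    simp
  rw [h1.fderiv, injective_iff_map_eq_zero]
  rintro ⟨a, w⟩ ha
  simp only [ContinuousLinearMap.prod_apply, ContinuousLinearMap.coe_fst', Prod.mk_eq_zero] at ha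
  obtain ⟨rfl, ha⟩ := ha
  -- A kernel vector has the form `(0, w)` with `D²H(0, w) = 0`. By symmetry of `D²H`, `w` is
  -- annihilated by the whole range of the derivative of `∂H/∂u`, which consists of all functionals.
  suffices w = 0 by simp [this]
  by_contra hw
  obtain ⟨l, hl⟩ := SeparatingDual.exists_ne_zero (R := ℝ) hw
  obtain ⟨c, rfl⟩ := hM l
  rw [h2, hH.fderiv_fderiv_comm, ha] at hl
  simp at hl

/-- A smooth map whose values are critical covectors of a Morse family `H` is isotropic. -/
theorem isotropic_of_morse [FiniteDimensional ℝ Z] [FiniteDimensional ℝ W] [FiniteDimensional ℝ V]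
    {σ : Z →L[ℝ] Z →L[ℝ] ℝ} {Ω : Set (Z × W)} (hΩ : IsOpen Ω) {H : Z × W → ℝ}
    (hH : ContDiffOn ℝ ∞ H Ω)
    (hM : ∀ p ∈ Ω, (fderiv ℝ H p).comp (ContinuousLinearMap.inr ℝ Z W) = 0 → Function.Surjective
      (fderiv ℝ (fun q => (fderiv ℝ H q).comp (ContinuousLinearMap.inr ℝ Z W)) p))
    {B : Set V} (hB : IsOpen B) {ζ v : V → Z} (hζ : ContDiffOn ℝ ∞ ζ B)
    (hv : ContDiffOn ℝ ∞ v B)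
    (hex : ∀ y ∈ B, ∃ u, (ζ y, u) ∈ Ω ∧
      fderiv ℝ H (ζ y, u) = (σ (v y)).comp (ContinuousLinearMap.fst ℝ Z W))
    {y : V} (hy : y ∈ B) (a b : V) :
    σ (fderiv ℝ v y a) (fderiv ℝ ζ y b) = σ (fderiv ℝ v y b) (fderiv ℝ ζ y a) := by
  set C : Set (Z × W) :=
    {p | p ∈ Ω ∧ (fderiv ℝ H p).comp (ContinuousLinearMap.inr ℝ Z W) = 0}
  have hDH : ContDiffOn ℝ ∞ (fderiv ℝ H) Ω := hH.fderiv_of_isOpen hΩ (by simp)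
  have hloc : ∀ p ∈ C, ∃ K ∈ 𝓝 p, IsCompact K ∧ K ⊆ Ω ∧
      ∃ T : Set (Z × (Z × W →L[ℝ] ℝ)), IsOpen T ∧ ∃ g : Z × (Z × W →L[ℝ] ℝ) → Z × W,
        ContDiffOn ℝ ∞ g T ∧ ∀ q ∈ K, (q.1, fderiv ℝ H q) ∈ T ∧ g (q.1, fderiv ℝ H q) = q := by
    intro p hp
    obtain ⟨N, hN, T, hT, g, hg, hgN⟩ := ContDiffOn.exists_smooth_leftInverse hΩ
      (contDiff_fst.contDiffOn.prodMk hDH) hp.1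
      (injective_fderiv_of_morse (hH.contDiffAt (hΩ.mem_nhds hp.1)) (hM p hp.1 hp.2))
    obtain ⟨K, hK, hKN, hKc⟩ := local_compact_nhds (inter_mem hN (hΩ.mem_nhds hp.1))
    exact ⟨K, hK, hKc, fun q hq => (hKN hq).2, T, hT, g, hg, fun q hq => hgN q (hKN hq).1⟩
  choose! K hK hKc hKΩ T hT g hg hgK using hloc
  -- Lindelöf: countably many of the compact neighbourhoods cover the critical set, which is what
  -- Baire's theorem needs.
  obtain ⟨t, htC, htc, htcov⟩ := TopologicalSpace.countable_cover_nhdsWithin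
    (fun p hp => mem_nhdsWithin_of_mem_nhds (hK p hp))
  -- A nonzero defect would stay nonzero on a ball around `y`; the rest of the proof finds a point
  -- of that ball where it vanishes.
  by_contra hne
  have hζ' := hζ.continuousOn_fderiv_of_isOpen hB (by simp)
  have hv' := hv.continuousOn_fderiv_of_isOpen hB (by simp)
  have hcont : ContinuousOn (fun y => σ (fderiv ℝ v y a) (fderiv ℝ ζ y b)
      - σ (fderiv ℝ v y b) (fderiv ℝ ζ y a)) B :=
    ((σ.continuous.comp_continuousOn (hv'.clm_apply continuousOn_const)).clm_apply
      (hζ'.clm_apply continuousOn_const)).sub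
    ((σ.continuous.comp_continuousOn (hv'.clm_apply continuousOn_const)).clm_apply
      (hζ'.clm_apply continuousOn_const))
  have hB' := hcont.isOpen_inter_preimage hB (isOpen_compl_singleton (x := (0 : ℝ)))
  obtain ⟨ε, hε, hεB⟩ := Metric.nhds_basis_closedBall.mem_iff.1
    (hB'.mem_nhds ⟨hy, by simpa [sub_eq_zero] using hne⟩)
  have := htc.to_subtype
  have hsub : Metric.closedBall y ε ⊆ B := fun z hz => (hεB hz).1
  -- The points of the closed ball whose control can be taken in `K p`. The redundant factor
  -- `Prod.snd '' K p` confines the pairs to a compact set, so that the projection is closed.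
  let S : t → Set V := fun p => Prod.fst '' {q : V × W |
    (q ∈ Metric.closedBall y ε ×ˢ (Prod.snd '' K p) ∧ (ζ q.1, q.2) ∈ K p) ∧
      fderiv ℝ H (ζ q.1, q.2) - (σ (v q.1)).comp (ContinuousLinearMap.fst ℝ Z W) = 0}
  have hS : ∀ p, IsClosed (S p) := by
    rintro ⟨p, hp⟩
    have hc : IsCompact (Metric.closedBall y ε ×ˢ (Prod.snd '' K p)) :=
      (isCompact_closedBall y ε).prod ((hKc p (htC hp)).image continuous_snd)
    have h1 : ContinuousOn (fun q : V × W => (ζ q.1, q.2))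
        (Metric.closedBall y ε ×ˢ (Prod.snd '' K p)) :=
      (hζ.continuousOn.comp continuousOn_fst (fun q hq => hsub hq.1)).prodMk continuousOn_snd
    have h2 := h1.preimage_isClosed_of_isClosed hc.isClosed (hKc p (htC hp)).isClosed
    have h3 : ContinuousOn (fun q : V × W => fderiv ℝ H (ζ q.1, q.2)
        - (σ (v q.1)).comp (ContinuousLinearMap.fst ℝ Z W))
        (Metric.closedBall y ε ×ˢ (Prod.snd '' K p) ∩ (fun q : V × W => (ζ q.1, q.2)) ⁻¹' K p) := by
      have h4 : ContinuousOn (fun q : V × W => v q.1) (Metric.closedBall y ε ×ˢ (Prod.snd '' K p)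
          ∩ (fun q : V × W => (ζ q.1, q.2)) ⁻¹' K p) :=
        hv.continuousOn.comp continuousOn_fst (fun q hq => hsub hq.1.1)
      have h5 := hDH.continuousOn.comp (h1.mono inter_subset_left)
        (fun q hq => hKΩ p (htC hp) hq.2)
      exact h5.sub ((σ.continuous.comp_continuousOn h4).clm_comp continuousOn_const)
    have h4 := h3.preimage_isClosed_of_isClosed h2 (isClosed_singleton (x := 0))
    exact ((hc.of_isClosed_subset h4 (fun q hq => hq.1.1)).image continuous_fst).isClosed
  -- Adding the complement of the open ball makes these closed sets cover all of `V`, while its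
  -- interior misses the ball.
  let S' : Option t → Set V := fun o => o.elim (Metric.ball y ε)ᶜ S
  have hS' : ∀ o, IsClosed (S' o) := by
    rintro (_ | p)
    exacts [Metric.isOpen_ball.isClosed_compl, hS p]
  have hcov : ⋃ o, S' o = univ := by
    refine eq_univ_of_forall fun z => mem_iUnion.2 ?_
    by_cases hz : z ∈ Metric.ball y ε
    · have hzB := Metric.ball_subset_closedBall hz
      obtain ⟨u, hu, hu'⟩ := hex z (hsub hzB)
      obtain ⟨p, hp, hpu⟩ := mem_iUnion₂.1 (htcov (show (ζ z, u) ∈ C from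
        ⟨hu, by ext w; simp [hu']⟩))
      exact ⟨some ⟨p, hp⟩, (z, u), ⟨⟨⟨hzB, (ζ z, u), hpu, rfl⟩, hpu⟩, by simp [hu']⟩, rfl⟩
    · exact ⟨none, hz⟩
  obtain ⟨z, hz, hzS⟩ := (dense_iUnion_interior_of_closed hS' hcov).inter_open_nonempty _
    Metric.isOpen_ball ⟨y, Metric.mem_ball_self hε⟩
  obtain ⟨o, ho⟩ := mem_iUnion.1 hzS
  rcases o with _ | ⟨p, hp⟩
  · exact interior_subset ho hz
  have hint : ∀ x ∈ interior (S ⟨p, hp⟩), x ∈ Metric.closedBall y ε ∧ ∃ u, (ζ x, u) ∈ K p ∧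
      fderiv ℝ H (ζ x, u) = (σ (v x)).comp (ContinuousLinearMap.fst ℝ Z W) := by
    intro x hx
    obtain ⟨⟨x, u⟩, ⟨⟨hq, hK'⟩, he⟩, rfl⟩ := interior_subset hx
    exact ⟨hq.1, u, hK', sub_eq_zero.1 he⟩
  have hpC := htC hp
  -- On the interior of `S p` the left inverse recovers the pair `(ζ x, u)` from `ζ x` and `dH(ζ x,
  -- u) = σ(v x) ∘ fst`, so this control depends smoothly on `x`.
  let q : V → Z × W := fun x => g p (ζ x, (σ (v x)).comp (ContinuousLinearMap.fst ℝ Z W))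
  have hq : ∀ x ∈ interior (S ⟨p, hp⟩),
      (ζ x, (σ (v x)).comp (ContinuousLinearMap.fst ℝ Z W)) ∈ T p ∧ q x ∈ Ω ∧ (q x).1 = ζ x ∧
      fderiv ℝ H (q x) = (σ (v x)).comp (ContinuousLinearMap.fst ℝ Z W) := by
    intro x hx
    obtain ⟨-, u, hu, he⟩ := hint x hx
    obtain ⟨h1, h2⟩ := hgK p hpC _ hu
    simp only [he] at h1 h2
    refine ⟨h1, ?_⟩
    simp only [q, h2]
    exact ⟨hKΩ p hpC hu, trivial, he⟩
  have hIB : interior (S ⟨p, hp⟩) ⊆ B := fun x hx => hsub (hint x hx).1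
  have hqs : ContDiffOn ℝ ∞ q (interior (S ⟨p, hp⟩)) := by
    refine (hg p hpC).comp ((hζ.mono hIB).prodMk ?_) (fun x hx => (hq x hx).1)
    exact (σ.contDiff.comp_contDiffOn (hv.mono hIB)).clm_comp contDiffOn_const
  -- The potential is `H ∘ q`: the `u`-part of `dH` vanishes along `q`, so the chain rule gives `d(H
  -- ∘ q) = σ(v, dζ)`.
  have hfin := isotropic_of_exact (σ := σ) (f := H ∘ q) isOpen_interior (hζ.mono hIB)
    (hv.mono hIB) (fun x hx => by
      have hqx : DifferentiableAt ℝ q x :=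
        (hqs.contDiffAt (isOpen_interior.mem_nhds hx)).differentiableAt (by simp)
      have hHx : DifferentiableAt ℝ H (q x) :=
        (hH.contDiffAt (hΩ.mem_nhds (hq x hx).2.1)).differentiableAt (by simp)
      have h1 := hHx.hasFDerivAt.comp x hqx.hasFDerivAt
      have h2 : fderiv ℝ ζ x = (ContinuousLinearMap.fst ℝ Z W).comp (fderiv ℝ q x) := by
        rw [← (hasFDerivAt_fst.comp x hqx.hasFDerivAt).fderiv]
        have h3 : ζ =ᶠ[𝓝 x] Prod.fst ∘ q := eventually_of_mem (isOpen_interior.mem_nhds hx)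
          (fun x' hx' => (hq x' hx').2.2.1.symm)
        exact h3.fderiv_eq
      rwa [(hq x hx).2.2.2, ContinuousLinearMap.comp_assoc, ← h2] at h1) ho a b
  exact (hεB (hint z ho).1).2 (by simp [hfin])

end Calculus

/-! ### The dimension count for Lagrangian subspaces of a presymplectic space. -/

section LinearAlgebra

variable {T : Type*} [AddCommGroup T] [Module ℝ T] [FiniteDimensional ℝ T]

/-- An isotropic subspace with an isotropic complement (not necessarily disjoint) is Lagrangian. -/
theorem finrank_lagrangian {σ : T →ₗ[ℝ] T →ₗ[ℝ] ℝ} (hσ : ∀ v w, σ v w = - σ w v)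
    {P L K N : Submodule ℝ T} (hLP : L ≤ P) (hL : ∀ v ∈ L, ∀ w ∈ L, σ v w = 0)
    (hN : ∀ v ∈ N, ∀ w ∈ N, σ v w = 0) (hP : ∀ v ∈ P, ∃ l ∈ L, v - l ∈ N)
    (hK : ∀ v, v ∈ K ↔ v ∈ P ∧ ∀ w ∈ P, σ v w = 0) :
    (Module.finrank ℝ L : ℝ) = ((Module.finrank ℝ P : ℝ) - Module.finrank ℝ K) / 2
      + Module.finrank ℝ (L ⊓ K : Submodule ℝ T) := by
  let ψ : L →ₗ[ℝ] Module.Dual ℝ P := (σ.domRestrict₁₂ L P)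
  -- Up to the identification of `P` with its double dual, `ψ.flip` is the transpose of `ψ`, so both
  -- have the same rank.
  have hflip : Module.finrank ℝ (LinearMap.range ψ.flip) = Module.finrank ℝ (LinearMap.range ψ) := by
    have h1 : ψ.flip = ψ.dualMap ∘ₗ (Module.evalEquiv ℝ P : P →ₗ[ℝ] _) := by ext; rfl
    rw [h1, LinearMap.range_comp_of_range_eq_top _ (LinearEquiv.range _),
      LinearMap.finrank_range_dualMap_eq_finrank_range]
  have hKP : K ≤ P := fun v hv => ((hK v).1 hv).1
  have hker : LinearMap.ker ψ = (L ⊓ K).comap L.subtype := by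
    ext ⟨l, hl⟩
    simp only [LinearMap.mem_ker, Submodule.mem_comap, Submodule.subtype_apply, Submodule.mem_inf,
      hl, true_and, hK, hLP hl]
    exact ⟨fun h w hw => LinearMap.congr_fun h ⟨w, hw⟩, fun h => LinearMap.ext fun w => h w w.2⟩
  have hker' : LinearMap.ker ψ.flip = (L ⊔ K).comap P.subtype := by
    ext ⟨p, hp⟩
    simp only [LinearMap.mem_ker, Submodule.mem_comap, Submodule.subtype_apply]
    constructor
    · intro h
      have h' : ∀ l ∈ L, σ l p = 0 := fun l hl => LinearMap.congr_fun h ⟨l, hl⟩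
      -- If `p` is orthogonal to `L`, then so is `p - l`, as `L` is isotropic. Being in `N`, it is
      -- also orthogonal to the `N`-part of every `w ∈ P`. Hence `p - l ∈ K`.
      obtain ⟨l, hl, hpl⟩ := hP p hp
      refine Submodule.mem_sup.2 ⟨l, hl, p - l, (hK _).2 ⟨P.sub_mem hp (hLP hl), fun w hw => ?_⟩,
        by abel⟩
      obtain ⟨l', hl', hwl⟩ := hP w hw
      have h1 := hN _ hpl _ hwl
      have h2 : σ (p - l) l' = 0 := by
        rw [hσ, map_sub, h' l' hl', hL _ hl' _ hl, sub_zero, neg_zero]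
      rwa [map_sub, h2, sub_zero] at h1
    · intro h
      obtain ⟨l, hl, k, hk, rfl⟩ := Submodule.mem_sup.1 h
      refine LinearMap.ext fun w => ?_
      change σ w (l + k) = 0
      rw [map_add, hL _ w.2 _ hl, hσ, ((hK k).1 hk).2 _ (hLP w.2), neg_zero, add_zero]
  -- Comparing ranks gives `dim L - dim (L ⊓ K) = dim P - dim (L ⊔ K)`; the formula for `dim (L ⊔
  -- K)` then turns this into the claim.
  have e1 := ψ.finrank_range_add_finrank_ker
  have e2 := ψ.flip.finrank_range_add_finrank_ker
  rw [hker, (Submodule.comapSubtypeEquivOfLe (inf_le_left : L ⊓ K ≤ L)).finrank_eq] at e1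
  rw [hker', (Submodule.comapSubtypeEquivOfLe (sup_le hLP hKP)).finrank_eq, hflip] at e2
  have e3 := Submodule.finrank_sup_add_finrank_inf_eq L K
  have e1' : (Module.finrank ℝ (LinearMap.range ψ) : ℝ)
      + Module.finrank ℝ (L ⊓ K : Submodule ℝ T) = Module.finrank ℝ L := mod_cast e1
  have e2' : (Module.finrank ℝ (LinearMap.range ψ) : ℝ)
      + Module.finrank ℝ (L ⊔ K : Submodule ℝ T) = Module.finrank ℝ P := mod_cast e2
  have e3' : (Module.finrank ℝ (L ⊔ K : Submodule ℝ T) : ℝ)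
      + Module.finrank ℝ (L ⊓ K : Submodule ℝ T)
      = Module.finrank ℝ L + Module.finrank ℝ K := mod_cast e3
  linarith

end LinearAlgebra

/-! ### Chart expressions, the inverse function theorem on manifolds, and spans of velocities. -/

section Manifolds

variable {F : Type*} [NormedAddCommGroup F] [NormedSpace ℝ F]
  {H : Type*} [TopologicalSpace H] {I : ModelWithCorners ℝ F H}
  {M : Type*} [TopologicalSpace M] [ChartedSpace H M]
  {F' : Type*} [NormedAddCommGroup F'] [NormedSpace ℝ F']
  {H' : Type*} [TopologicalSpace H'] {I' : ModelWithCorners ℝ F' H'}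
  {M' : Type*} [TopologicalSpace M'] [ChartedSpace H' M']
  {V : Type*} [NormedAddCommGroup V] [NormedSpace ℝ V]

theorem MDifferentiableAt.mfderiv_eq_fderiv [I.Boundaryless] {f : M → M'} {x : M}
    (hf : MDifferentiableAt I I' f x) :
    mfderiv I I' f x =
      fderiv ℝ (extChartAt I' (f x) ∘ f ∘ (extChartAt I x).symm) (extChartAt I x x) := by
  rw [hf.mfderiv, I.range_eq_univ, fderivWithin_univ]
  rfl

theorem MDifferentiableAt.mfderiv_eq_fderiv_of_model {f : V → M'} {x : V}
    (hf : MDifferentiableAt 𝓘(ℝ, V) I' f x) :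
    mfderiv 𝓘(ℝ, V) I' f x = fderiv ℝ (extChartAt I' (f x) ∘ f) x := by
  rw [hf.mfderiv_eq_fderiv]
  simp only [extChartAt_model_space_eq_id]
  rfl

/-- The expression in charts of a smooth function is smooth. -/
theorem ContMDiffOn.contDiffOn_chart [IsManifold I ∞ M] [IsManifold I' ∞ M']
    {f : M → M'} {s : Set M} (hf : ContMDiffOn I I' ∞ f s) (x : M) (y : M') :
    ContDiffOn ℝ ∞ (extChartAt I' y ∘ f ∘ (extChartAt I x).symm)
      ((extChartAt I x).target ∩ (extChartAt I x).symm ⁻¹'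
        (s ∩ f ⁻¹' (extChartAt I' y).source)) := by
  rw [← contMDiffOn_iff_contDiffOn]
  refine (contMDiffOn_extChartAt (n := ∞) (x := y)).comp
    (hf.comp ((contMDiffOn_extChartAt_symm x).mono inter_subset_left) fun z hz => hz.2.1)
    fun z hz => ?_
  simpa using hz.2.2

theorem isOpen_chart_inter [I.Boundaryless] {f : M → M'} {s : Set M} (hs : IsOpen s)
    (hf : ContinuousOn f s) (x : M) {t : Set M'} (ht : IsOpen t) :
    IsOpen ((extChartAt I x).target ∩ (extChartAt I x).symm ⁻¹' (s ∩ f ⁻¹' t)) :=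
  (continuousOn_extChartAt_symm x).isOpen_inter_preimage (isOpen_extChartAt_target x)
    (hf.isOpen_inter_preimage hs ht)

/-- The inverse function theorem on manifolds. -/
theorem ContMDiffOn.exists_local_inverse [CompleteSpace F] [I.Boundaryless] [I'.Boundaryless]
    [IsManifold I ∞ M] [IsManifold I' ∞ M'] {s : Set M} (hs : IsOpen s) {f : M → M'}
    (hf : ContMDiffOn I I' ∞ f s) {x : M} (hx : x ∈ s) (A : F ≃L[ℝ] F')
    (hA : mfderiv I I' f x = (A : F →L[ℝ] F')) :
    ∃ U ⊆ s, IsOpen U ∧ x ∈ U ∧ IsOpen (f '' U) ∧ ∃ g : M' → M,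
      ContMDiffOn I' I ∞ g (f '' U) ∧ ∀ y ∈ U, g (f y) = y := by
  let φ := extChartAt I x
  let ψ := extChartAt I' (f x)
  have hO := isOpen_chart_inter (I := I) hs hf.continuousOn x (isOpen_extChartAt_source (I := I') (f x))
  have hfx : MDifferentiableAt I I' f x :=
    (hf.contMDiffAt (hs.mem_nhds hx)).mdifferentiableAt (by simp)
  obtain ⟨e, hxe, heO, hef, hes⟩ := (hf.contDiffOn_chart x (f x)).exists_openPartialHomeomorph hO
    (x := φ x) ⟨mem_extChartAt_target x, by simp [φ, hx]⟩ A (by rw [← hA, hfx.mfderiv_eq_fderiv])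
  have hinv : ∀ z ∈ e.source, φ.symm z ∈ s ∧ ψ.symm (e z) = f (φ.symm z) := by
    intro z hz
    refine ⟨(heO hz).2.1, ?_⟩
    rw [hef]
    exact ψ.left_inv (heO hz).2.2
  have hU : IsOpen (φ.source ∩ φ ⁻¹' e.source) :=
    (continuousOn_extChartAt x).isOpen_inter_preimage (isOpen_extChartAt_source x) e.open_source
  -- In this form the image is visibly open and lies where `φ.symm ∘ e.symm ∘ ψ` is smooth.
  have himg : f '' (φ.source ∩ φ ⁻¹' e.source) = ψ.source ∩ ψ ⁻¹' e.target := by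
    ext y
    constructor
    · rintro ⟨u, ⟨hu, hue⟩, rfl⟩
      have h1 := (heO hue).2.2
      have h2 := e.map_source hue
      rw [hef] at h2
      simp only [mem_preimage, φ, Function.comp_apply, (extChartAt I x).left_inv hu] at h1 h2
      exact ⟨h1, h2⟩
    · rintro ⟨hy, hye⟩
      have h1 := e.map_target hye
      refine ⟨φ.symm (e.symm (ψ y)), ⟨φ.map_target (heO h1).1, ?_⟩, ?_⟩
      · simpa [φ.right_inv (heO h1).1] using h1
      · rw [← (hinv _ h1).2, e.right_inv hye, ψ.left_inv hy]
  refine ⟨_, ?_, hU, ⟨mem_extChartAt_source x, hxe⟩, ?_, φ.symm ∘ e.symm ∘ ψ, ?_, ?_⟩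
  · rintro u ⟨hu, hue⟩
    have := (hinv _ hue).1
    rwa [φ.left_inv hu] at this
  · rw [himg]
    exact (continuousOn_extChartAt (f x)).isOpen_inter_preimage (isOpen_extChartAt_source (f x))
      e.open_target
  · rw [himg]
    refine (contMDiffOn_extChartAt_symm (n := ∞) x).comp (hes.contMDiffOn.comp
      ((contMDiffOn_extChartAt (n := ∞) (x := f x)).mono fun y hy => ?_) fun y hy => hy.2)
      fun y hy => (heO (e.map_target hy.2)).1
    simpa [ψ] using hy.1
  · rintro u ⟨hu, hue⟩
    have h2 : e (φ u) = ψ (f u) := by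
      rw [hef]
      simp only [Function.comp_apply, φ, ψ, (extChartAt I x).left_inv hu]
    simp only [Function.comp_apply, ← h2, e.left_inv hue, φ.left_inv hu]

/-! ### Tangent spaces of subsets -/

theorem map_tangentSpaceOf_le {f : M → M'} {x : M} (hf : MDifferentiableAt I I' f x)
    {N : Set M} {N' : Set M'} (hN : ∀ᶠ y in 𝓝 x, y ∈ N → f y ∈ N') :
    (tangentSpaceOf I N x).map (mfderiv I I' f x).toLinearMap ≤ tangentSpaceOf I' N' (f x) := by
  rw [tangentSpaceOf, Submodule.map_span_le]
  rintro v ⟨γ, h0, hγN, hγ, hv⟩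
  subst h0
  refine Submodule.subset_span ⟨f ∘ γ, rfl, ?_, hf.comp 0 hγ, ?_⟩
  · filter_upwards [hγN, hγ.continuousAt.eventually hN] with t h1 h2 using h2 h1
  · rw [mfderiv_comp 0 hf hγ]
    exact congrArg (mfderiv I I' f (γ 0)) hv

theorem tangentSpaceOf_mono {N N' : Set M} (h : N ⊆ N') (x : M) :
    tangentSpaceOf I N x ≤ tangentSpaceOf I N' x :=
  Submodule.span_mono fun _ ⟨γ, h0, hγN, hγ⟩ => ⟨γ, h0, hγN.mono fun _ ht => h ht, hγ⟩

/-- The velocities of curves in the zero set of `g` lie in the kernel of the differential. -/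
theorem tangentSpaceOf_le_ker {N : Set M} {x : M} {g : M → V}
    (hg : MDifferentiableAt I 𝓘(ℝ, V) g x) (hN : ∀ᶠ y in 𝓝 x, y ∈ N → g y = 0) :
    tangentSpaceOf I N x ≤ LinearMap.ker (mfderiv I 𝓘(ℝ, V) g x).toLinearMap := by
  refine Submodule.span_le.2 ?_
  rintro v ⟨γ, h0, hγN, hγ, hv⟩
  subst h0
  have h1 : g ∘ γ =ᶠ[𝓝 0] fun _ => 0 := by
    filter_upwards [hγN, hγ.continuousAt.eventually hN] with t h1 h2 using h2 h1
  have h2 := h1.mfderiv_eq (I := 𝓘(ℝ, ℝ)) (I' := 𝓘(ℝ, V))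
  rw [mfderiv_comp 0 hg hγ, mfderiv_const] at h2
  have h3 := DFunLike.congr_fun h2 (show ℝ from 1)
  change mfderiv I 𝓘(ℝ, V) g (γ 0) v = 0
  exact (congrArg (mfderiv I 𝓘(ℝ, V) g (γ 0)) hv).symm.trans h3

theorem range_mfderiv_le_tangentSpaceOf {N : Set M} {c : V → M} {y : V}
    (hc : MDifferentiableAt 𝓘(ℝ, V) I c y) (hN : ∀ᶠ z in 𝓝 y, c z ∈ N) (v : V) :
    mfderiv 𝓘(ℝ, V) I c y v ∈ tangentSpaceOf I N (c y) := by
  have hl : HasFDerivAt (fun t : ℝ => y + t • v)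
      ((1 : ℝ →L[ℝ] ℝ).smulRight v) (0 : ℝ) :=
    ((1 : ℝ →L[ℝ] ℝ).smulRight v).hasFDerivAt.const_add y
  have hc' : MDifferentiableAt 𝓘(ℝ, V) I c ((fun t : ℝ => y + t • v) 0) := by simpa using hc
  have hl' : MDifferentiableAt 𝓘(ℝ, ℝ) 𝓘(ℝ, V) (fun t : ℝ => y + t • v) 0 :=
    hl.differentiableAt.mdifferentiableAt
  refine Submodule.subset_span ⟨fun t => c (y + t • v), by simp, ?_, hc'.comp 0 hl', ?_⟩
  · have : Tendsto (fun t : ℝ => y + t • v) (𝓝 0) (𝓝 y) := by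
      simpa using hl.continuousAt.tendsto
    exact this.eventually hN
  · have h := mfderiv_comp 0 hc' hl'
    have h2 : mfderiv 𝓘(ℝ, ℝ) 𝓘(ℝ, V) (fun t : ℝ => y + t • v) 0
        = ((1 : ℝ →L[ℝ] ℝ).smulRight v) := by
      rw [mfderiv_eq_fderiv, hl.fderiv]
    have h3 := DFunLike.congr_fun h (show ℝ from 1)
    refine h3.trans ?_
    change mfderiv 𝓘(ℝ, V) I c (y + (0 : ℝ) • v)
      (mfderiv 𝓘(ℝ, ℝ) 𝓘(ℝ, V) (fun t : ℝ => y + t • v) 0 (show ℝ from 1)) = _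
    rw [h2, zero_smul, add_zero]
    change mfderiv 𝓘(ℝ, V) I c y ((1 : ℝ) • v) = _
    rw [one_smul]

end Manifolds

/-! ### Parametrizations of regular zero sets in a vector space, and differentials of charts. -/

section Submanifolds

variable {F : Type*} [NormedAddCommGroup F] [NormedSpace ℝ F]
  {H : Type*} [TopologicalSpace H] {I : ModelWithCorners ℝ F H}
  {M : Type*} [TopologicalSpace M] [ChartedSpace H M]
  {F' : Type*} [NormedAddCommGroup F'] [NormedSpace ℝ F']
  {H' : Type*} [TopologicalSpace H'] {I' : ModelWithCorners ℝ F' H'}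
  {M' : Type*} [TopologicalSpace M'] [ChartedSpace H' M']
  {V : Type*} [NormedAddCommGroup V] [NormedSpace ℝ V]

/-- Near a regular point, a zero set is parametrized by the kernel of the differential. -/
theorem ContDiffOn.exists_parametrization [FiniteDimensional ℝ F] [FiniteDimensional ℝ V]
    {O : Set F} (hO : IsOpen O) {g : F → V} (hg : ContDiffOn ℝ ∞ g O) {x : F} (hx : x ∈ O)
    (hgx : g x = 0) (hs : Function.Surjective (fderiv ℝ g x)) {K : Submodule ℝ F}
    (hK : K = LinearMap.ker (fderiv ℝ g x).toLinearMap) :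
    ∃ (B : Set K) (c : K → F), IsOpen B ∧ 0 ∈ B ∧ ContDiffOn ℝ ∞ c B ∧ c 0 = x ∧
      fderiv ℝ c 0 = K.subtypeL ∧ ∀ k ∈ B, c k ∈ O ∧ g (c k) = 0 := by
  -- A projection `ϖ` onto the kernel completes `g` to the local diffeomorphism `y ↦ (g y, ϖ (y -
  -- x))`, which flattens the zero set; its inverse on `{0} × K` is the parametrization.
  obtain ⟨ϖ, hϖ⟩ := K.subtype.exists_leftInverse_of_injective K.ker_subtype
  have hϖK : ∀ k : K, ϖ k = k := fun k => LinearMap.congr_fun hϖ k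
  let ϖ' : F →L[ℝ] K := LinearMap.toContinuousLinearMap ϖ
  have hker : ∀ v, v ∈ K ↔ fderiv ℝ g x v = 0 := fun v => by rw [hK]; rfl
  have hgd : HasFDerivAt g (fderiv ℝ g x) x :=
    ((hg.contDiffAt (hO.mem_nhds hx)).differentiableAt (by simp)).hasFDerivAt
  have hbij : Function.Bijective ((fderiv ℝ g x).prod ϖ') := by
    constructor
    · rw [injective_iff_map_eq_zero]
      intro v hv
      obtain ⟨h1, h2⟩ := Prod.mk_eq_zero.1 hv
      have h3 := hϖK ⟨v, (hker v).2 h1⟩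
      exact (congrArg Subtype.val (h2.symm.trans h3)).symm
    · rintro ⟨a, k⟩
      obtain ⟨v, rfl⟩ := hs a
      refine ⟨v + ((k - ϖ v : K) : F), Prod.ext ?_ ?_⟩
      · change fderiv ℝ g x (v + ((k - ϖ v : K) : F)) = _
        rw [map_add, (hker _).1 (k - ϖ v).2, add_zero]
      · change ϖ (v + ((k - ϖ v : K) : F)) = k
        rw [map_add, hϖK]
        abel
  let A : F ≃L[ℝ] V × K := (LinearEquiv.ofBijective
    ((fderiv ℝ g x).prod ϖ').toLinearMap hbij).toContinuousLinearEquiv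
  have hd : HasFDerivAt (fun y => (g y, ϖ' (y - x))) (A : F →L[ℝ] V × K) x :=
    hgd.prodMk (ϖ'.hasFDerivAt.comp x ((hasFDerivAt_id x).sub_const x))
  obtain ⟨e, hxe, heO, hef, hes⟩ := ContDiffOn.exists_openPartialHomeomorph hO
    (hg.prodMk (ϖ'.contDiff.comp (contDiff_id.sub contDiff_const)).contDiffOn) hx A hd.fderiv
  have hex : e x = (0, 0) := by simp [hef, hgx]
  have h0 : ((0 : V), (0 : K)) ∈ e.target := hex ▸ e.map_source hxe
  have hB : IsOpen ((fun k : K => ((0 : V), k)) ⁻¹' e.target) :=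
    e.open_target.preimage (by fun_prop)
  refine ⟨_, fun k => e.symm (0, k), hB, h0,
    hes.comp (contDiff_const.prodMk contDiff_id).contDiffOn (fun _ h => h), ?_, ?_, ?_⟩
  · simp only [← hex, e.left_inv hxe]
  · have hsx : e.symm (0, 0) = x := by rw [← hex, e.left_inv hxe]
    have h1 : HasFDerivAt e.symm (A.symm : V × K →L[ℝ] F) ((0 : V), (0 : K)) :=
      e.hasFDerivAt_symm h0 (by rw [hsx, hef]; exact hd)
    have h2 : HasFDerivAt (fun k : K => ((0 : V), k)) (ContinuousLinearMap.inr ℝ V K) (0 : K) :=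
      (hasFDerivAt_const (0 : V) (0 : K)).prodMk (hasFDerivAt_id (0 : K))
    have h3 := (HasFDerivAt.comp (0 : K) h1 h2).fderiv
    rw [show (fun k => e.symm (0, k)) = e.symm ∘ fun k : K => ((0 : V), k) from rfl, h3]
    ext k
    change A.symm (0, k) = k
    rw [A.symm_apply_eq]
    exact Prod.ext ((hker _).1 k.2).symm (hϖK k).symm
  · intro k hk
    have h1 := e.right_inv hk
    rw [hef] at h1
    exact ⟨heO (e.map_target hk), congrArg Prod.fst h1⟩

/-- A right inverse `A'` of the differential at one point is kept fixed: its composite with the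
nearby differentials stays invertible, and this forces those to be surjective. -/
theorem isOpen_surjective_fderiv [FiniteDimensional ℝ V] {O : Set F} (hO : IsOpen O) {g : F → V}
    (hg : ContDiffOn ℝ ∞ g O) : IsOpen {x ∈ O | Function.Surjective (fderiv ℝ g x)} := by
  refine isOpen_iff_mem_nhds.2 fun x ⟨hx, hs⟩ => ?_
  obtain ⟨A, hA⟩ := (fderiv ℝ g x).toLinearMap.exists_rightInverse_of_surjective
    (LinearMap.range_eq_top.2 hs)
  let A' : V →L[ℝ] F := LinearMap.toContinuousLinearMap A
  have hc : ContinuousOn (fun y => (fderiv ℝ g y).comp A') O :=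
    (hg.continuousOn_fderiv_of_isOpen hO (by simp)).clm_comp continuousOn_const
  have hU := hc.isOpen_inter_preimage hO (ContinuousLinearEquiv.isOpen (𝕜 := ℝ) (E := V) (F := V))
  refine mem_of_superset (hU.mem_nhds ⟨hx, ContinuousLinearEquiv.refl ℝ V, ?_⟩) ?_
  · ext v
    exact (LinearMap.congr_fun hA v).symm
  · rintro y ⟨hy, e, he⟩
    refine ⟨hy, fun v => ⟨A' (e.symm v), ?_⟩⟩
    have := DFunLike.congr_fun he (e.symm v)
    simpa using! this.symm

theorem mfderiv_extChartAt_bijective [I.Boundaryless] [IsManifold I ∞ M] {x y : M}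
    (hy : y ∈ (extChartAt I x).source) :
    (mfderiv I 𝓘(ℝ, F) (extChartAt I x) y).comp
        (mfderiv 𝓘(ℝ, F) I (extChartAt I x).symm (extChartAt I x y)) =
      ContinuousLinearMap.id ℝ F ∧
    (mfderiv 𝓘(ℝ, F) I (extChartAt I x).symm (extChartAt I x y)).comp
        (mfderiv I 𝓘(ℝ, F) (extChartAt I x) y) = ContinuousLinearMap.id ℝ _ := by
  have h1 := mfderiv_extChartAt_comp_mfderivWithin_extChartAt_symm' (I := I) hy
  have h2 := mfderivWithin_extChartAt_symm_comp_mfderiv_extChartAt' (I := I) hy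
  rw [I.range_eq_univ, mfderivWithin_univ] at h1 h2
  exact ⟨h1, h2⟩

end Submanifolds

/-! ### Tangent spaces of submanifolds, and images under injective local diffeomorphisms. -/

section Submanifolds

variable {F : Type*} [NormedAddCommGroup F] [NormedSpace ℝ F]
  {H : Type*} [TopologicalSpace H] {I : ModelWithCorners ℝ F H}
  {M : Type*} [TopologicalSpace M] [ChartedSpace H M]
  {F' : Type*} [NormedAddCommGroup F'] [NormedSpace ℝ F']
  {H' : Type*} [TopologicalSpace H'] {I' : ModelWithCorners ℝ F' H'}
  {M' : Type*} [TopologicalSpace M'] [ChartedSpace H' M']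
  {V : Type*} [NormedAddCommGroup V] [NormedSpace ℝ V]

theorem MDifferentiableAt.mfderiv_eq_fderiv_comp_symm [I.Boundaryless] {g : M → V} {x : M}
    (hg : MDifferentiableAt I 𝓘(ℝ, V) g x) :
    mfderiv I 𝓘(ℝ, V) g x = fderiv ℝ (g ∘ (extChartAt I x).symm) (extChartAt I x x) := by
  rw [hg.mfderiv_eq_fderiv]
  simp only [extChartAt_model_space_eq_id]
  rfl

theorem ContMDiffOn.contDiffOn_comp_symm [IsManifold I ∞ M] {g : M → V} {s : Set M}
    (hg : ContMDiffOn I 𝓘(ℝ, V) ∞ g s) (x : M) :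
    ContDiffOn ℝ ∞ (g ∘ (extChartAt I x).symm)
      ((extChartAt I x).target ∩ (extChartAt I x).symm ⁻¹' s) := by
  rw [← contMDiffOn_iff_contDiffOn]
  exact hg.comp ((contMDiffOn_extChartAt_symm x).mono inter_subset_left) fun z hz => hz.2

/-- Choosing a basis of the target replaces `V` by `Fin c → ℝ`. Defining functions can thus take
values in any space of the right dimension, such as a product. -/
theorem exists_defining_function [FiniteDimensional ℝ V] {d : ℕ} {N O : Set M} (hO : IsOpen O) {g : M → V}
    (hg : ContMDiffOn I 𝓘(ℝ, V) ∞ g O) {x : M} (hx : x ∈ O)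
    (hs : Function.Surjective (mfderiv I 𝓘(ℝ, V) g x)) (hN : ∀ y ∈ O, y ∈ N ↔ g y = 0)
    (hd : Module.finrank ℝ V + d = Module.finrank ℝ F) :
    ∃ (c : ℕ) (O : Set M) (g : M → (Fin c → ℝ)),
      c + d = Module.finrank ℝ F ∧ IsOpen O ∧ x ∈ O ∧
      ContMDiffOn I 𝓘(ℝ, Fin c → ℝ) ∞ g O ∧
      Function.Surjective (mfderiv I 𝓘(ℝ, Fin c → ℝ) g x) ∧
      ∀ y ∈ O, y ∈ N ↔ g y = 0 := by
  let L : V ≃L[ℝ] (Fin (Module.finrank ℝ V) → ℝ) :=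
    ContinuousLinearEquiv.ofFinrankEq (by simp)
  refine ⟨_, O, L ∘ g, hd, hO, hx, L.contDiff.contMDiff.comp_contMDiffOn hg, ?_, fun y hy => ?_⟩
  · rw [mfderiv_comp x L.differentiableAt.mdifferentiableAt
      ((hg.contMDiffAt (hO.mem_nhds hx)).mdifferentiableAt (by simp)), mfderiv_eq_fderiv, L.fderiv]
    exact L.surjective.comp hs
  · simp [hN y hy]

variable [I.Boundaryless] [IsManifold I ∞ M] [FiniteDimensional ℝ F] [FiniteDimensional ℝ V]

/-- A regular zero set is locally parametrized by its tangent space. -/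
theorem exists_parametrization_of_regular {N O : Set M} (hO : IsOpen O) {g : M → V}
    (hg : ContMDiffOn I 𝓘(ℝ, V) ∞ g O) {x : M} (hx : x ∈ O) (hgx : g x = 0)
    (hs : Function.Surjective (mfderiv I 𝓘(ℝ, V) g x)) (hN : ∀ y ∈ O, g y = 0 → y ∈ N)
    {K : Submodule ℝ F} (hK : K = LinearMap.ker (mfderiv I 𝓘(ℝ, V) g x).toLinearMap) :
    ∃ (B : Set K) (c : K → M), IsOpen B ∧ 0 ∈ B ∧ ContMDiffOn 𝓘(ℝ, K) I ∞ c B ∧ c 0 = x ∧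
      mfderiv 𝓘(ℝ, K) I c 0 = K.subtypeL ∧ MapsTo c B N := by
  have hO' : IsOpen ((extChartAt I x).target ∩ (extChartAt I x).symm ⁻¹' O) :=
    (continuousOn_extChartAt_symm x).isOpen_inter_preimage (isOpen_extChartAt_target x) hO
  have hgd : MDifferentiableAt I 𝓘(ℝ, V) g x :=
    (hg.contMDiffAt (hO.mem_nhds hx)).mdifferentiableAt (by simp)
  rw [hgd.mfderiv_eq_fderiv_comp_symm] at hs hK
  obtain ⟨B, c, hB, h0, hc, hc0, hcd, hcB⟩ := (hg.contDiffOn_comp_symm x).exists_parametrization hO'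
    (x := extChartAt I x x) ⟨mem_extChartAt_target x, by simpa using hx⟩ (by simpa using hgx) hs hK
  have hcs : ContMDiffOn 𝓘(ℝ, K) I ∞ ((extChartAt I x).symm ∘ c) B :=
    (contMDiffOn_extChartAt_symm x).comp hc.contMDiffOn fun k hk => (hcB k hk).1.1
  have hx0 : ((extChartAt I x).symm ∘ c) 0 = x := by simp [hc0]
  refine ⟨B, (extChartAt I x).symm ∘ c, hB, h0, hcs, hx0, ?_,
    fun k hk => hN _ (hcB k hk).1.2 (hcB k hk).2⟩
  rw [((hcs.contMDiffAt (hB.mem_nhds h0)).mdifferentiableAt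
    (by simp)).mfderiv_eq_fderiv_of_model, hx0, ← hcd]
  refine Filter.EventuallyEq.fderiv_eq ?_
  filter_upwards [hB.mem_nhds h0] with k hk
  exact (extChartAt I x).right_inv (hcB k hk).1.1

/-- A function vanishing along a curve kills its velocity, and conversely the parametrization by the
kernel realizes each kernel vector as a velocity. The span in `tangentSpaceOf` hence adds nothing at
such points. -/
theorem tangentSpaceOf_eq_ker {N O : Set M} (hO : IsOpen O) {g : M → V}
    (hg : ContMDiffOn I 𝓘(ℝ, V) ∞ g O) {x : M} (hx : x ∈ O) (hgx : g x = 0)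
    (hs : Function.Surjective (mfderiv I 𝓘(ℝ, V) g x)) (hN : ∀ y ∈ O, y ∈ N ↔ g y = 0) :
    tangentSpaceOf I N x = LinearMap.ker (mfderiv I 𝓘(ℝ, V) g x).toLinearMap := by
  have hOx := hO.mem_nhds hx
  refine le_antisymm (tangentSpaceOf_le_ker
    ((hg.contMDiffAt hOx).mdifferentiableAt (by simp)) ?_) fun v hv => ?_
  · filter_upwards [hOx] with y hy using (hN y hy).1
  · obtain ⟨K, hK⟩ : ∃ K : Submodule ℝ F,
        K = LinearMap.ker (mfderiv I 𝓘(ℝ, V) g x).toLinearMap := ⟨_, rfl⟩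
    rw [← hK] at hv
    obtain ⟨B, c, hB, h0, hc, hc0, hcd, hcB⟩ := exists_parametrization_of_regular hO hg hx hgx hs
      (fun y hy => (hN y hy).2) hK
    have h1 := range_mfderiv_le_tangentSpaceOf
      ((hc.contMDiffAt (hB.mem_nhds h0)).mdifferentiableAt (by simp))
      (eventually_of_mem (hB.mem_nhds h0) hcB) ⟨v, hv⟩
    rw [hcd, hc0] at h1
    exact h1

/-- The tangent space is named as a submodule `K` of the model space so that it carries a norm and
can be the domain of a smooth map. -/
theorem IsSubmanifold.exists_parametrization {d : ℕ} {N : Set M} (hN : IsSubmanifold I d N)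
    {x : M} (hx : x ∈ N) :
    ∃ K : Submodule ℝ F, K = tangentSpaceOf I N x ∧ Module.finrank ℝ K = d ∧
      ∃ (B : Set K) (c : K → M), IsOpen B ∧ 0 ∈ B ∧ ContMDiffOn 𝓘(ℝ, K) I ∞ c B ∧ c 0 = x ∧
        mfderiv 𝓘(ℝ, K) I c 0 = K.subtypeL ∧ MapsTo c B N := by
  obtain ⟨k, O, g, hkd, hO, hxO, hg, hs, hgN⟩ := hN x hx
  have hgx := (hgN x hxO).1 hx
  refine ⟨_, tangentSpaceOf_eq_ker hO hg hxO hgx hs hgN ▸ rfl, ?_,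
    exists_parametrization_of_regular hO hg hxO hgx hs (fun y hy => (hgN y hy).2)
    (tangentSpaceOf_eq_ker hO hg hxO hgx hs hgN)⟩
  have h1 : ∀ A : F →ₗ[ℝ] Fin k → ℝ, Function.Surjective A →
      Module.finrank ℝ (LinearMap.ker A) = d := fun A hA => by
    have h2 := A.finrank_range_add_finrank_ker
    rw [LinearMap.range_eq_top.2 hA, finrank_top, Module.finrank_fin_fun] at h2
    omega
  rw [tangentSpaceOf_eq_ker hO hg hxO hgx hs hgN]
  exact h1 _ hs

theorem IsSubmanifold.finrank_tangentSpaceOf {d : ℕ} {N : Set M} (hN : IsSubmanifold I d N)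
    {x : M} (hx : x ∈ N) : Module.finrank ℝ (tangentSpaceOf I N x) = d := by
  obtain ⟨K, hK, hd, -⟩ := hN.exists_parametrization hx
  rw [← hK]
  exact hd

/-- The image of a submanifold under an injective local diffeomorphism. -/
theorem IsSubmanifold.image [I'.Boundaryless] [IsManifold I' ∞ M'] {d : ℕ} {N s : Set M}
    (hN : IsSubmanifold I d N) (hs : IsOpen s) {f : M → M'} (hf : ContMDiffOn I I' ∞ f s)
    (hinj : InjOn f s) (A : M → F ≃L[ℝ] F')
    (hA : ∀ x ∈ s, mfderiv I I' f x = (A x : F →L[ℝ] F')) :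
    IsSubmanifold I' d (f '' (N ∩ s)) ∧ ∀ x ∈ s, tangentSpaceOf I' (f '' (N ∩ s)) (f x) =
      (tangentSpaceOf I N x).map (mfderiv I I' f x).toLinearMap := by
  have key : ∀ x ∈ s, ∃ U ⊆ s, IsOpen U ∧ x ∈ U ∧ IsOpen (f '' U) ∧ ∃ g : M' → M,
      ContMDiffOn I' I ∞ g (f '' U) ∧ (∀ y ∈ U, g (f y) = y) ∧
      (∀ z ∈ f '' U, z ∈ f '' (N ∩ s) ↔ g z ∈ N) ∧
      (mfderiv I I' f x).comp (mfderiv I' I g (f x)) = ContinuousLinearMap.id ℝ _ := by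
    intro x hx
    obtain ⟨U, hUs, hU, hxU, hfU, g, hg, hgf⟩ := hf.exists_local_inverse hs hx (A x) (hA x hx)
    refine ⟨U, hUs, hU, hxU, hfU, g, hg, hgf, ?_, ?_⟩
    · rintro _ ⟨u, hu, rfl⟩
      rw [hgf u hu]
      refine ⟨?_, fun h => ⟨u, ⟨h, hUs hu⟩, rfl⟩⟩
      -- Injectivity on all of `s`, not just near `x`, excludes points of the image that come from a
      -- distant piece of `N`; the image is thus embedded.
      rintro ⟨n, ⟨hn, hns⟩, hnu⟩
      rwa [← hinj hns (hUs hu) hnu]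
    · have h1 : MDifferentiableAt I' I g (f x) := (hg.contMDiffAt
        (hfU.mem_nhds (mem_image_of_mem f hxU))).mdifferentiableAt (by simp)
      have h2 : MDifferentiableAt I I' f (g (f x)) := by
        rw [hgf x hxU]
        exact (hf.contMDiffAt (hs.mem_nhds hx)).mdifferentiableAt (by simp)
      have h3 := mfderiv_comp (f x) h2 h1
      rw [hgf x hxU] at h3
      rw [← h3]
      have h4 : f ∘ g =ᶠ[𝓝 (f x)] id := by
        filter_upwards [hfU.mem_nhds (mem_image_of_mem f hxU)]
        rintro _ ⟨u, hu, rfl⟩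
        simp [hgf u hu]
      rw [h4.mfderiv_eq, mfderiv_id]
  have hfd : ∀ x ∈ s, MDifferentiableAt I I' f x := fun x hx =>
    (hf.contMDiffAt (hs.mem_nhds hx)).mdifferentiableAt (by simp)
  constructor
  · rintro _ ⟨x, ⟨hxN, hxs⟩, rfl⟩
    obtain ⟨U, hUs, hU, hxU, hfU, g, hg, hgf, hgN, hcomp⟩ := key x hxs
    obtain ⟨k, O, q, hkd, hO, hxO, hq, hqs, hqN⟩ := hN x hxN
    have hfx := hfU.mem_nhds (mem_image_of_mem f hxU)
    have hgd : MDifferentiableAt I' I g (f x) := (hg.contMDiffAt hfx).mdifferentiableAt (by simp)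
    refine ⟨k, f '' U ∩ g ⁻¹' O, q ∘ g, hkd.trans (A x).toLinearEquiv.finrank_eq,
      hg.continuousOn.isOpen_inter_preimage hfU hO, ⟨mem_image_of_mem f hxU, ?_⟩,
      hq.comp (hg.mono inter_subset_left) (fun z hz => hz.2), ?_, fun z hz => ?_⟩
    · simpa [hgf x hxU] using hxO
    · have hqd : MDifferentiableAt I 𝓘(ℝ, Fin k → ℝ) q (g (f x)) := by
        rw [hgf x hxU]
        exact (hq.contMDiffAt (hO.mem_nhds hxO)).mdifferentiableAt (by simp)
      rw [mfderiv_comp (f x) hqd hgd, hgf x hxU]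
      refine hqs.comp fun v => ⟨mfderiv I I' f x v, ?_⟩
      have h1 : (A x) (mfderiv I' I g (f x) (mfderiv I I' f x v)) = (A x) v := by
        have h2 := DFunLike.congr_fun hcomp (mfderiv I I' f x v)
        rw [hA x hxs] at h2 ⊢
        exact h2
      exact (A x).injective h1
    · rw [hgN z hz.1, hqN _ hz.2]
      rfl
  · intro x hx
    obtain ⟨U, hUs, hU, hxU, hfU, g, hg, hgf, hgN, hcomp⟩ := key x hx
    refine le_antisymm (fun v hv => ?_) (map_tangentSpaceOf_le (hfd x hx) ?_)
    · have hfx := hfU.mem_nhds (mem_image_of_mem f hxU)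
      have hgd : MDifferentiableAt I' I g (f x) := (hg.contMDiffAt hfx).mdifferentiableAt (by simp)
      have h1 := map_tangentSpaceOf_le (N := f '' (N ∩ s)) (N' := N) hgd
        (by filter_upwards [hfx] with z hz using (hgN z hz).1) (Submodule.mem_map_of_mem hv)
      rw [hgf x hxU] at h1
      exact ⟨_, h1, DFunLike.congr_fun hcomp v⟩
    · filter_upwards [hs.mem_nhds hx] with y hy hyN using ⟨y, ⟨hyN, hy⟩, rfl⟩

end Submanifolds

/-! ### Charts of the tangent bundle, and the tangent bundle of a submanifold. -/

section TangentBundle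

variable {F : Type*} [NormedAddCommGroup F] [NormedSpace ℝ F]
  {H : Type*} [TopologicalSpace H] {I : ModelWithCorners ℝ F H}
  {M : Type*} [TopologicalSpace M] [ChartedSpace H M]
  {V : Type*} [NormedAddCommGroup V] [NormedSpace ℝ V]

/-- The differential of `f`, as a continuous linear map between the model spaces. -/
def coordDeriv {H : Type*} [TopologicalSpace H] (I : ModelWithCorners ℝ F H)
    {M : Type*} [TopologicalSpace M] [ChartedSpace H M]
    {F' : Type*} [NormedAddCommGroup F'] [NormedSpace ℝ F']
    {H' : Type*} [TopologicalSpace H'] (I' : ModelWithCorners ℝ F' H')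
    {M' : Type*} [TopologicalSpace M'] [ChartedSpace H' M'] (f : M → M') (x : M) : F →L[ℝ] F' :=
  mfderiv I I' f x

/-- The tangent vector at the base point, as an element of the model space. -/
def tangentVec (w : TangentBundle I M) : F := w.snd

section coordDeriv

variable {F' : Type*} [NormedAddCommGroup F'] [NormedSpace ℝ F']
  {H' : Type*} [TopologicalSpace H'] {I' : ModelWithCorners ℝ F' H'}
  {M' : Type*} [TopologicalSpace M'] [ChartedSpace H' M']
  {F'' : Type*} [NormedAddCommGroup F''] [NormedSpace ℝ F'']
  {H'' : Type*} [TopologicalSpace H''] {I'' : ModelWithCorners ℝ F'' H''}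
  {M'' : Type*} [TopologicalSpace M''] [ChartedSpace H'' M'']
  {V' : Type*} [NormedAddCommGroup V'] [NormedSpace ℝ V']

theorem coordDeriv_comp {g : M' → M''} {f : M → M'} {x : M} (hg : MDifferentiableAt I' I'' g (f x))
    (hf : MDifferentiableAt I I' f x) :
    coordDeriv I I'' (g ∘ f) x = (coordDeriv I' I'' g (f x)).comp (coordDeriv I I' f x) :=
  mfderiv_comp x hg hf

theorem coordDeriv_congr {f g : M → M'} {x : M} (h : f =ᶠ[𝓝 x] g) :
    coordDeriv I I' f x = coordDeriv I I' g x :=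
  h.mfderiv_eq

theorem coordDeriv_eq_fderiv (f : V → V') (x : V) :
    coordDeriv 𝓘(ℝ, V) 𝓘(ℝ, V') f x = fderiv ℝ f x :=
  mfderiv_eq_fderiv

theorem coordDeriv_chart_eq_id (x : M) [IsManifold I ∞ M] :
    coordDeriv I 𝓘(ℝ, F) (extChartAt I x) x = ContinuousLinearMap.id ℝ F :=
  mfderiv_extChartAt_self

theorem coordDeriv_chart_comp_symm [I.Boundaryless] [IsManifold I ∞ M] {x y : M}
    (hy : y ∈ (extChartAt I x).source) (v : F) :
    coordDeriv I 𝓘(ℝ, F) (extChartAt I x) y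
      (coordDeriv 𝓘(ℝ, F) I (extChartAt I x).symm (extChartAt I x y) v) = v :=
  DFunLike.congr_fun (mfderiv_extChartAt_bijective hy).1 v

theorem coordDeriv_symm_comp_chart [I.Boundaryless] [IsManifold I ∞ M] {x y : M}
    (hy : y ∈ (extChartAt I x).source) (v : F) :
    coordDeriv 𝓘(ℝ, F) I (extChartAt I x).symm (extChartAt I x y)
      (coordDeriv I 𝓘(ℝ, F) (extChartAt I x) y v) = v :=
  DFunLike.congr_fun (mfderiv_extChartAt_bijective hy).2 v

theorem mdifferentiableAt_chart [IsManifold I ∞ M] {x y : M} (hy : y ∈ (extChartAt I x).source) :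
    MDifferentiableAt I 𝓘(ℝ, F) (extChartAt I x) y :=
  mdifferentiableAt_extChartAt (by rwa [extChartAt_source] at hy)

/-- Differentials of functions in terms of their chart expressions. -/
theorem coordDeriv_eq_fderiv_comp_chart [IsManifold I ∞ M] {g : M → V} {x y : M}
    (hy : y ∈ (extChartAt I x).source)
    (hg : DifferentiableAt ℝ (g ∘ (extChartAt I x).symm) (extChartAt I x y)) :
    coordDeriv I 𝓘(ℝ, V) g y = (fderiv ℝ (g ∘ (extChartAt I x).symm) (extChartAt I x y)).comp
      (coordDeriv I 𝓘(ℝ, F) (extChartAt I x) y) := by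
  have h1 : g =ᶠ[𝓝 y] (g ∘ (extChartAt I x).symm) ∘ extChartAt I x := by
    filter_upwards [(isOpen_extChartAt_source _).mem_nhds hy] with z hz
    exact (congrArg g ((extChartAt I x).left_inv hz)).symm
  rw [coordDeriv_congr h1, coordDeriv_comp hg.mdifferentiableAt (mdifferentiableAt_chart hy),
    coordDeriv_eq_fderiv]

end coordDeriv

variable [IsManifold I ∞ M]

theorem mem_extChartAt_tangent_source (w₀ w : TangentBundle I M) :
    w ∈ (extChartAt I.tangent w₀).source ↔ w.proj ∈ (extChartAt I w₀.proj).source := by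
  rw [extChartAt_source, extChartAt_source]
  exact TangentBundle.mem_chart_source_iff _ _

theorem extChartAt_tangent_apply (w₀ w : TangentBundle I M)
    (hw : w.proj ∈ (extChartAt I w₀.proj).source) :
    extChartAt I.tangent w₀ w = (extChartAt I w₀.proj w.proj,
      coordDeriv I 𝓘(ℝ, F) (extChartAt I w₀.proj) w.proj (tangentVec w)) := by
  rw [extChartAt_source] at hw
  have h1 : coordDeriv I 𝓘(ℝ, F) (extChartAt I w₀.proj) w.proj =
      (trivializationAt F (TangentSpace I) w₀.proj).continuousLinearMapAt ℝ w.proj :=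
    (TangentBundle.continuousLinearMapAt_trivializationAt hw).symm
  have h2 : (trivializationAt F (TangentSpace I) w₀.proj).continuousLinearMapAt ℝ w.proj w.snd =
      (trivializationAt F (TangentSpace I) w₀.proj w).2 := by
    rw [Trivialization.continuousLinearMapAt_apply, Trivialization.linearMapAt_apply]
    exact if_pos hw
  rw [FiberBundle.extChartAt, h1]
  exact Prod.ext rfl h2.symm

theorem extChartAt_tangent_self (w : TangentBundle I M) :
    extChartAt I.tangent w w = (extChartAt I w.proj w.proj, tangentVec w) := by
  rw [extChartAt_tangent_apply w w (mem_extChartAt_source _), coordDeriv_chart_eq_id]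
  rfl

variable [I.Boundaryless]

theorem mfderiv_tangentBundle_proj (w : TangentBundle I M) :
    mfderiv I.tangent I (TotalSpace.proj : TangentBundle I M → M) w =
      ContinuousLinearMap.fst ℝ F F := by
  have h1 : MDifferentiableAt I.tangent I (TotalSpace.proj : TangentBundle I M → M) w :=
    (Bundle.contMDiffAt_proj (TangentSpace I) (n := 1)).mdifferentiableAt (by simp)
  rw [h1.mfderiv_eq_fderiv]
  have h2 : extChartAt I w.proj ∘ TotalSpace.proj ∘ (extChartAt I.tangent w).symm
      =ᶠ[𝓝 (extChartAt I.tangent w w)] Prod.fst := by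
    filter_upwards [extChartAt_target_mem_nhds (I := I.tangent) w] with z hz
    have h3 := (extChartAt I.tangent w).map_target hz
    have h4 := extChartAt_tangent_apply w _ ((mem_extChartAt_tangent_source _ _).1 h3)
    rw [(extChartAt I.tangent w).right_inv hz] at h4
    exact (congrArg Prod.fst h4).symm
  rw [h2.fderiv_eq]
  exact fderiv_fst

variable [FiniteDimensional ℝ F]

/-- If `g` defines `N`, then `(x, v) ↦ (g x, dg_x v)` defines `TN`. Its differential is block
triangular with both diagonal blocks equal to `dg`, hence surjective. -/
theorem IsSubmanifold.tangentBundleOf {d : ℕ} {N : Set M} (hN : IsSubmanifold I d N) :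
    IsSubmanifold I.tangent (2 * d) (tangentBundleOf I N) := by
  intro w₀ hw₀
  obtain ⟨k, O, g, hkd, hO, hxO, hg, hs, hgN⟩ := hN w₀.proj hw₀.1
  let φ := extChartAt I w₀.proj
  let Φ := extChartAt I.tangent w₀
  let g' : F → Fin k → ℝ := g ∘ φ.symm
  have hO' : IsOpen (φ.target ∩ φ.symm ⁻¹' O) :=
    (continuousOn_extChartAt_symm _).isOpen_inter_preimage (isOpen_extChartAt_target _) hO
  have hg' : ContDiffOn ℝ ∞ g' (φ.target ∩ φ.symm ⁻¹' O) := hg.contDiffOn_comp_symm w₀.proj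
  have hgd : ∀ x ∈ O, MDifferentiableAt I 𝓘(ℝ, Fin k → ℝ) g x := fun x hx =>
    (hg.contMDiffAt (hO.mem_nhds hx)).mdifferentiableAt (by simp)
  rw [(hgd _ hxO).mfderiv_eq_fderiv_comp_symm] at hs
  have hR := isOpen_surjective_fderiv hO' hg'
  -- The tangent space must be the kernel of `dg` at all nearby points of `N`, so the base is
  -- restricted to where `dg` stays surjective.
  let U : Set M := φ.source ∩ φ ⁻¹' {ζ ∈ φ.target ∩ φ.symm ⁻¹' O |
    Function.Surjective (fderiv ℝ g' ζ)}
  have hU : IsOpen U :=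
    (continuousOn_extChartAt _).isOpen_inter_preimage (isOpen_extChartAt_source _) hR
  have hUO : ∀ x ∈ U, x ∈ O := fun x hx => by
    have := hx.2.1.2
    rwa [mem_preimage, φ.left_inv hx.1] at this
  have hchain : ∀ x ∈ U, coordDeriv I 𝓘(ℝ, Fin k → ℝ) g x =
      (fderiv ℝ g' (φ x)).comp (coordDeriv I 𝓘(ℝ, F) φ x) := fun x hx =>
    coordDeriv_eq_fderiv_comp_chart hx.1
      ((hg'.contDiffAt (hO'.mem_nhds hx.2.1)).differentiableAt (by simp))
  let G' : F × F → (Fin k → ℝ) × (Fin k → ℝ) := fun z => (g' z.1, fderiv ℝ g' z.1 z.2)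
  have hdg' : ContDiffOn ℝ ∞ (fderiv ℝ g') (φ.target ∩ φ.symm ⁻¹' O) :=
    hg'.fderiv_of_isOpen hO' (by simp)
  have hG' : ContDiffOn ℝ ∞ G' ((φ.target ∩ φ.symm ⁻¹' O) ×ˢ univ) :=
    (hg'.comp contDiffOn_fst fun z hz => hz.1).prodMk
      ((hdg'.comp contDiffOn_fst fun z hz => hz.1).clm_apply contDiffOn_snd)
  have hw₀U : w₀.proj ∈ U :=
    ⟨mem_extChartAt_source _, ⟨mem_extChartAt_target _, by simpa [φ] using hxO⟩, hs⟩
  have hW : IsOpen ((TotalSpace.proj : TangentBundle I M → M) ⁻¹' U) :=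
    hU.preimage (FiberBundle.continuous_proj F (TangentSpace I))
  have hΦ : ∀ w : TangentBundle I M, w.proj ∈ U →
      Φ w = (φ w.proj, coordDeriv I 𝓘(ℝ, F) φ w.proj (tangentVec w)) :=
    fun w hw => extChartAt_tangent_apply w₀ w hw.1
  have hG : ContMDiffOn I.tangent 𝓘(ℝ, (Fin k → ℝ) × (Fin k → ℝ)) ∞ (G' ∘ Φ)
      (TotalSpace.proj ⁻¹' U) := by
    refine hG'.contMDiffOn.comp ((contMDiffOn_extChartAt (n := ∞) (x := w₀)).mono
      fun w hw => ?_) fun w hw => ?_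
    · rw [← extChartAt_source I.tangent, mem_extChartAt_tangent_source]
      exact hw.1
    · simp only [mem_preimage, hΦ w hw]
      exact ⟨hw.2.1, mem_univ _⟩
  refine exists_defining_function hW hG hw₀U ?_ ?_ ?_
  · rw [((hG.contMDiffAt (hW.mem_nhds hw₀U)).mdifferentiableAt
      (by simp)).mfderiv_eq_fderiv_comp_symm]
    have h1 : (G' ∘ Φ) ∘ Φ.symm =ᶠ[𝓝 (Φ w₀)] G' := by
      filter_upwards [extChartAt_target_mem_nhds (I := I.tangent) w₀] with z hz
      exact congrArg G' (Φ.right_inv hz)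
    rw [h1.fderiv_eq, show Φ w₀ = (φ w₀.proj, tangentVec w₀) from extChartAt_tangent_self w₀]
    have hgx := hw₀U.2.1
    have h2 : HasFDerivAt g' (fderiv ℝ g' (φ w₀.proj)) (φ w₀.proj) :=
      ((hg'.contDiffAt (hO'.mem_nhds hgx)).differentiableAt (by simp)).hasFDerivAt
    have h3 : HasFDerivAt (fderiv ℝ g') (fderiv ℝ (fderiv ℝ g') (φ w₀.proj)) (φ w₀.proj) :=
      ((hdg'.contDiffAt (hO'.mem_nhds hgx)).differentiableAt (by simp)).hasFDerivAt
    let z₀ : F × F := (φ w₀.proj, tangentVec w₀)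
    have h4 : HasFDerivAt G' _ z₀ := (HasFDerivAt.comp z₀ (f := Prod.fst) h2 hasFDerivAt_fst).prodMk
      ((HasFDerivAt.comp z₀ (f := Prod.fst) h3 hasFDerivAt_fst).clm_apply hasFDerivAt_snd)
    rw [show fderiv ℝ G' (φ w₀.proj, tangentVec w₀) = _ from h4.fderiv]
    rintro ⟨a, b⟩
    -- The triangular system is solved from the top: `u` for the first block, then `v` after
    -- subtracting the second-derivative term in `u`.
    obtain ⟨u, rfl⟩ := hs a
    obtain ⟨v, hv⟩ := hs (b - fderiv ℝ (fderiv ℝ g') (φ w₀.proj) u (tangentVec w₀))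
    refine ⟨(u, v), Prod.ext rfl ?_⟩
    change fderiv ℝ g' (φ w₀.proj) v + fderiv ℝ (fderiv ℝ g') (φ w₀.proj) u (tangentVec w₀) = b
    change fderiv ℝ g' (φ w₀.proj) v = _ at hv
    rw [hv]
    abel
  · intro w hw
    have hwO := hUO _ hw
    have h0 : (G' ∘ Φ) w =
        (g w.proj, coordDeriv I 𝓘(ℝ, Fin k → ℝ) g w.proj (tangentVec w)) := by
      rw [hchain _ hw, Function.comp_apply, hΦ w hw]
      simp only [G', g', Function.comp_apply, φ.left_inv hw.1]
      rfl
    rw [h0, Prod.mk_eq_zero, ← hgN _ hwO]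
    refine and_congr_right fun hwN => ?_
    rw [tangentSpaceOf_eq_ker hO hg hwO ((hgN _ hwO).1 hwN) (fun v => ?_) hgN]
    · rfl
    · obtain ⟨u, hu⟩ := hw.2.2 v
      refine ⟨coordDeriv 𝓘(ℝ, F) I φ.symm (φ w.proj) u, ?_⟩
      change coordDeriv I 𝓘(ℝ, Fin k → ℝ) g w.proj _ = v
      rw [hchain _ hw, ContinuousLinearMap.comp_apply, coordDeriv_chart_comp_symm hw.1, hu]
  · simp only [Module.finrank_prod, Module.finrank_fin_fun, ← hkd]
    ring

end TangentBundle

/-! ### Charts of the cotangent bundle, the Liouville form and the canonical form. -/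

section Cotangent

variable {F : Type*} [NormedAddCommGroup F] [NormedSpace ℝ F]
  {H : Type*} [TopologicalSpace H] {I : ModelWithCorners ℝ F H}
  {M : Type*} [TopologicalSpace M] [ChartedSpace H M]
  {V : Type*} [NormedAddCommGroup V] [NormedSpace ℝ V]

/-- The covector at the base point, as a functional on the model space. -/
def covec (z : CotangentBundle I M) : F →L[ℝ] ℝ := z.snd

variable [IsManifold I ∞ M]

theorem mem_extChartAt_cotangent_source (z₀ z : CotangentBundle I M) :
    z ∈ (extChartAt (cotangentModel I) z₀).source ↔
      z.proj ∈ (extChartAt I z₀.proj).source := by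
  rw [FiberBundle.extChartAt]
  simp
  exact fun h => h

theorem extChartAt_cotangent_fst (z₀ z : CotangentBundle I M) :
    (extChartAt (cotangentModel I) z₀ z).1 = extChartAt I z₀.proj z.proj := by
  rw [FiberBundle.extChartAt]
  rfl

/-- Covector coordinates involve the inverse of the chart differential; composing with the
differential itself removes the inverse, the form in which covectors are compared below. -/
theorem extChartAt_cotangent_snd_comp [I.Boundaryless] (z₀ z : CotangentBundle I M)
    (hz : z.proj ∈ (extChartAt I z₀.proj).source) :
    (extChartAt (cotangentModel I) z₀ z).2.comp
      (coordDeriv I 𝓘(ℝ, F) (extChartAt I z₀.proj) z.proj) = covec z := by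
  have hz' : z.proj ∈ (chartAt H z₀.proj).source := by rwa [extChartAt_source] at hz
  have h1 : (extChartAt (cotangentModel I) z₀ z).2 = (covec z).comp
      (coordDeriv 𝓘(ℝ, F) I (extChartAt I z₀.proj).symm (extChartAt I z₀.proj z.proj)) := by
    have h2 : (trivializationAt F (TangentSpace I) z₀.proj).symmL ℝ z.proj =
        coordDeriv 𝓘(ℝ, F) I (extChartAt I z₀.proj).symm (extChartAt I z₀.proj z.proj) := by
      rw [TangentBundle.symmL_trivializationAt hz', I.range_eq_univ, mfderivWithin_univ]
      rfl
    rw [FiberBundle.extChartAt, ← h2]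
    change ContinuousLinearMap.inCoordinates F (TangentSpace I) ℝ (Trivial M ℝ)
      z₀.proj z.proj z₀.proj z.proj z.snd = _
    ext v
    rw [ContinuousLinearMap.inCoordinates]
    have h3 : (trivializationAt ℝ (Trivial M ℝ) z₀.proj).continuousLinearMapAt ℝ z.proj =
        ContinuousLinearMap.id ℝ ℝ := Bundle.Trivial.continuousLinearMapAt_trivialization ℝ M ℝ _
    exact DFunLike.congr_fun h3 _
  rw [h1]
  ext v
  exact congrArg (covec z) (coordDeriv_symm_comp_chart hz v)

variable [I.Boundaryless]

theorem coordDeriv_cotangent_proj (z : CotangentBundle I M) :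
    coordDeriv (cotangentModel I) I (TotalSpace.proj : CotangentBundle I M → M) z =
      ContinuousLinearMap.fst ℝ F (F →L[ℝ] ℝ) := by
  have h1 : MDifferentiableAt (cotangentModel I) I
      (TotalSpace.proj : CotangentBundle I M → M) z :=
    (Bundle.contMDiffAt_proj _ (n := 1)).mdifferentiableAt (by simp)
  rw [coordDeriv, h1.mfderiv_eq_fderiv]
  have h2 : extChartAt I z.proj ∘ TotalSpace.proj ∘ (extChartAt (cotangentModel I) z).symm
      =ᶠ[𝓝 (extChartAt (cotangentModel I) z z)] Prod.fst := by
    filter_upwards [extChartAt_target_mem_nhds (I := cotangentModel I) z] with y hy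
    have h4 := extChartAt_cotangent_fst z ((extChartAt (cotangentModel I) z).symm y)
    rw [(extChartAt (cotangentModel I) z).right_inv hy] at h4
    exact h4.symm
  rw [h2.fderiv_eq]
  exact fderiv_fst

theorem extChartAt_cotangent_self (z : CotangentBundle I M) :
    extChartAt (cotangentModel I) z z = (extChartAt I z.proj z.proj, covec z) := by
  refine Prod.ext (extChartAt_cotangent_fst z z) ?_
  rw [← extChartAt_cotangent_snd_comp z z (mem_extChartAt_source _), coordDeriv_chart_eq_id]
  rfl

/-- The pullback of the Liouville form `p dq` under `c : V → T^* M`. -/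
def liouville (I : ModelWithCorners ℝ F H) (c : V → CotangentBundle I M) (y : V) : V →L[ℝ] ℝ :=
  (covec (c y)).comp (coordDeriv 𝓘(ℝ, V) I (fun y => (c y).proj) y)

section liouville

variable {O : Set V} (hO : IsOpen O) {c : V → CotangentBundle I M}
  (hc : ContMDiffOn 𝓘(ℝ, V) (cotangentModel I) ∞ c O)

omit [I.Boundaryless] in
include hc in
theorem contDiffOn_extChartAt_cotangent_comp (z₀ : CotangentBundle I M) :
    ContDiffOn ℝ ∞ (extChartAt (cotangentModel I) z₀ ∘ c)
      (O ∩ c ⁻¹' (extChartAt (cotangentModel I) z₀).source) := by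
  rw [← contMDiffOn_iff_contDiffOn]
  refine (contMDiffOn_extChartAt (n := ∞) (x := z₀)).comp (hc.mono inter_subset_left) fun y hy => ?_
  simpa using! hy.2

include hO hc

/-- Under a change of bundle chart, `p` and `dq` change by mutually inverse factors, so `p dq` has
the same expression in every bundle chart. A fixed chart makes its smoothness visible and allows it
to be differentiated. -/
theorem liouville_eq (z₀ : CotangentBundle I M) {y : V} (hy : y ∈ O)
    (hyz : c y ∈ (extChartAt (cotangentModel I) z₀).source) :
    liouville I c y = (extChartAt (cotangentModel I) z₀ (c y)).2.comp
      (fderiv ℝ (fun y => (extChartAt (cotangentModel I) z₀ (c y)).1) y) := by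
  have hz := (mem_extChartAt_cotangent_source _ _).1 hyz
  have hcy : MDifferentiableAt 𝓘(ℝ, V) (cotangentModel I) c y :=
    (hc.contMDiffAt (hO.mem_nhds hy)).mdifferentiableAt (by simp)
  have hp : MDifferentiableAt 𝓘(ℝ, V) I (fun y => (c y).proj) y :=
    ((Bundle.contMDiffAt_proj _ (n := 1)).mdifferentiableAt (by simp)).comp y hcy
  have h1 : (fun y => (extChartAt (cotangentModel I) z₀ (c y)).1) =
      extChartAt I z₀.proj ∘ fun y => (c y).proj :=
    funext fun y => extChartAt_cotangent_fst z₀ (c y)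
  rw [← coordDeriv_eq_fderiv, h1, coordDeriv_comp (g := extChartAt I z₀.proj)
      (f := fun y => (c y).proj) (mdifferentiableAt_chart hz) hp,
    ← ContinuousLinearMap.comp_assoc, extChartAt_cotangent_snd_comp z₀ (c y) hz]
  rfl

theorem contDiffOn_liouville : ContDiffOn ℝ ∞ (liouville I c) O := by
  intro y hy
  have hO' : IsOpen (O ∩ c ⁻¹' (extChartAt (cotangentModel I) (c y)).source) :=
    hc.continuousOn.isOpen_inter_preimage hO (isOpen_extChartAt_source _)
  have h1 := contDiffOn_extChartAt_cotangent_comp hc (c y)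
  have hy' : y ∈ O ∩ c ⁻¹' (extChartAt (cotangentModel I) (c y)).source :=
    ⟨hy, mem_extChartAt_source _⟩
  have h2 : ContDiffOn ℝ ∞ (liouville I c)
      (O ∩ c ⁻¹' (extChartAt (cotangentModel I) (c y)).source) := by
    refine ContDiffOn.congr ?_ fun y' hy' => liouville_eq hO hc (c y) hy'.1 hy'.2
    exact (contDiff_snd.comp_contDiffOn h1).clm_comp
      ((contDiff_fst.comp_contDiffOn h1).fderiv_of_isOpen hO' (by simp))
  exact (h2.contDiffAt (hO'.mem_nhds hy')).contDiffWithinAt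

/-- `c^* ω = - d (c^* (p dq))`. -/
theorem canonicalForm_pullback {y : V} (hy : y ∈ O) (a b : V) :
    standardForm F (coordDeriv 𝓘(ℝ, V) (cotangentModel I) c y a)
      (coordDeriv 𝓘(ℝ, V) (cotangentModel I) c y b) =
      fderiv ℝ (liouville I c) y b a - fderiv ℝ (liouville I c) y a b := by
  have hO' : IsOpen (O ∩ c ⁻¹' (extChartAt (cotangentModel I) (c y)).source) :=
    hc.continuousOn.isOpen_inter_preimage hO (isOpen_extChartAt_source _)
  have h1 := contDiffOn_extChartAt_cotangent_comp hc (c y)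
  have hy' := hO'.mem_nhds ⟨hy, mem_extChartAt_source (I := cotangentModel I) (c y)⟩
  have hcy : MDifferentiableAt 𝓘(ℝ, V) (cotangentModel I) c y :=
    (hc.contMDiffAt (hO.mem_nhds hy)).mdifferentiableAt (by simp)
  set C := extChartAt (cotangentModel I) (c y) ∘ c with hC
  have h2 : liouville I c =ᶠ[𝓝 y] fun y' =>
      (C y').2.comp (fderiv ℝ (fun y' => (C y').1) y') := by
    filter_upwards [hy'] with y' hy' using liouville_eq hO hc (c y) hy'.1 hy'.2
  have h3 : ContDiffAt ℝ ∞ C y := h1.contDiffAt hy'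
  have h4 : ContDiffAt ℝ ∞ (fun y => (C y).1) y := contDiff_fst.contDiffAt.comp y h3
  have h5 : HasFDerivAt C (fderiv ℝ C y) y := (h3.differentiableAt (by simp)).hasFDerivAt
  have h6 : HasFDerivAt (fun y => (C y).2) _ y := hasFDerivAt_snd.comp y h5
  have h7 : HasFDerivAt (fun y => (C y).1) _ y := hasFDerivAt_fst.comp y h5
  have h8 : HasFDerivAt (fderiv ℝ (fun y => (C y).1)) (fderiv ℝ (fderiv ℝ (fun y => (C y).1)) y) y :=
    ((h4.fderiv_right (m := ∞) (by simp)).differentiableAt (by simp)).hasFDerivAt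
  have h9 : coordDeriv 𝓘(ℝ, V) (cotangentModel I) c y = fderiv ℝ C y :=
    hcy.mfderiv_eq_fderiv_of_model
  -- The second derivatives of the `q`-coordinates of `c` are symmetric and cancel in the exterior
  -- derivative; the products of first derivatives that remain are the standard form.
  have h10 := h4.fderiv_fderiv_comm a b
  rw [h2.fderiv_eq, (h6.clm_comp h8 : HasFDerivAt (fun y' => (C y').2.comp
    (fderiv ℝ (fun y' => (C y').1) y')) _ y).fderiv, h9, h7.fderiv, standardForm_apply]
  simp only [add_apply, ContinuousLinearMap.comp_apply, ContinuousLinearMap.compL_apply,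
    ContinuousLinearMap.flip_apply, h10]
  simp

end liouville

set_option synthInstance.maxHeartbeats 200000 in
/-- The canonical form has the standard expression in every bundle chart. -/
theorem standardForm_chart_symm (z₀ : CotangentBundle I M) {y : F × (F →L[ℝ] ℝ)}
    (hy : y ∈ (extChartAt (cotangentModel I) z₀).target) (a b : F × (F →L[ℝ] ℝ)) :
    standardForm F
      (coordDeriv 𝓘(ℝ, F × (F →L[ℝ] ℝ)) (cotangentModel I) (extChartAt (cotangentModel I) z₀).symm y a)
      (coordDeriv 𝓘(ℝ, F × (F →L[ℝ] ℝ)) (cotangentModel I) (extChartAt (cotangentModel I) z₀).symm y b) =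
      standardForm F a b := by
  have hO := isOpen_extChartAt_target (I := cotangentModel I) z₀
  have hc := contMDiffOn_extChartAt_symm (I := cotangentModel I) (n := ∞) z₀
  -- The inverse chart pulls the Liouville form back to `p dq` on the model space, which is linear
  -- in the point; its exterior derivative is therefore constant and standard.
  have h1 : liouville I (extChartAt (cotangentModel I) z₀).symm =ᶠ[𝓝 y] fun y =>
      y.2.comp (ContinuousLinearMap.fst ℝ F (F →L[ℝ] ℝ)) := by
    filter_upwards [hO.mem_nhds hy] with y' hy'
    rw [liouville_eq hO hc z₀ hy' ((extChartAt _ _).map_target hy'), (extChartAt _ _).right_inv hy']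
    have h2 : (fun y => (extChartAt (cotangentModel I) z₀
        ((extChartAt (cotangentModel I) z₀).symm y)).1) =ᶠ[𝓝 y'] Prod.fst := by
      filter_upwards [hO.mem_nhds hy'] with y hy
      rw [(extChartAt _ _).right_inv hy]
    rw [h2.fderiv_eq, fderiv_fst]
  have h2 : HasFDerivAt (fun y : F × (F →L[ℝ] ℝ) =>
      y.2.comp (ContinuousLinearMap.fst ℝ F (F →L[ℝ] ℝ))) _ y :=
    (((ContinuousLinearMap.compL ℝ (F × (F →L[ℝ] ℝ)) F ℝ).flip
      (ContinuousLinearMap.fst ℝ F (F →L[ℝ] ℝ))).comp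
      (ContinuousLinearMap.snd ℝ F (F →L[ℝ] ℝ))).hasFDerivAt
  rw [canonicalForm_pullback hO hc hy, h1.fderiv_eq, h2.fderiv, standardForm_apply]
  rfl

end Cotangent

/-! ### Smoothness and closedness of exact two-forms. -/

section ClosedForms

variable {V : Type*} [NormedAddCommGroup V] [NormedSpace ℝ V]

theorem HasFDerivAt.clm_apply_vector {X Y : Type*} [NormedAddCommGroup X] [NormedSpace ℝ X]
    [NormedAddCommGroup Y] [NormedSpace ℝ Y] {f : V → X →L[ℝ] Y} {f' : V →L[ℝ] X →L[ℝ] Y} {y : V}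
    (hf : HasFDerivAt f f' y) (a : X) : HasFDerivAt (fun y => f y a) (f'.flip a) y := by
  have h : HasFDerivAt (fun L : X →L[ℝ] Y => L a) (ContinuousLinearMap.apply ℝ Y a) (f y) :=
    (ContinuousLinearMap.apply ℝ Y a).hasFDerivAt
  exact h.comp y hf

theorem ContDiffOn.sub_fderiv_swap {O : Set V} (hO : IsOpen O) {l : V → V →L[ℝ] ℝ}
    (hl : ContDiffOn ℝ ∞ l O) (a b : V) :
    ContDiffOn ℝ ∞ (fun y => fderiv ℝ l y b a - fderiv ℝ l y a b) O := by
  have h1 := hl.fderiv_of_isOpen (m := ∞) hO (by simp)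
  exact ((h1.clm_apply contDiffOn_const).clm_apply contDiffOn_const).sub
    ((h1.clm_apply contDiffOn_const).clm_apply contDiffOn_const)

set_option synthInstance.maxHeartbeats 200000 in
/-- `d (d l) = 0` for a one-form `l`. -/
theorem ContDiffAt.cyclic_sum_fderiv {l : V → V →L[ℝ] ℝ} {y : V} (hl : ContDiffAt ℝ ∞ l y)
    (a₁ a₂ a₃ : V) :
    fderiv ℝ (fun y => fderiv ℝ l y a₃ a₂ - fderiv ℝ l y a₂ a₃) y a₁
      + fderiv ℝ (fun y => fderiv ℝ l y a₁ a₃ - fderiv ℝ l y a₃ a₁) y a₂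
      + fderiv ℝ (fun y => fderiv ℝ l y a₂ a₁ - fderiv ℝ l y a₁ a₂) y a₃ = 0 := by
  have h1 : HasFDerivAt (fderiv ℝ l) (fderiv ℝ (fderiv ℝ l) y) y :=
    ((hl.fderiv_right (m := ∞) (by simp)).differentiableAt (by simp)).hasFDerivAt
  have h2 : ∀ a b : V, HasFDerivAt (fun y => fderiv ℝ l y a b)
      (((fderiv ℝ (fderiv ℝ l) y).flip a).flip b) y := fun a b =>
    (h1.clm_apply_vector a).clm_apply_vector b
  have h3 : ∀ a b v : V, fderiv ℝ (fun y => fderiv ℝ l y a b - fderiv ℝ l y b a) y v =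
      fderiv ℝ (fderiv ℝ l) y v a b - fderiv ℝ (fderiv ℝ l) y v b a := fun a b v =>
    DFunLike.congr_fun ((h2 a b).sub (h2 b a)).fderiv v
  rw [h3, h3, h3, hl.fderiv_fderiv_comm a₁ a₃, hl.fderiv_fderiv_comm a₁ a₂,
    hl.fderiv_fderiv_comm a₂ a₃]
  ring

end ClosedForms

/-! ### The form `Ω₁₂` on `T^*Q × T^*Q`. -/

section Pair

variable {E : Type*} [NormedAddCommGroup E] [NormedSpace ℝ E]
  {Q : Type*} [TopologicalSpace Q] [ChartedSpace E Q] [IsManifold 𝓘(ℝ, E) ∞ Q]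
  {V : Type*} [NormedAddCommGroup V] [NormedSpace ℝ V]

/-- `ω₂ - ω₁` on the product of two copies of `E × E^*`. -/
def pairForm (a b : (E × (E →L[ℝ] ℝ)) × (E × (E →L[ℝ] ℝ))) : ℝ :=
  standardForm E a.2 b.2 - standardForm E a.1 b.1

theorem omega12_apply (y : CotangentBundle 𝓘(ℝ, E) Q × CotangentBundle 𝓘(ℝ, E) Q)
    (a b : (E × (E →L[ℝ] ℝ)) × (E × (E →L[ℝ] ℝ))) : Omega12 E Q y a b = pairForm a b := by
  have h1 : coordDeriv (pairModel E) (cotangentModel 𝓘(ℝ, E))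
      (Prod.snd : CotangentBundle 𝓘(ℝ, E) Q × CotangentBundle 𝓘(ℝ, E) Q → _) y =
      ContinuousLinearMap.snd ℝ (E × (E →L[ℝ] ℝ)) (E × (E →L[ℝ] ℝ)) := mfderiv_snd
  have h2 : coordDeriv (pairModel E) (cotangentModel 𝓘(ℝ, E))
      (Prod.fst : CotangentBundle 𝓘(ℝ, E) Q × CotangentBundle 𝓘(ℝ, E) Q → _) y =
      ContinuousLinearMap.fst ℝ (E × (E →L[ℝ] ℝ)) (E × (E →L[ℝ] ℝ)) := mfderiv_fst
  change standardForm E (coordDeriv _ _ Prod.snd y a) (coordDeriv _ _ Prod.snd y b) -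
    standardForm E (coordDeriv _ _ Prod.fst y a) (coordDeriv _ _ Prod.fst y b) = _
  rw [h1, h2]
  rfl

theorem coordDeriv_pair {c : V → CotangentBundle 𝓘(ℝ, E) Q × CotangentBundle 𝓘(ℝ, E) Q} {y : V}
    (hc : MDifferentiableAt 𝓘(ℝ, V) (pairModel E) c y) (a : V) :
    coordDeriv 𝓘(ℝ, V) (pairModel E) c y a =
      (coordDeriv 𝓘(ℝ, V) (cotangentModel 𝓘(ℝ, E)) (fun y => (c y).1) y a,
        coordDeriv 𝓘(ℝ, V) (cotangentModel 𝓘(ℝ, E)) (fun y => (c y).2) y a) := by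
  have h1 := mfderiv_prodMk (mdifferentiableAt_fst.comp y hc) (mdifferentiableAt_snd.comp y hc)
  exact DFunLike.congr_fun h1 a

variable {O : Set V} {c : V → CotangentBundle 𝓘(ℝ, E) Q × CotangentBundle 𝓘(ℝ, E) Q}

/-- `c^* Ω₁₂ = -d(c₂^* (p dq) - c₁^* (p dq))`. -/
theorem pairForm_pullback (hO : IsOpen O) (hc : ContMDiffOn 𝓘(ℝ, V) (pairModel E) ∞ c O) {y : V}
    (hy : y ∈ O) (a b : V) :
    pairForm (coordDeriv 𝓘(ℝ, V) (pairModel E) c y a) (coordDeriv 𝓘(ℝ, V) (pairModel E) c y b) =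
      fderiv ℝ (fun y => liouville 𝓘(ℝ, E) (fun y => (c y).2) y
        - liouville 𝓘(ℝ, E) (fun y => (c y).1) y) y b a
      - fderiv ℝ (fun y => liouville 𝓘(ℝ, E) (fun y => (c y).2) y
        - liouville 𝓘(ℝ, E) (fun y => (c y).1) y) y a b := by
  have h1 : ContMDiffOn 𝓘(ℝ, V) (cotangentModel 𝓘(ℝ, E)) ∞ (fun y => (c y).1) O :=
    contMDiff_fst.comp_contMDiffOn hc
  have h2 : ContMDiffOn 𝓘(ℝ, V) (cotangentModel 𝓘(ℝ, E)) ∞ (fun y => (c y).2) O :=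
    contMDiff_snd.comp_contMDiffOn hc
  have h3 := canonicalForm_pullback hO h1 hy a b
  have h4 := canonicalForm_pullback hO h2 hy a b
  have h5 : DifferentiableAt ℝ (liouville 𝓘(ℝ, E) (fun y => (c y).1)) y :=
    ((contDiffOn_liouville hO h1).contDiffAt (hO.mem_nhds hy)).differentiableAt (by simp)
  have h6 : DifferentiableAt ℝ (liouville 𝓘(ℝ, E) (fun y => (c y).2)) y :=
    ((contDiffOn_liouville hO h2).contDiffAt (hO.mem_nhds hy)).differentiableAt (by simp)
  have hcy : MDifferentiableAt 𝓘(ℝ, V) (pairModel E) c y :=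
    (hc.contMDiffAt (hO.mem_nhds hy)).mdifferentiableAt (by simp)
  rw [coordDeriv_pair hcy, coordDeriv_pair hcy, pairForm, h3, h4]
  have h7 := (h6.hasFDerivAt.sub h5.hasFDerivAt).fderiv
  change fderiv ℝ (fun y => liouville 𝓘(ℝ, E) (fun y => (c y).2) y
        - liouville 𝓘(ℝ, E) (fun y => (c y).1) y) y = _ at h7
  rw [h7]
  simp only [sub_apply]
  ring

theorem contDiffOn_liouville_sub (hO : IsOpen O) (hc : ContMDiffOn 𝓘(ℝ, V) (pairModel E) ∞ c O) :
    ContDiffOn ℝ ∞ (fun y => liouville 𝓘(ℝ, E) (fun y => (c y).2) y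
        - liouville 𝓘(ℝ, E) (fun y => (c y).1) y) O :=
  (contDiffOn_liouville hO (contMDiff_snd.comp_contMDiffOn hc)).sub
    (contDiffOn_liouville hO (contMDiff_fst.comp_contMDiffOn hc))

/-- In each parametrization the pullback of `Ω₁₂` is the exterior derivative of a smooth one-form,
hence smooth and closed. This works for an arbitrary set `P`. -/
theorem isPresymplecticOn_omega12
    (P : Set (CotangentBundle 𝓘(ℝ, E) Q × CotangentBundle 𝓘(ℝ, E) Q)) :
    IsPresymplecticOn (Omega12 E Q) P where
  alternating x _ v _ := by
    refine (omega12_apply x v v).trans ?_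
    simp [pairForm, standardForm_apply]
  smooth k O c hO hc _ a b := by
    refine ((contDiffOn_liouville_sub hO hc).sub_fderiv_swap hO a b).congr fun y hy => ?_
    exact (omega12_apply _ _ _).trans (pairForm_pullback hO hc hy a b)
  closed k O c hO hc _ y hy a₁ a₂ a₃ := by
    have h1 : ∀ a b, (fun y => ((Omega12 E Q).pullback c :
        BilinearField 𝓘(ℝ, Fin k → ℝ) (Fin k → ℝ)) y a b) =ᶠ[𝓝 y] _ := fun a b =>
      eventually_of_mem (hO.mem_nhds hy) fun y hy =>
        (omega12_apply _ _ _).trans (pairForm_pullback hO hc hy a b)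
    rw [(h1 _ _).fderiv_eq, (h1 _ _).fderiv_eq, (h1 _ _).fderiv_eq]
    exact ((contDiffOn_liouville_sub hO hc).contDiffAt (hO.mem_nhds hy)).cyclic_sum_fderiv a₁ a₂ a₃

end Pair

/-! ### The isomorphism `T T^*Q → T^*TQ` in bundle charts. -/

section Tulczyjew

variable {E : Type*} [NormedAddCommGroup E] [NormedSpace ℝ E]
  {Q : Type*} [TopologicalSpace Q] [ChartedSpace E Q] [IsManifold 𝓘(ℝ, E) ∞ Q]

/-- The velocity in `T Q` of a tangent vector of `T^* Q`. -/
def velocity (w : TTStar E Q) : TangentBundle 𝓘(ℝ, E) Q := (tulczyjew w).proj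

/-- The covector `(δq, δv) ↦ ṗ(δq) + p(δv)` on `T Q` associated with `(q, p, q̇, ṗ)`. -/
def tulczyjewForm (z a : E × (E →L[ℝ] ℝ)) : E × E →L[ℝ] ℝ :=
  a.2.comp (ContinuousLinearMap.fst ℝ E E) + z.2.comp (ContinuousLinearMap.snd ℝ E E)

theorem tulczyjewForm_apply (z a : E × (E →L[ℝ] ℝ)) (d : E × E) :
    tulczyjewForm z a d = a.2 d.1 + z.2 d.2 := rfl

theorem covec_tulczyjew_apply (w : TTStar E Q) (d : E × E) :
    covec (tulczyjew w) d = (tangentVec w).2 d.1 + covec w.proj d.2 := rfl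

theorem coordDeriv_eq_fderiv_comp_symm {F : Type*} [NormedAddCommGroup F] [NormedSpace ℝ F]
    {H : Type*} [TopologicalSpace H] {I : ModelWithCorners ℝ F H} [I.Boundaryless]
    {M : Type*} [TopologicalSpace M] [ChartedSpace H M]
    {V : Type*} [NormedAddCommGroup V] [NormedSpace ℝ V] {g : M → V} {x : M}
    (hg : MDifferentiableAt I 𝓘(ℝ, V) g x) :
    coordDeriv I 𝓘(ℝ, V) g x = fderiv ℝ (g ∘ (extChartAt I x).symm) (extChartAt I x x) :=
  hg.mfderiv_eq_fderiv_comp_symm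

theorem contDiffAt_chart_transition {F : Type*} [NormedAddCommGroup F] [NormedSpace ℝ F]
    {H : Type*} [TopologicalSpace H] {I : ModelWithCorners ℝ F H} [I.Boundaryless]
    {M : Type*} [TopologicalSpace M] [ChartedSpace H M] [IsManifold I ∞ M] {x₀ x y : M}
    (hy : y ∈ (extChartAt I x₀).source) (hy' : y ∈ (extChartAt I x).source) :
    ContDiffAt ℝ ∞ (extChartAt I x₀ ∘ (extChartAt I x).symm) (extChartAt I x y) := by
  have h1 := (contMDiffOn_extChartAt (I := I) (n := ∞) (x := x₀)).contDiffOn_comp_symm x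
  refine h1.contDiffAt (((continuousOn_extChartAt_symm x).isOpen_inter_preimage
    (isOpen_extChartAt_target x) (chartAt H x₀).open_source).mem_nhds
      ⟨(extChartAt I x).map_source hy', ?_⟩)
  rw [mem_preimage, (extChartAt I x).left_inv hy', ← extChartAt_source I]
  exact hy

/-- The canonical isomorphism `T T^* Q → T^* T Q` in arbitrary bundle charts. -/
theorem velocity_chart (z₀ : CotangentBundle 𝓘(ℝ, E) Q) (v₀ : E) (w : TTStar E Q)
    (hw : w.proj.proj ∈ (extChartAt 𝓘(ℝ, E) z₀.proj).source) :
    extChartAt 𝓘(ℝ, E).tangent (⟨z₀.proj, v₀⟩ : TangentBundle 𝓘(ℝ, E) Q) (velocity w) =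
      (extChartAt 𝓘(ℝ, E) z₀.proj w.proj.proj,
        (coordDeriv (cotangentModel 𝓘(ℝ, E)) 𝓘(ℝ, E × (E →L[ℝ] ℝ))
          (extChartAt (cotangentModel 𝓘(ℝ, E)) z₀) w.proj (tangentVec w)).1) := by
  have hz := (mem_extChartAt_cotangent_source z₀ w.proj).2 hw
  refine (extChartAt_tangent_apply _ _ hw).trans (Prod.ext rfl ?_)
  have h1 : extChartAt 𝓘(ℝ, E) z₀.proj ∘ TotalSpace.proj =
      Prod.fst ∘ extChartAt (cotangentModel 𝓘(ℝ, E)) z₀ :=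
    funext fun z => (extChartAt_cotangent_fst z₀ z).symm
  have h2 : MDifferentiableAt (cotangentModel 𝓘(ℝ, E)) 𝓘(ℝ, E)
      (TotalSpace.proj : CotangentBundle 𝓘(ℝ, E) Q → Q) w.proj :=
    (Bundle.contMDiffAt_proj _ (n := 1)).mdifferentiableAt (by simp)
  have h3 := coordDeriv_comp (x := w.proj) (mdifferentiableAt_chart hw) h2
  rw [h1, coordDeriv_comp (I' := 𝓘(ℝ, E × (E →L[ℝ] ℝ)))
    differentiableAt_fst.mdifferentiableAt (mdifferentiableAt_chart hz),
    coordDeriv_eq_fderiv, fderiv_fst, coordDeriv_cotangent_proj] at h3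
  exact (DFunLike.congr_fun h3 (tangentVec w)).symm

/-- A change of chart `f` on `Q` changes `ṗ` by a term `-p(D²f(q̇, δq))` and `δv` by `D²f(δq, q̇)`;
by symmetry of `D²f` these cancel in `ṗ(δq) + p(δv)`. The map, defined in a chart that varies with
the point, thus gets its expression in one fixed chart. -/
theorem covec_tulczyjew_chart (z₀ : CotangentBundle 𝓘(ℝ, E) Q) (v₀ : E) (w : TTStar E Q)
    (hw : w.proj.proj ∈ (extChartAt 𝓘(ℝ, E) z₀.proj).source) :
    covec (tulczyjew w) =
      (tulczyjewForm (extChartAt (cotangentModel 𝓘(ℝ, E)) z₀ w.proj)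
        (coordDeriv (cotangentModel 𝓘(ℝ, E)) 𝓘(ℝ, E × (E →L[ℝ] ℝ))
          (extChartAt (cotangentModel 𝓘(ℝ, E)) z₀) w.proj (tangentVec w))).comp
      (coordDeriv 𝓘(ℝ, E).tangent 𝓘(ℝ, E × E)
        (extChartAt 𝓘(ℝ, E).tangent (⟨z₀.proj, v₀⟩ : TangentBundle 𝓘(ℝ, E) Q)) (velocity w)) := by
  set z := w.proj with hzdef
  set ξ := velocity w with hξ
  set q := z.proj with hq
  set ξ₀ : TangentBundle 𝓘(ℝ, E) Q := ⟨z₀.proj, v₀⟩ with hξ₀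
  set φ := extChartAt 𝓘(ℝ, E) q with hφ
  set φ₀ := extChartAt 𝓘(ℝ, E) z₀.proj with hφ₀
  set X := extChartAt (cotangentModel 𝓘(ℝ, E)) z with hX
  set X₀ := extChartAt (cotangentModel 𝓘(ℝ, E)) z₀ with hX₀
  set Y := extChartAt 𝓘(ℝ, E).tangent ξ with hY
  set Y₀ := extChartAt 𝓘(ℝ, E).tangent ξ₀ with hY₀
  have hz : z ∈ X₀.source := (mem_extChartAt_cotangent_source z₀ z).2 hw
  have hξs : ξ ∈ Y₀.source := (mem_extChartAt_tangent_source ξ₀ ξ).2 hw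
  set f := φ₀ ∘ φ.symm with hf
  have hqs : q ∈ φ.source := mem_extChartAt_source q
  have hfs : ContDiffAt ℝ ∞ f (φ q) := contDiffAt_chart_transition hw hqs
  have hXz : X z = (φ q, covec z) := extChartAt_cotangent_self z
  have hYξ : Y ξ = (φ q, (tangentVec w).1) := extChartAt_tangent_self ξ
  -- the transition functions of the two bundles
  set T := X₀ ∘ X.symm with hT
  set T' := Y₀ ∘ Y.symm with hT'
  have hTd : HasFDerivAt T (fderiv ℝ T (X z)) (X z) :=
    ((contDiffAt_chart_transition hz (mem_extChartAt_source z)).differentiableAt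
      (by simp)).hasFDerivAt
  have hnear : ∀ᶠ x in 𝓝 (φ q), x ∈ φ.target ∧ φ.symm x ∈ φ₀.source ∧ DifferentiableAt ℝ f x := by
    have h1 : ∀ᶠ x in 𝓝 (φ q), φ.symm x ∈ φ₀.source :=
      (continuousAt_extChartAt_symm q).eventually_mem (by
        rw [φ.left_inv hqs]
        exact (isOpen_extChartAt_source _).mem_nhds hw)
    have h2 := (hfs.of_le (m := 1) (by simp)).eventually (by simp)
    filter_upwards [extChartAt_target_mem_nhds (I := 𝓘(ℝ, E)) q, h1, h2] with x h1 h2 h3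
    exact ⟨h1, h2, h3.differentiableAt (by simp)⟩
  have hchart : ∀ q', q' ∈ φ.source → q' ∈ φ₀.source → DifferentiableAt ℝ f (φ q') →
      coordDeriv 𝓘(ℝ, E) 𝓘(ℝ, E) φ₀ q' =
        (fderiv ℝ f (φ q')).comp (coordDeriv 𝓘(ℝ, E) 𝓘(ℝ, E) φ q') :=
    fun q' h1 h2 h3 => coordDeriv_eq_fderiv_comp_chart h1 h3
  -- The transformation law of covectors in implicit form. Differentiating it (`hDT`) gives what is
  -- needed about the derivative of the transition map without inverting `Df`.
  have hTsnd : (fun y => (T y).2.comp (fderiv ℝ f y.1)) =ᶠ[𝓝 (X z)] Prod.snd := by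
    have h1 : Tendsto Prod.fst (𝓝 (X z)) (𝓝 (φ q)) := by
      rw [hXz]
      exact continuous_fst.tendsto _
    filter_upwards [extChartAt_target_mem_nhds (I := cotangentModel 𝓘(ℝ, E)) z,
      h1.eventually hnear] with y hy hy1
    have e1 : y.1 = φ (X.symm y).proj := by
      rw [← extChartAt_cotangent_fst z (X.symm y), X.right_inv hy]
    have hs : (X.symm y).proj ∈ φ.source :=
      (mem_extChartAt_cotangent_source z _).1 (X.map_target hy)
    have e2 : φ.symm y.1 = (X.symm y).proj := by rw [e1, φ.left_inv hs]
    have h2 := extChartAt_cotangent_snd_comp z₀ (X.symm y) (e2 ▸ hy1.2.1)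
    have h3 := extChartAt_cotangent_snd_comp z (X.symm y) hs
    change (T y).2.comp (coordDeriv 𝓘(ℝ, E) 𝓘(ℝ, E) φ₀ (X.symm y).proj) = _ at h2
    rw [hchart _ hs (e2 ▸ hy1.2.1) (e1 ▸ hy1.2.2), ← e1, ← h3] at h2
    change _ = (X (X.symm y)).2.comp (coordDeriv 𝓘(ℝ, E) 𝓘(ℝ, E) φ (X.symm y).proj) at h2
    rw [X.right_inv hy] at h2
    ext v
    have h4 := DFunLike.congr_fun h2
      (coordDeriv 𝓘(ℝ, E) 𝓘(ℝ, E) φ.symm (φ (X.symm y).proj) v)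
    simpa only [ContinuousLinearMap.comp_apply, coordDeriv_chart_comp_symm hs, φ] using h4
  have hT'e : T' =ᶠ[𝓝 (Y ξ)] fun y => (f y.1, fderiv ℝ f y.1 y.2) := by
    have h1 : Tendsto Prod.fst (𝓝 (Y ξ)) (𝓝 (φ q)) := by
      rw [hYξ]
      exact continuous_fst.tendsto _
    filter_upwards [extChartAt_target_mem_nhds (I := 𝓘(ℝ, E).tangent) ξ,
      h1.eventually hnear] with y hy hy1
    have hs : (Y.symm y).proj ∈ φ.source :=
      (mem_extChartAt_tangent_source ξ _).1 (Y.map_target hy)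
    have e0 := extChartAt_tangent_apply ξ (Y.symm y) hs
    change Y (Y.symm y) = (φ _, coordDeriv 𝓘(ℝ, E) 𝓘(ℝ, E) φ _ _) at e0
    rw [Y.right_inv hy] at e0
    have e1 : y.1 = φ (Y.symm y).proj := congrArg Prod.fst e0
    have e2 : φ.symm y.1 = (Y.symm y).proj := by rw [e1, φ.left_inv hs]
    have h2 := extChartAt_tangent_apply ξ₀ (Y.symm y) (e2 ▸ hy1.2.1)
    refine h2.trans (Prod.ext ?_ ?_)
    · exact congrArg φ₀ e2.symm
    · change coordDeriv 𝓘(ℝ, E) 𝓘(ℝ, E) φ₀ (Y.symm y).proj _ = fderiv ℝ f y.1 y.2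
      rw [hchart _ hs (e2 ▸ hy1.2.1) (e1 ▸ hy1.2.2), ← e1, congrArg Prod.snd e0]
      rfl
  have hfd : HasFDerivAt f (fderiv ℝ f (φ q)) (φ q) := (hfs.differentiableAt (by simp)).hasFDerivAt
  have hfdd : HasFDerivAt (fderiv ℝ f) (fderiv ℝ (fderiv ℝ f) (φ q)) (φ q) :=
    ((hfs.fderiv_right (m := ∞) (by simp)).differentiableAt (by simp)).hasFDerivAt
  have hDT' : ∀ d : E × E, fderiv ℝ T' (Y ξ) d = (fderiv ℝ f (φ q) d.1,
      fderiv ℝ f (φ q) d.2 + fderiv ℝ (fderiv ℝ f) (φ q) d.1 (tangentVec w).1) := by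
    intro d
    rw [hT'e.fderiv_eq, hYξ]
    have h1 : HasFDerivAt (fun y : E × E => (f y.1, fderiv ℝ f y.1 y.2)) _
        (φ q, (tangentVec w).1) :=
      (HasFDerivAt.comp (φ q, (tangentVec w).1) (f := Prod.fst) hfd hasFDerivAt_fst).prodMk
      ((HasFDerivAt.comp (φ q, (tangentVec w).1) (f := Prod.fst) hfdd hasFDerivAt_fst).clm_apply
        hasFDerivAt_snd)
    rw [h1.fderiv]
    rfl
  have hDT : ∀ (a : E × (E →L[ℝ] ℝ)) (d : E), (fderiv ℝ T (X z) a).2 (fderiv ℝ f (φ q) d) +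
      (T (X z)).2 (fderiv ℝ (fderiv ℝ f) (φ q) a.1 d) = a.2 d := by
    intro a d
    have e1 : HasFDerivAt (fun y : E × (E →L[ℝ] ℝ) => fderiv ℝ f y.1)
        ((fderiv ℝ (fderiv ℝ f) (φ q)).comp (ContinuousLinearMap.fst ℝ E (E →L[ℝ] ℝ))) (X z) := by
      have : HasFDerivAt (fderiv ℝ f) (fderiv ℝ (fderiv ℝ f) (φ q)) (X z).1 := by rw [hXz]; exact hfdd
      exact this.comp (X z) hasFDerivAt_fst
    have e2 : HasFDerivAt (fun y => (T y).2)
      ((ContinuousLinearMap.snd ℝ E (E →L[ℝ] ℝ)).comp (fderiv ℝ T (X z))) (X z) :=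
      hasFDerivAt_snd.comp (X z) hTd
    have e3 := (e2.clm_comp e1).fderiv
    rw [hTsnd.fderiv_eq, fderiv_snd] at e3
    have e4 := DFunLike.congr_fun (DFunLike.congr_fun e3 a) d
    have e5 : (X z).1 = φ q := by rw [hXz]
    simp only [e5] at e4
    rw [add_comm]
    exact e4.symm
  have c1 : coordDeriv (cotangentModel 𝓘(ℝ, E)) 𝓘(ℝ, E × (E →L[ℝ] ℝ)) X₀ z = fderiv ℝ T (X z) :=
    coordDeriv_eq_fderiv_comp_symm (mdifferentiableAt_chart hz)
  have c2 : coordDeriv 𝓘(ℝ, E).tangent 𝓘(ℝ, E × E) Y₀ ξ = fderiv ℝ T' (Y ξ) :=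
    coordDeriv_eq_fderiv_comp_symm (mdifferentiableAt_chart hξs)
  refine ContinuousLinearMap.ext fun d => ?_
  rw [c1, c2, ContinuousLinearMap.comp_apply, hDT', tulczyjewForm_apply, covec_tulczyjew_apply]
  have hTz : T (X z) = X₀ z := congrArg X₀ (X.left_inv (mem_extChartAt_source z))
  have h1 := hDT (tangentVec w) d.1
  have h2 : (T (X z)).2 (fderiv ℝ f (X z).1 d.2) = (X z).2 d.2 :=
    DFunLike.congr_fun hTsnd.self_of_nhds d.2
  rw [hTz] at h1 h2
  rw [show (X z).1 = φ q by rw [hXz], show (X z).2 = covec z by rw [hXz]] at h2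
  have h3 := hfs.fderiv_fderiv_comm d.1 (tangentVec w).1
  change (tangentVec w).2 d.1 + covec z d.2 = _
  rw [map_add, h2, ← h1, h3]
  ring

end Tulczyjew

/-! ### Injectivity and coordinate expression of the cotangent lift. -/

section CotangentLift

variable {E : Type*} [NormedAddCommGroup E] [NormedSpace ℝ E]
  {Q : Type*} [TopologicalSpace Q] [ChartedSpace E Q] [IsManifold 𝓘(ℝ, E) ∞ Q]
  {D : Set (TangentBundle 𝓘(ℝ, E) Q)} {R : TangentBundle 𝓘(ℝ, E) Q → Q × Q}

theorem exists_equiv_coordDeriv_chart {F : Type*} [NormedAddCommGroup F] [NormedSpace ℝ F]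
    {H : Type*} [TopologicalSpace H] {I : ModelWithCorners ℝ F H} [I.Boundaryless]
    {M : Type*} [TopologicalSpace M] [ChartedSpace H M] [IsManifold I ∞ M] {x y : M}
    (hy : y ∈ (extChartAt I x).source) :
    ∃ B : F ≃L[ℝ] F, coordDeriv I 𝓘(ℝ, F) (extChartAt I x) y = B :=
  ⟨ContinuousLinearEquiv.equivOfInverse (coordDeriv I 𝓘(ℝ, F) (extChartAt I x) y)
    (coordDeriv 𝓘(ℝ, F) I (extChartAt I x).symm (extChartAt I x y))
    (coordDeriv_symm_comp_chart hy) (coordDeriv_chart_comp_symm hy), rfl⟩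

theorem coordDeriv_chart_prod (x y : Q × Q)
    (hy : y ∈ (extChartAt (𝓘(ℝ, E).prod 𝓘(ℝ, E)) x).source) (v : E × E) :
    coordDeriv (𝓘(ℝ, E).prod 𝓘(ℝ, E)) 𝓘(ℝ, E × E) (extChartAt (𝓘(ℝ, E).prod 𝓘(ℝ, E)) x) y v =
      (coordDeriv 𝓘(ℝ, E) 𝓘(ℝ, E) (extChartAt 𝓘(ℝ, E) x.1) y.1 v.1,
        coordDeriv 𝓘(ℝ, E) 𝓘(ℝ, E) (extChartAt 𝓘(ℝ, E) x.2) y.2 v.2) := by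
  have hy' : y.1 ∈ (extChartAt 𝓘(ℝ, E) x.1).source ∧ y.2 ∈ (extChartAt 𝓘(ℝ, E) x.2).source := by
    rw [extChartAt_prod] at hy
    exact hy
  have hd := mdifferentiableAt_chart hy
  set Y := extChartAt (𝓘(ℝ, E).prod 𝓘(ℝ, E)) x with hY
  have e1 : Prod.fst ∘ Y = extChartAt 𝓘(ℝ, E) x.1 ∘ Prod.fst := by
    rw [hY, extChartAt_prod]
    rfl
  have e2 : Prod.snd ∘ Y = extChartAt 𝓘(ℝ, E) x.2 ∘ Prod.snd := by
    rw [hY, extChartAt_prod]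
    rfl
  have h1 := coordDeriv_comp (I'' := 𝓘(ℝ, E)) (x := y) (f := Y) (g := Prod.fst)
    differentiableAt_fst.mdifferentiableAt hd
  have h2 := coordDeriv_comp (I'' := 𝓘(ℝ, E)) (x := y) (f := Y) (g := Prod.snd)
    differentiableAt_snd.mdifferentiableAt hd
  rw [e1, coordDeriv_comp (I' := 𝓘(ℝ, E)) (mdifferentiableAt_chart hy'.1) mdifferentiableAt_fst,
    coordDeriv_eq_fderiv, fderiv_fst] at h1
  rw [e2, coordDeriv_comp (I' := 𝓘(ℝ, E)) (mdifferentiableAt_chart hy'.2) mdifferentiableAt_snd,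
    coordDeriv_eq_fderiv, fderiv_snd] at h2
  have f1 : coordDeriv (𝓘(ℝ, E).prod 𝓘(ℝ, E)) 𝓘(ℝ, E) (Prod.fst : Q × Q → Q) y =
    ContinuousLinearMap.fst ℝ E E := mfderiv_fst
  have f2 : coordDeriv (𝓘(ℝ, E).prod 𝓘(ℝ, E)) 𝓘(ℝ, E) (Prod.snd : Q × Q → Q) y =
    ContinuousLinearMap.snd ℝ E E := mfderiv_snd
  rw [f1] at h1
  rw [f2] at h2
  exact Prod.ext (DFunLike.congr_fun h1 v).symm (DFunLike.congr_fun h2 v).symm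

theorem contMDiff_velocity :
    ContMDiff (cotangentModel 𝓘(ℝ, E)).tangent 𝓘(ℝ, E).tangent ∞
      (velocity : TTStar E Q → TangentBundle 𝓘(ℝ, E) Q) := by
  intro w₀
  rw [contMDiffAt_totalSpace]
  constructor
  · exact (Bundle.contMDiff_proj _).comp (Bundle.contMDiff_proj _) w₀
  · have h1 : ContMDiffAt (cotangentModel 𝓘(ℝ, E)).tangent 𝓘(ℝ, E) ∞
        (fun w : TTStar E Q => (extChartAt (cotangentModel 𝓘(ℝ, E)).tangent w₀ w).2.1) w₀ := by
      have h2 : ContDiff ℝ ∞ (fun y : (E × (E →L[ℝ] ℝ)) × (E × (E →L[ℝ] ℝ)) => y.2.1) := by fun_prop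
      exact h2.contMDiff.contMDiffAt.comp w₀ contMDiffAt_extChartAt
    refine h1.congr_of_eventuallyEq ?_
    filter_upwards [extChartAt_source_mem_nhds (I := (cotangentModel 𝓘(ℝ, E)).tangent) w₀] with w hw
    have hw' := (mem_extChartAt_tangent_source _ _).1 hw
    have h3 := velocity_chart w₀.proj (tangentVec w₀).1 w
      ((mem_extChartAt_cotangent_source _ _).1 hw')
    rw [extChartAt_tangent_apply w₀ w hw']
    exact congrArg Prod.snd h3

theorem isOpen_cotangentLiftDomain (hD : IsOpen D) : IsOpen (cotangentLiftDomain D) :=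
  hD.preimage (contMDiff_velocity (E := E) (Q := Q)).continuous

theorem covec_cotangentLift_fst (w : TTStar E Q) : covec (cotangentLift R w).1 =
    -((covec (hatLift R (tulczyjew w))).comp (ContinuousLinearMap.inl ℝ E E)) := rfl

theorem covec_cotangentLift_snd (w : TTStar E Q) : covec (cotangentLift R w).2 =
    (covec (hatLift R (tulczyjew w))).comp (ContinuousLinearMap.inr ℝ E E) := rfl

variable [FiniteDimensional ℝ E]

theorem IsDiffeoOntoImage.exists_equiv (hR : IsDiffeoOntoImage D R)
    {ξ : TangentBundle 𝓘(ℝ, E) Q} (hξ : ξ ∈ D) :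
    ∃ A : (E × E) ≃L[ℝ] (E × E),
      coordDeriv 𝓘(ℝ, E).tangent (𝓘(ℝ, E).prod 𝓘(ℝ, E)) R ξ = A := by
  have hb : Function.Bijective
    (coordDeriv 𝓘(ℝ, E).tangent (𝓘(ℝ, E).prod 𝓘(ℝ, E)) R ξ).toLinearMap := hR.2.2.2 ξ hξ
  exact ⟨(LinearEquiv.ofBijective _ hb).toContinuousLinearEquiv, by ext <;> rfl⟩

/-- Over `D` the differential of `R` is invertible, so the default value of
`ContinuousLinearMap.inverse` never enters. This inverse-free form is the one used for injectivity,
coordinates and the Liouville form. -/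
theorem covec_hatLift_comp (hR : IsDiffeoOntoImage D R) {w : TTStar E Q}
    (hw : w ∈ cotangentLiftDomain D) :
    (covec (hatLift R (tulczyjew w))).comp
      (coordDeriv 𝓘(ℝ, E).tangent (𝓘(ℝ, E).prod 𝓘(ℝ, E)) R (velocity w)) =
      covec (tulczyjew w) := by
  obtain ⟨A, hA⟩ := hR.exists_equiv (ξ := velocity w) hw
  have h1 : covec (hatLift R (tulczyjew w)) = (covec (tulczyjew w)).comp
      (ContinuousLinearMap.inverse
        (coordDeriv 𝓘(ℝ, E).tangent (𝓘(ℝ, E).prod 𝓘(ℝ, E)) R (velocity w))) := rfl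
  rw [h1, hA, ContinuousLinearMap.inverse_equiv]
  ext <;> simp

/-- The base points determine `(q, q̇)` because `R` is injective. The two momenta determine the
covector on `Q × Q`, and its pullback by `dR` is `(δq, δv) ↦ ṗ(δq) + p(δv)`, from which `ṗ` and `p`
are read off. -/
theorem injOn_cotangentLift (hR : IsDiffeoOntoImage D R) :
    InjOn (cotangentLift R) (cotangentLiftDomain D) := by
  intro w hw w' hw' h
  have h1 : velocity w = velocity w' := hR.2.2.1 hw hw'
    (Prod.ext (congrArg (fun y => y.1.proj) h) (congrArg (fun y => y.2.proj) h))
  have h2 : covec (hatLift R (tulczyjew w)) = covec (hatLift R (tulczyjew w')) := by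
    have e1 := congrArg (fun y => covec y.1) h
    have e2 := congrArg (fun y => covec y.2) h
    simp only [covec_cotangentLift_fst, covec_cotangentLift_snd, neg_inj] at e1 e2
    refine ContinuousLinearMap.ext fun v => ?_
    have e3 := congrArg₂ (· + ·) (DFunLike.congr_fun e1 v.1) (DFunLike.congr_fun e2 v.2)
    simpa [← map_add] using e3
  have h3 := covec_hatLift_comp hR hw
  rw [h1, h2, covec_hatLift_comp hR hw'] at h3
  have hq : w.proj.proj = w'.proj.proj :=
    congrArg (fun ξ : TangentBundle 𝓘(ℝ, E) Q => ξ.proj) h1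
  have hv : (tangentVec w).1 = (tangentVec w').1 := congrArg tangentVec h1
  have hp : covec w.proj = covec w'.proj := by
    ext d
    have := DFunLike.congr_fun h3 (0, d)
    simpa [covec_tulczyjew_apply] using this.symm
  have hv' : (tangentVec w).2 = (tangentVec w').2 := by
    ext d
    have := DFunLike.congr_fun h3 (d, 0)
    simpa [covec_tulczyjew_apply] using this.symm
  obtain ⟨⟨q, p⟩, v⟩ := w
  obtain ⟨⟨q', p'⟩, v'⟩ := w'
  change q = q' at hq
  subst hq
  change p = p' at hp
  subst hp
  have hvv : v = v' := Prod.ext hv hv'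
  rw [hvv]

/-- The coordinate expression of the cotangent lift. -/
def liftCoord (r : E × E → E × E) (y : (E × (E →L[ℝ] ℝ)) × (E × (E →L[ℝ] ℝ))) : E × E →L[ℝ] ℝ :=
  (tulczyjewForm y.1 y.2).comp (ContinuousLinearMap.inverse (fderiv ℝ r (y.1.1, y.2.1)))

theorem contDiffAt_liftCoord {r : E × E → E × E} {y : (E × (E →L[ℝ] ℝ)) × (E × (E →L[ℝ] ℝ))}
    (hr : ContDiffAt ℝ ∞ r (y.1.1, y.2.1)) (A : (E × E) ≃L[ℝ] (E × E))
    (hA : fderiv ℝ r (y.1.1, y.2.1) = A) : ContDiffAt ℝ ∞ (liftCoord r) y := by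
  have h1 : ContDiff ℝ ∞ (fun y : (E × (E →L[ℝ] ℝ)) × (E × (E →L[ℝ] ℝ)) =>
      tulczyjewForm y.1 y.2) := by
    unfold tulczyjewForm
    exact ((contDiff_snd.comp contDiff_snd).clm_comp contDiff_const).add
      ((contDiff_snd.comp contDiff_fst).clm_comp contDiff_const)
  have h2 : ContDiffAt ℝ ∞ (fderiv ℝ r) (y.1.1, y.2.1) := hr.fderiv_right (by simp)
  have h3 : ContDiff ℝ ∞ (fun y : (E × (E →L[ℝ] ℝ)) × (E × (E →L[ℝ] ℝ)) => (y.1.1, y.2.1)) := by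
    fun_prop
  have h4 : ContDiffAt ℝ ∞ (ContinuousLinearMap.inverse : (E × E →L[ℝ] E × E) → _)
      (fderiv ℝ r (y.1.1, y.2.1)) := hA ▸ contDiffAt_map_inverse A
  have h5 : ContDiffAt ℝ ∞ (fun y : (E × (E →L[ℝ] ℝ)) × (E × (E →L[ℝ] ℝ)) =>
      fderiv ℝ r (y.1.1, y.2.1)) y :=
    ContDiffAt.comp y (f := fun y : (E × (E →L[ℝ] ℝ)) × (E × (E →L[ℝ] ℝ)) => (y.1.1, y.2.1))
      h2 h3.contDiffAt
  have h6 : ContDiffAt ℝ ∞ (fun y : (E × (E →L[ℝ] ℝ)) × (E × (E →L[ℝ] ℝ)) =>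
      ContinuousLinearMap.inverse (fderiv ℝ r (y.1.1, y.2.1))) y :=
    ContDiffAt.comp y (f := fun y : (E × (E →L[ℝ] ℝ)) × (E × (E →L[ℝ] ℝ)) =>
      fderiv ℝ r (y.1.1, y.2.1)) h4 h5
  exact h1.contDiffAt.clm_comp h6

end CotangentLift

/-! ### Smoothness of the cotangent lift. -/

section CotangentLiftSmooth

variable {E : Type*} [NormedAddCommGroup E] [NormedSpace ℝ E]
  {Q : Type*} [TopologicalSpace Q] [ChartedSpace E Q] [IsManifold 𝓘(ℝ, E) ∞ Q]
  {D : Set (TangentBundle 𝓘(ℝ, E) Q)} {R : TangentBundle 𝓘(ℝ, E) Q → Q × Q}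

/-- The canonical isomorphism `T T^* Q → T^* T Q` in the coordinates of `T T^* Q`. -/
theorem extChartAt_velocity (w₀ w : TTStar E Q)
    (hw : w ∈ (extChartAt (cotangentModel 𝓘(ℝ, E)).tangent w₀).source) :
    extChartAt 𝓘(ℝ, E).tangent (velocity w₀) (velocity w) =
      ((extChartAt (cotangentModel 𝓘(ℝ, E)).tangent w₀ w).1.1,
        (extChartAt (cotangentModel 𝓘(ℝ, E)).tangent w₀ w).2.1) := by
  have hw' := (mem_extChartAt_tangent_source _ _).1 hw
  rw [extChartAt_tangent_apply w₀ w hw']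
  refine (velocity_chart w₀.proj (tangentVec w₀).1 w
    ((mem_extChartAt_cotangent_source _ _).1 hw')).trans (Prod.ext ?_ rfl)
  exact (extChartAt_cotangent_fst w₀.proj w.proj).symm

theorem velocity_mem_extChartAt_source (w₀ w : TTStar E Q)
    (hw : w ∈ (extChartAt (cotangentModel 𝓘(ℝ, E)).tangent w₀).source) :
    velocity w ∈ (extChartAt 𝓘(ℝ, E).tangent (velocity w₀)).source :=
  (mem_extChartAt_tangent_source _ _).2
    ((mem_extChartAt_cotangent_source _ _).1 ((mem_extChartAt_tangent_source _ _).1 hw))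

theorem covec_tulczyjew_eq (w₀ w : TTStar E Q)
    (hw : w ∈ (extChartAt (cotangentModel 𝓘(ℝ, E)).tangent w₀).source) :
    covec (tulczyjew w) =
      (tulczyjewForm (extChartAt (cotangentModel 𝓘(ℝ, E)).tangent w₀ w).1
        (extChartAt (cotangentModel 𝓘(ℝ, E)).tangent w₀ w).2).comp
      (coordDeriv 𝓘(ℝ, E).tangent 𝓘(ℝ, E × E)
        (extChartAt 𝓘(ℝ, E).tangent (velocity w₀)) (velocity w)) := by
  have hw' := (mem_extChartAt_tangent_source _ _).1 hw
  rw [extChartAt_tangent_apply w₀ w hw']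
  exact covec_tulczyjew_chart w₀.proj (tangentVec w₀).1 w
    ((mem_extChartAt_cotangent_source _ _).1 hw')

variable [FiniteDimensional ℝ E]

/-- The expression of `R` in the charts at `ξ₀` and `R ξ₀`. -/
def chartExpr (R : TangentBundle 𝓘(ℝ, E) Q → Q × Q) (ξ₀ : TangentBundle 𝓘(ℝ, E) Q) :
    E × E → E × E :=
  (extChartAt (𝓘(ℝ, E).prod 𝓘(ℝ, E)) (R ξ₀) ∘ R) ∘ (extChartAt 𝓘(ℝ, E).tangent ξ₀).symm

theorem IsDiffeoOntoImage.contDiffAt_chartExpr (hR : IsDiffeoOntoImage D R)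
    {ξ₀ ξ : TangentBundle 𝓘(ℝ, E) Q} (hξ : ξ ∈ D)
    (hs : ξ ∈ (extChartAt 𝓘(ℝ, E).tangent ξ₀).source)
    (hs' : R ξ ∈ (extChartAt (𝓘(ℝ, E).prod 𝓘(ℝ, E)) (R ξ₀)).source) :
    ContDiffAt ℝ ∞ (chartExpr R ξ₀) (extChartAt 𝓘(ℝ, E).tangent ξ₀ ξ) ∧
    ∃ A : (E × E) ≃L[ℝ] (E × E),
      fderiv ℝ (chartExpr R ξ₀) (extChartAt 𝓘(ℝ, E).tangent ξ₀ ξ) = A ∧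
      (coordDeriv (𝓘(ℝ, E).prod 𝓘(ℝ, E)) 𝓘(ℝ, E × E)
        (extChartAt (𝓘(ℝ, E).prod 𝓘(ℝ, E)) (R ξ₀)) (R ξ)).comp
      (coordDeriv 𝓘(ℝ, E).tangent (𝓘(ℝ, E).prod 𝓘(ℝ, E)) R ξ) =
      (A : E × E →L[ℝ] E × E).comp
        (coordDeriv 𝓘(ℝ, E).tangent 𝓘(ℝ, E × E) (extChartAt 𝓘(ℝ, E).tangent ξ₀) ξ) := by
  have h0 := hR.2.1.contDiffOn_chart ξ₀ (R ξ₀)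
  have h1 : ContDiffAt ℝ ∞ (chartExpr R ξ₀) (extChartAt 𝓘(ℝ, E).tangent ξ₀ ξ) := by
    refine h0.contDiffAt ((isOpen_chart_inter hR.1 hR.2.1.continuousOn ξ₀
      (isOpen_extChartAt_source _)).mem_nhds ⟨(extChartAt _ _).map_source hs, ?_⟩)
    rw [mem_preimage, (extChartAt _ _).left_inv hs]
    exact ⟨hξ, hs'⟩
  obtain ⟨A, hA⟩ := hR.exists_equiv hξ
  obtain ⟨B, hB⟩ := exists_equiv_coordDeriv_chart hs
  obtain ⟨C, hC⟩ := exists_equiv_coordDeriv_chart hs'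
  have hRd : MDifferentiableAt 𝓘(ℝ, E).tangent (𝓘(ℝ, E).prod 𝓘(ℝ, E)) R ξ :=
    (hR.2.1.contMDiffAt (hR.1.mem_nhds hξ)).mdifferentiableAt (by simp)
  have h2 := coordDeriv_eq_fderiv_comp_chart
    (g := extChartAt (𝓘(ℝ, E).prod 𝓘(ℝ, E)) (R ξ₀) ∘ R) hs (h1.differentiableAt (by simp))
  rw [coordDeriv_comp (mdifferentiableAt_chart hs') hRd, hC, hA, hB] at h2
  refine ⟨h1, (B.symm.trans A).trans C, ?_, ?_⟩
  · refine ContinuousLinearMap.ext fun v => ?_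
    have h3 := DFunLike.congr_fun h2 (B.symm v)
    simp only [ContinuousLinearMap.comp_apply, ContinuousLinearEquiv.coe_coe,
      ContinuousLinearEquiv.apply_symm_apply] at h3
    exact h3.symm
  · rw [hC, hA, hB]
    ext <;> simp

theorem covec_hatLift_chart (hR : IsDiffeoOntoImage D R) {w₀ w : TTStar E Q}
    (hw : w ∈ cotangentLiftDomain D)
    (hs : w ∈ (extChartAt (cotangentModel 𝓘(ℝ, E)).tangent w₀).source)
    (hs' : R (velocity w) ∈
      (extChartAt (𝓘(ℝ, E).prod 𝓘(ℝ, E)) (R (velocity w₀))).source) :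
    covec (hatLift R (tulczyjew w)) =
      (liftCoord (chartExpr R (velocity w₀))
        (extChartAt (cotangentModel 𝓘(ℝ, E)).tangent w₀ w)).comp
      (coordDeriv (𝓘(ℝ, E).prod 𝓘(ℝ, E)) 𝓘(ℝ, E × E)
        (extChartAt (𝓘(ℝ, E).prod 𝓘(ℝ, E)) (R (velocity w₀))) (R (velocity w))) := by
  obtain ⟨-, A, hA, hAc⟩ := hR.contDiffAt_chartExpr (ξ := velocity w) hw
    (velocity_mem_extChartAt_source w₀ w hs) hs'
  obtain ⟨B, hB⟩ := hR.exists_equiv (ξ := velocity w) hw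
  have h1 := covec_hatLift_comp hR hw
  rw [extChartAt_velocity w₀ w hs] at hA
  have h2 : ((liftCoord (chartExpr R (velocity w₀))
        (extChartAt (cotangentModel 𝓘(ℝ, E)).tangent w₀ w)).comp
      (coordDeriv (𝓘(ℝ, E).prod 𝓘(ℝ, E)) 𝓘(ℝ, E × E)
        (extChartAt (𝓘(ℝ, E).prod 𝓘(ℝ, E)) (R (velocity w₀))) (R (velocity w)))).comp
      (coordDeriv 𝓘(ℝ, E).tangent (𝓘(ℝ, E).prod 𝓘(ℝ, E)) R (velocity w)) =
      covec (tulczyjew w) := by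
    rw [ContinuousLinearMap.comp_assoc, hAc, covec_tulczyjew_eq w₀ w hs, liftCoord, hA,
      ContinuousLinearMap.inverse_equiv]
    refine ContinuousLinearMap.ext fun v => ?_
    simp
  refine ContinuousLinearMap.ext fun v => ?_
  have h3 := DFunLike.congr_fun (h1.trans h2.symm) (B.symm v)
  rw [hB] at h3
  simpa using h3

theorem extChartAt_cotangentLift (hR : IsDiffeoOntoImage D R) {w₀ w : TTStar E Q}
    (hw : w ∈ cotangentLiftDomain D)
    (hs : w ∈ (extChartAt (cotangentModel 𝓘(ℝ, E)).tangent w₀).source)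
    (hs' : R (velocity w) ∈
      (extChartAt (𝓘(ℝ, E).prod 𝓘(ℝ, E)) (R (velocity w₀))).source) :
    (extChartAt (cotangentModel 𝓘(ℝ, E)) (cotangentLift R w₀).1 (cotangentLift R w).1).2 =
      -((liftCoord (chartExpr R (velocity w₀))
        (extChartAt (cotangentModel 𝓘(ℝ, E)).tangent w₀ w)).comp
          (ContinuousLinearMap.inl ℝ E E)) ∧
    (extChartAt (cotangentModel 𝓘(ℝ, E)) (cotangentLift R w₀).2 (cotangentLift R w).2).2 =
      (liftCoord (chartExpr R (velocity w₀))
        (extChartAt (cotangentModel 𝓘(ℝ, E)).tangent w₀ w)).comp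
          (ContinuousLinearMap.inr ℝ E E) := by
  have h1 := covec_hatLift_chart hR hw hs hs'
  have hs1 : (R (velocity w)).1 ∈ (extChartAt 𝓘(ℝ, E) (R (velocity w₀)).1).source ∧
      (R (velocity w)).2 ∈ (extChartAt 𝓘(ℝ, E) (R (velocity w₀)).2).source := by
    rw [extChartAt_prod] at hs'
    exact hs'
  have h2 := coordDeriv_chart_prod (R (velocity w₀)) (R (velocity w)) hs'
  obtain ⟨B₁, hB₁⟩ := exists_equiv_coordDeriv_chart hs1.1
  obtain ⟨B₂, hB₂⟩ := exists_equiv_coordDeriv_chart hs1.2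
  have e1 := extChartAt_cotangent_snd_comp (cotangentLift R w₀).1 (cotangentLift R w).1 hs1.1
  have e2 := extChartAt_cotangent_snd_comp (cotangentLift R w₀).2 (cotangentLift R w).2 hs1.2
  rw [covec_cotangentLift_fst, h1] at e1
  rw [covec_cotangentLift_snd, h1] at e2
  constructor
  · refine ContinuousLinearMap.ext fun v => ?_
    have h3 := DFunLike.congr_fun e1 (B₁.symm v)
    change (extChartAt (cotangentModel 𝓘(ℝ, E)) (cotangentLift R w₀).1 (cotangentLift R w).1).2
      (coordDeriv 𝓘(ℝ, E) 𝓘(ℝ, E) (extChartAt 𝓘(ℝ, E) (R (velocity w₀)).1)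
        (R (velocity w)).1 (B₁.symm v)) = - (liftCoord (chartExpr R (velocity w₀))
        (extChartAt (cotangentModel 𝓘(ℝ, E)).tangent w₀ w))
        (coordDeriv _ _ _ _ (B₁.symm v, 0)) at h3
    rw [h2, hB₁] at h3
    simpa using h3
  · refine ContinuousLinearMap.ext fun v => ?_
    have h3 := DFunLike.congr_fun e2 (B₂.symm v)
    change (extChartAt (cotangentModel 𝓘(ℝ, E)) (cotangentLift R w₀).2 (cotangentLift R w).2).2
      (coordDeriv 𝓘(ℝ, E) 𝓘(ℝ, E) (extChartAt 𝓘(ℝ, E) (R (velocity w₀)).2)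
        (R (velocity w)).2 (B₂.symm v)) = (liftCoord (chartExpr R (velocity w₀))
        (extChartAt (cotangentModel 𝓘(ℝ, E)).tangent w₀ w))
        (coordDeriv _ _ _ _ (0, B₂.symm v)) at h3
    rw [h2, hB₂] at h3
    simpa using h3

/-- In the charts at `w₀` and its image, the momenta are the two halves of `liftCoord`, up to sign,
and inversion of linear maps is smooth at invertible ones. -/
theorem contMDiffOn_cotangentLift (hR : IsDiffeoOntoImage D R) :
    ContMDiffOn (cotangentModel 𝓘(ℝ, E)).tangent (pairModel E) ∞ (cotangentLift R)
      (cotangentLiftDomain D : Set (TTStar E Q)) := by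
  intro w₀ hw₀
  have hRv : ContMDiffAt (cotangentModel 𝓘(ℝ, E)).tangent (𝓘(ℝ, E).prod 𝓘(ℝ, E)) ∞
      (fun w : TTStar E Q => R (velocity w)) w₀ :=
    ContMDiffAt.comp w₀ (hR.2.1.contMDiffAt (hR.1.mem_nhds hw₀)) (contMDiff_velocity w₀)
  have hev : ∀ᶠ w in 𝓝 w₀, w ∈ cotangentLiftDomain D ∧
      w ∈ (extChartAt (cotangentModel 𝓘(ℝ, E)).tangent w₀).source ∧
      R (velocity w) ∈ (extChartAt (𝓘(ℝ, E).prod 𝓘(ℝ, E)) (R (velocity w₀))).source := by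
    filter_upwards [(isOpen_cotangentLiftDomain hR.1).mem_nhds hw₀,
      extChartAt_source_mem_nhds (I := (cotangentModel 𝓘(ℝ, E)).tangent) w₀,
      hRv.continuousAt.eventually_mem
        (extChartAt_source_mem_nhds (I := 𝓘(ℝ, E).prod 𝓘(ℝ, E)) (R (velocity w₀)))] with w h1 h2 h3
    exact ⟨h1, h2, h3⟩
  obtain ⟨hr, A, hA, -⟩ := hR.contDiffAt_chartExpr (ξ₀ := velocity w₀) (ξ := velocity w₀) hw₀
    (mem_extChartAt_source _) (mem_extChartAt_source _)
  rw [extChartAt_velocity w₀ w₀ (mem_extChartAt_source _)] at hr hA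
  have hl : ContMDiffAt (cotangentModel 𝓘(ℝ, E)).tangent 𝓘(ℝ, E × E →L[ℝ] ℝ) ∞
      (fun w : TTStar E Q => liftCoord (chartExpr R (velocity w₀))
        (extChartAt (cotangentModel 𝓘(ℝ, E)).tangent w₀ w)) w₀ :=
    ContMDiffAt.comp w₀ (contDiffAt_liftCoord hr A hA).contMDiffAt contMDiffAt_extChartAt
  refine ContMDiffAt.contMDiffWithinAt (ContMDiffAt.prodMk ?_ ?_)
  · rw [contMDiffAt_totalSpace]
    refine ⟨contMDiffAt_fst.comp w₀ hRv, ?_⟩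
    have h1 : ContMDiffAt (cotangentModel 𝓘(ℝ, E)).tangent 𝓘(ℝ, E →L[ℝ] ℝ) ∞
        (fun w : TTStar E Q => -((liftCoord (chartExpr R (velocity w₀))
        (extChartAt (cotangentModel 𝓘(ℝ, E)).tangent w₀ w)).comp
          (ContinuousLinearMap.inl ℝ E E))) w₀ := by
      have h2 : ContDiff ℝ ∞ fun l : E × E →L[ℝ] ℝ => -(l.comp (ContinuousLinearMap.inl ℝ E E)) :=
        (contDiff_id.clm_comp contDiff_const).neg
      exact h2.contMDiff.contMDiffAt.comp w₀ hl
    refine h1.congr_of_eventuallyEq ?_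
    filter_upwards [hev] with w hw
    rw [← (extChartAt_cotangentLift hR hw.1 hw.2.1 hw.2.2).1, FiberBundle.extChartAt]
    rfl
  · rw [contMDiffAt_totalSpace]
    refine ⟨contMDiffAt_snd.comp w₀ hRv, ?_⟩
    have h1 : ContMDiffAt (cotangentModel 𝓘(ℝ, E)).tangent 𝓘(ℝ, E →L[ℝ] ℝ) ∞
        (fun w : TTStar E Q => (liftCoord (chartExpr R (velocity w₀))
        (extChartAt (cotangentModel 𝓘(ℝ, E)).tangent w₀ w)).comp
          (ContinuousLinearMap.inr ℝ E E)) w₀ := by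
      have h2 : ContDiff ℝ ∞ fun l : E × E →L[ℝ] ℝ => l.comp (ContinuousLinearMap.inr ℝ E E) :=
        contDiff_id.clm_comp contDiff_const
      exact h2.contMDiff.contMDiffAt.comp w₀ hl
    refine h1.congr_of_eventuallyEq ?_
    filter_upwards [hev] with w hw
    rw [← (extChartAt_cotangentLift hR hw.1 hw.2.1 hw.2.2).2, FiberBundle.extChartAt]
    rfl

end CotangentLiftSmooth

/-! ### The pullback of `Ω₁₂` under the cotangent lift. -/

section LiftedForm

variable {E : Type*} [NormedAddCommGroup E] [NormedSpace ℝ E]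
  {Q : Type*} [TopologicalSpace Q] [ChartedSpace E Q] [IsManifold 𝓘(ℝ, E) ∞ Q]
  {D : Set (TangentBundle 𝓘(ℝ, E) Q)} {R : TangentBundle 𝓘(ℝ, E) Q → Q × Q}

variable (E) in
/-- The tangent lift `dq̇ ∧ dp + dq ∧ dṗ` of the standard form. -/
def liftedForm : ((E × (E →L[ℝ] ℝ)) × (E × (E →L[ℝ] ℝ))) →L[ℝ]
    ((E × (E →L[ℝ] ℝ)) × (E × (E →L[ℝ] ℝ))) →L[ℝ] ℝ :=
  (standardForm E).bilinearComp (ContinuousLinearMap.fst ℝ _ _) (ContinuousLinearMap.snd ℝ _ _) +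
    (standardForm E).bilinearComp (ContinuousLinearMap.snd ℝ _ _) (ContinuousLinearMap.fst ℝ _ _)

theorem liftedForm_apply (a b : (E × (E →L[ℝ] ℝ)) × (E × (E →L[ℝ] ℝ))) :
    liftedForm E a b = standardForm E a.1 b.2 + standardForm E a.2 b.1 := rfl

theorem standardForm_swap (a b : E × (E →L[ℝ] ℝ)) : standardForm E a b = -standardForm E b a := by
  simp [standardForm_apply]

theorem eq_zero_of_standardForm {a : E × (E →L[ℝ] ℝ)} (h : ∀ b, standardForm E a b = 0) : a = 0 := by
  refine Prod.ext ?_ ?_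
  · refine SeparatingDual.eq_zero_of_forall_dual_eq_zero (R := ℝ) fun l => ?_
    simpa [standardForm_apply] using h (0, l)
  · refine ContinuousLinearMap.ext fun v => ?_
    simpa [standardForm_apply] using h (v, 0)

/-- Vectors `(0, b)` test the first component and vectors `(b, 0)` the second. This nondegeneracy
makes the cotangent lift a local diffeomorphism. -/
theorem eq_zero_of_liftedForm {a : (E × (E →L[ℝ] ℝ)) × (E × (E →L[ℝ] ℝ))}
    (h : ∀ b, liftedForm E a b = 0) : a = 0 := by
  refine Prod.ext (eq_zero_of_standardForm fun b => ?_) (eq_zero_of_standardForm fun b => ?_)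
  · simpa [liftedForm_apply] using h (0, b)
  · simpa [liftedForm_apply] using h (b, 0)

theorem coordDeriv_chart_symm_self {F : Type*} [NormedAddCommGroup F] [NormedSpace ℝ F]
    {H : Type*} [TopologicalSpace H] {I : ModelWithCorners ℝ F H} [I.Boundaryless]
    {M : Type*} [TopologicalSpace M] [ChartedSpace H M] [IsManifold I ∞ M] (x : M) (v : F) :
    coordDeriv 𝓘(ℝ, F) I (extChartAt I x).symm (extChartAt I x x) v = v := by
  have h := coordDeriv_chart_comp_symm (I := I) (mem_extChartAt_source x) v
  rwa [coordDeriv_chart_eq_id] at h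

theorem fderiv_comp_add_comp {V : Type*} [NormedAddCommGroup V] [NormedSpace ℝ V] (a b : V →L[ℝ] E)
    (l m : V →L[ℝ] E →L[ℝ] ℝ) (y v : V) :
    fderiv ℝ (fun y => (l y).comp a + (m y).comp b) y v = (l v).comp a + (m v).comp b := by
  have h1 : ∀ (a : V →L[ℝ] E) (l : V →L[ℝ] E →L[ℝ] ℝ), HasFDerivAt (fun y => (l y).comp a)
      (((ContinuousLinearMap.compL ℝ V E ℝ).flip a).comp l) y := fun a l =>
    (((ContinuousLinearMap.compL ℝ V E ℝ).flip a).comp l).hasFDerivAt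
  exact DFunLike.congr_fun ((h1 a l).add (h1 b m)).fderiv v

variable [FiniteDimensional ℝ E]

/-- With the first momentum equal to minus the first half of a covector `β` on `Q × Q`, the
difference `p₁ dq₁ - p₀ dq₀` is `β` itself evaluated on `(dq₀, dq₁) = dR(dq, dq̇)`. By
`covec_hatLift_comp` this is `ṗ dq + p dq̇`. -/
theorem liouville_cotangentLift (hR : IsDiffeoOntoImage D R) (w₀ : TTStar E Q)
    {y : (E × (E →L[ℝ] ℝ)) × (E × (E →L[ℝ] ℝ))}
    (hy : y ∈ (extChartAt (cotangentModel 𝓘(ℝ, E)).tangent w₀).target)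
    (hyD : (extChartAt (cotangentModel 𝓘(ℝ, E)).tangent w₀).symm y ∈ cotangentLiftDomain D) :
    liouville 𝓘(ℝ, E) (fun y => (cotangentLift R
        ((extChartAt (cotangentModel 𝓘(ℝ, E)).tangent w₀).symm y)).2) y -
      liouville 𝓘(ℝ, E) (fun y => (cotangentLift R
        ((extChartAt (cotangentModel 𝓘(ℝ, E)).tangent w₀).symm y)).1) y =
    (tulczyjewForm y.1 y.2).comp ((ContinuousLinearMap.fst ℝ E (E →L[ℝ] ℝ)).prodMap
      (ContinuousLinearMap.fst ℝ E (E →L[ℝ] ℝ))) := by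
  set Φ := extChartAt (cotangentModel 𝓘(ℝ, E)).tangent w₀ with hΦ
  have hs : Φ.symm y ∈ Φ.source := Φ.map_target hy
  have hsymm : MDifferentiableAt 𝓘(ℝ, (E × (E →L[ℝ] ℝ)) × (E × (E →L[ℝ] ℝ)))
      (cotangentModel 𝓘(ℝ, E)).tangent Φ.symm y :=
    ((contMDiffOn_extChartAt_symm (n := ∞) w₀).contMDiffAt
      ((isOpen_extChartAt_target w₀).mem_nhds hy)).mdifferentiableAt (by simp)
  have hv : MDifferentiableAt (cotangentModel 𝓘(ℝ, E)).tangent 𝓘(ℝ, E).tangent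
      (velocity : TTStar E Q → TangentBundle 𝓘(ℝ, E) Q) (Φ.symm y) :=
    (contMDiff_velocity _).mdifferentiableAt (by simp)
  have hvs := hv.comp y hsymm
  have hRd : MDifferentiableAt 𝓘(ℝ, E).tangent (𝓘(ℝ, E).prod 𝓘(ℝ, E)) R (velocity (Φ.symm y)) :=
    (hR.2.1.contMDiffAt (hR.1.mem_nhds hyD)).mdifferentiableAt (by simp)
  have hRvs := hRd.comp y hvs
  have h1 : coordDeriv 𝓘(ℝ, (E × (E →L[ℝ] ℝ)) × (E × (E →L[ℝ] ℝ))) (𝓘(ℝ, E).prod 𝓘(ℝ, E))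
      (R ∘ velocity ∘ Φ.symm) y =
        (coordDeriv 𝓘(ℝ, E).tangent (𝓘(ℝ, E).prod 𝓘(ℝ, E)) R (velocity (Φ.symm y))).comp
        (coordDeriv 𝓘(ℝ, (E × (E →L[ℝ] ℝ)) × (E × (E →L[ℝ] ℝ))) 𝓘(ℝ, E).tangent
          (velocity ∘ Φ.symm) y) := coordDeriv_comp hRd hvs
  have hfst : coordDeriv 𝓘(ℝ, (E × (E →L[ℝ] ℝ)) × (E × (E →L[ℝ] ℝ))) 𝓘(ℝ, E)
      (Prod.fst ∘ R ∘ velocity ∘ Φ.symm) y = (ContinuousLinearMap.fst ℝ E E).comp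
        (coordDeriv 𝓘(ℝ, (E × (E →L[ℝ] ℝ)) × (E × (E →L[ℝ] ℝ))) (𝓘(ℝ, E).prod 𝓘(ℝ, E)) (R ∘ velocity ∘ Φ.symm) y) := by
    rw [coordDeriv_comp mdifferentiableAt_fst hRvs]
    exact congrArg (fun l => ContinuousLinearMap.comp l _)
      (mfderiv_fst (I := 𝓘(ℝ, E)) (I' := 𝓘(ℝ, E)))
  have hsnd : coordDeriv 𝓘(ℝ, (E × (E →L[ℝ] ℝ)) × (E × (E →L[ℝ] ℝ))) 𝓘(ℝ, E)
      (Prod.snd ∘ R ∘ velocity ∘ Φ.symm) y = (ContinuousLinearMap.snd ℝ E E).comp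
        (coordDeriv 𝓘(ℝ, (E × (E →L[ℝ] ℝ)) × (E × (E →L[ℝ] ℝ))) (𝓘(ℝ, E).prod 𝓘(ℝ, E)) (R ∘ velocity ∘ Φ.symm) y) := by
    rw [coordDeriv_comp mdifferentiableAt_snd hRvs]
    exact congrArg (fun l => ContinuousLinearMap.comp l _)
      (mfderiv_snd (I := 𝓘(ℝ, E)) (I' := 𝓘(ℝ, E)))
  have h2 : extChartAt 𝓘(ℝ, E).tangent (velocity w₀) ∘ velocity ∘ Φ.symm =ᶠ[𝓝 y]
      (ContinuousLinearMap.fst ℝ E (E →L[ℝ] ℝ)).prodMap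
      (ContinuousLinearMap.fst ℝ E (E →L[ℝ] ℝ)) := by
    filter_upwards [(isOpen_extChartAt_target w₀).mem_nhds hy] with y' hy'
    have h3 := extChartAt_velocity w₀ (Φ.symm y') (Φ.map_target hy')
    rw [Φ.right_inv hy'] at h3
    exact h3
  have h3 := coordDeriv_comp (x := y)
    (mdifferentiableAt_chart (velocity_mem_extChartAt_source w₀ _ hs)) hvs
  rw [coordDeriv_congr h2, coordDeriv_eq_fderiv, ContinuousLinearMap.fderiv] at h3
  have h4 := covec_tulczyjew_eq w₀ (Φ.symm y) hs
  rw [Φ.right_inv hy] at h4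
  have h5 := covec_hatLift_comp hR hyD
  rw [h3, ← ContinuousLinearMap.comp_assoc]
  change _ = ContinuousLinearMap.comp (ContinuousLinearMap.comp _
    (coordDeriv 𝓘(ℝ, E).tangent 𝓘(ℝ, E × E) (extChartAt 𝓘(ℝ, E).tangent (velocity w₀))
      (velocity (Φ.symm y)))) _
  rw [← h4, ← h5, ContinuousLinearMap.comp_assoc, ← h1]
  refine ContinuousLinearMap.ext fun a => ?_
  change covec (cotangentLift R (Φ.symm y)).2 (coordDeriv 𝓘(ℝ, (E × (E →L[ℝ] ℝ)) × (E × (E →L[ℝ] ℝ))) 𝓘(ℝ, E)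
      (Prod.snd ∘ R ∘ velocity ∘ Φ.symm) y a)
    - covec (cotangentLift R (Φ.symm y)).1 (coordDeriv 𝓘(ℝ, (E × (E →L[ℝ] ℝ)) × (E × (E →L[ℝ] ℝ))) 𝓘(ℝ, E)
      (Prod.fst ∘ R ∘ velocity ∘ Φ.symm) y a) = _
  rw [hfst, hsnd, covec_cotangentLift_fst, covec_cotangentLift_snd]
  simp only [ContinuousLinearMap.comp_apply, neg_apply, sub_neg_eq_add, ← map_add]
  congr 1
  simp

set_option synthInstance.maxHeartbeats 200000 in
/-- The cotangent lift pulls `Ω₁₂` back to the tangent lift of the canonical form. -/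
theorem pairForm_cotangentLift (hR : IsDiffeoOntoImage D R) {w : TTStar E Q}
    (hw : w ∈ cotangentLiftDomain D) (a b : (E × (E →L[ℝ] ℝ)) × (E × (E →L[ℝ] ℝ))) :
    pairForm (coordDeriv (cotangentModel 𝓘(ℝ, E)).tangent (pairModel E) (cotangentLift R) w a)
      (coordDeriv (cotangentModel 𝓘(ℝ, E)).tangent (pairModel E) (cotangentLift R) w b) =
      liftedForm E a b := by
  set Φ := extChartAt (cotangentModel 𝓘(ℝ, E)).tangent w with hΦ
  have hO : IsOpen (Φ.target ∩ Φ.symm ⁻¹' cotangentLiftDomain D) :=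
    (continuousOn_extChartAt_symm w).isOpen_inter_preimage (isOpen_extChartAt_target w)
      (isOpen_cotangentLiftDomain hR.1)
  have hc : ContMDiffOn 𝓘(ℝ, (E × (E →L[ℝ] ℝ)) × (E × (E →L[ℝ] ℝ))) (pairModel E) ∞
      (cotangentLift R ∘ Φ.symm) (Φ.target ∩ Φ.symm ⁻¹' cotangentLiftDomain D) :=
    (contMDiffOn_cotangentLift hR).comp ((contMDiffOn_extChartAt_symm w).mono inter_subset_left)
      fun y hy => hy.2
  have hws : w ∈ Φ.source := mem_extChartAt_source w
  have hy : Φ w ∈ Φ.target ∩ Φ.symm ⁻¹' cotangentLiftDomain D :=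
    ⟨Φ.map_source hws, by rwa [mem_preimage, Φ.left_inv hws]⟩
  have h1 := pairForm_pullback hO hc hy a b
  have hsymm : MDifferentiableAt 𝓘(ℝ, (E × (E →L[ℝ] ℝ)) × (E × (E →L[ℝ] ℝ)))
      (cotangentModel 𝓘(ℝ, E)).tangent Φ.symm (Φ w) :=
    ((contMDiffOn_extChartAt_symm (n := ∞) w).contMDiffAt
      ((isOpen_extChartAt_target w).mem_nhds hy.1)).mdifferentiableAt (by simp)
  have hΨ : MDifferentiableAt (cotangentModel 𝓘(ℝ, E)).tangent (pairModel E) (cotangentLift R)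
      (Φ.symm (Φ w)) :=
    ((contMDiffOn_cotangentLift hR).contMDiffAt
      ((isOpen_cotangentLiftDomain hR.1).mem_nhds hy.2)).mdifferentiableAt (by simp)
  have h2 : ∀ v, coordDeriv 𝓘(ℝ, (E × (E →L[ℝ] ℝ)) × (E × (E →L[ℝ] ℝ))) (pairModel E)
      (cotangentLift R ∘ Φ.symm) (Φ w) v =
      coordDeriv (cotangentModel 𝓘(ℝ, E)).tangent (pairModel E) (cotangentLift R) w v := by
    intro v
    rw [coordDeriv_comp hΨ hsymm, ContinuousLinearMap.comp_apply, coordDeriv_chart_symm_self,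
      Φ.left_inv hws]
  rw [h2, h2] at h1
  have h3 : (fun y => liouville 𝓘(ℝ, E) (fun y => ((cotangentLift R ∘ Φ.symm) y).2) y
      - liouville 𝓘(ℝ, E) (fun y => ((cotangentLift R ∘ Φ.symm) y).1) y) =ᶠ[𝓝 (Φ w)]
      fun y => (tulczyjewForm y.1 y.2).comp ((ContinuousLinearMap.fst ℝ E (E →L[ℝ] ℝ)).prodMap
      (ContinuousLinearMap.fst ℝ E (E →L[ℝ] ℝ))) := by
    filter_upwards [hO.mem_nhds hy] with y hy
    exact liouville_cotangentLift hR w hy.1 hy.2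
  rw [h3.fderiv_eq] at h1
  have h4 : ∀ v, fderiv ℝ (fun y : (E × (E →L[ℝ] ℝ)) × (E × (E →L[ℝ] ℝ)) =>
      (tulczyjewForm y.1 y.2).comp ((ContinuousLinearMap.fst ℝ E (E →L[ℝ] ℝ)).prodMap
      (ContinuousLinearMap.fst ℝ E (E →L[ℝ] ℝ)))) (Φ w) v =
      (tulczyjewForm v.1 v.2).comp ((ContinuousLinearMap.fst ℝ E (E →L[ℝ] ℝ)).prodMap
      (ContinuousLinearMap.fst ℝ E (E →L[ℝ] ℝ))) := by
    intro v
    exact fderiv_comp_add_comp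
      ((ContinuousLinearMap.fst ℝ E (E →L[ℝ] ℝ)).comp (ContinuousLinearMap.fst ℝ _ _))
      ((ContinuousLinearMap.fst ℝ E (E →L[ℝ] ℝ)).comp (ContinuousLinearMap.snd ℝ _ _))
      ((ContinuousLinearMap.snd ℝ E (E →L[ℝ] ℝ)).comp (ContinuousLinearMap.snd ℝ _ _))
      ((ContinuousLinearMap.snd ℝ E (E →L[ℝ] ℝ)).comp (ContinuousLinearMap.fst ℝ _ _)) (Φ w) v
  rw [h4, h4] at h1
  rw [h1, liftedForm_apply, standardForm_apply, standardForm_apply]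
  simp only [ContinuousLinearMap.comp_apply, tulczyjewForm_apply]
  simp
  ring

set_option synthInstance.maxHeartbeats 200000 in
-- A vector killed by the differential is orthogonal to everything for the pulled-back form, which
-- is the nondegenerate lifted form. Injectivity suffices, since source and target have the same
-- finite-dimensional model.
theorem exists_equiv_cotangentLift (hR : IsDiffeoOntoImage D R) {w : TTStar E Q}
    (hw : w ∈ cotangentLiftDomain D) :
    ∃ A : ((E × (E →L[ℝ] ℝ)) × (E × (E →L[ℝ] ℝ))) ≃L[ℝ] ((E × (E →L[ℝ] ℝ)) × (E × (E →L[ℝ] ℝ))),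
      coordDeriv (cotangentModel 𝓘(ℝ, E)).tangent (pairModel E) (cotangentLift R) w = A := by
  have hinj : Function.Injective (coordDeriv (cotangentModel 𝓘(ℝ, E)).tangent (pairModel E)
      (cotangentLift R) w).toLinearMap := by
    rw [← LinearMap.ker_eq_bot, LinearMap.ker_eq_bot']
    intro a ha
    refine eq_zero_of_liftedForm fun b => ?_
    rw [← pairForm_cotangentLift hR hw]
    change coordDeriv (cotangentModel 𝓘(ℝ, E)).tangent (pairModel E) (cotangentLift R) w a = 0 at ha
    rw [ha]
    simp [pairForm]
  exact ⟨(LinearEquiv.ofInjectiveEndo _ hinj).toContinuousLinearEquiv,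
    ContinuousLinearMap.ext fun _ => rfl⟩

end LiftedForm

/-! ### Scaling by the step `h` in the fibres of a tangent bundle. -/

section FibreScale

variable {F : Type*} [NormedAddCommGroup F] [NormedSpace ℝ F]
  {H : Type*} [TopologicalSpace H] {I : ModelWithCorners ℝ F H}
  {M : Type*} [TopologicalSpace M] [ChartedSpace H M]

/-- Multiplication by `h` in the fibres of the tangent bundle. -/
def fibreScale (h : ℝ) (w : TangentBundle I M) : TangentBundle I M := ⟨w.proj, h • w.snd⟩

theorem fibreScale_inv {h : ℝ} (hh : h ≠ 0) (w : TangentBundle I M) :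
    fibreScale h (fibreScale h⁻¹ w) = w := by
  obtain ⟨x, v⟩ := w
  exact congrArg (TotalSpace.mk x) (smul_inv_smul₀ hh v)

theorem injective_fibreScale {h : ℝ} (hh : h ≠ 0) :
    Function.Injective (fibreScale h : TangentBundle I M → TangentBundle I M) := by
  refine Function.LeftInverse.injective (g := fibreScale h⁻¹) fun w => ?_
  have := fibreScale_inv (inv_ne_zero hh) w
  rwa [inv_inv] at this

variable [IsManifold I ∞ M]

theorem extChartAt_fibreScale (h : ℝ) (w₀ w : TangentBundle I M)
    (hw : w ∈ (extChartAt I.tangent w₀).source) :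
    extChartAt I.tangent (fibreScale h w₀) (fibreScale h w) =
      ((extChartAt I.tangent w₀ w).1, h • (extChartAt I.tangent w₀ w).2) := by
  have hw' := (mem_extChartAt_tangent_source _ _).1 hw
  rw [extChartAt_tangent_apply w₀ w hw']
  refine (extChartAt_tangent_apply (fibreScale h w₀) (fibreScale h w) hw').trans ?_
  exact Prod.ext rfl (map_smul (coordDeriv I 𝓘(ℝ, F) (extChartAt I w₀.proj) w.proj) h (tangentVec w))

theorem contMDiff_fibreScale (h : ℝ) :
    ContMDiff I.tangent I.tangent ∞ (fibreScale h : TangentBundle I M → TangentBundle I M) := by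
  intro w₀
  rw [contMDiffAt_totalSpace]
  refine ⟨Bundle.contMDiff_proj _ w₀, ?_⟩
  have h1 : ContMDiffAt I.tangent 𝓘(ℝ, F) ∞
      (fun w : TangentBundle I M => h • (extChartAt I.tangent w₀ w).2) w₀ := by
    have h2 : ContDiff ℝ ∞ (fun y : F × F => h • y.2) := by fun_prop
    exact h2.contMDiff.contMDiffAt.comp w₀ contMDiffAt_extChartAt
  refine h1.congr_of_eventuallyEq ?_
  filter_upwards [extChartAt_source_mem_nhds (I := I.tangent) w₀] with w hw
  exact congrArg Prod.snd (extChartAt_fibreScale h w₀ w hw)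

theorem coordDeriv_fibreScale [I.Boundaryless] (h : ℝ) (w : TangentBundle I M) (v : F × F) :
    coordDeriv I.tangent I.tangent (fibreScale h) w v = (v.1, h • v.2) := by
  have h1 : coordDeriv I.tangent I.tangent (fibreScale h) w =
      fderiv ℝ (extChartAt I.tangent (fibreScale h w) ∘ fibreScale h ∘
        (extChartAt I.tangent w).symm) (extChartAt I.tangent w w) :=
    ((contMDiff_fibreScale h w).mdifferentiableAt (by simp)).mfderiv_eq_fderiv
  have h2 : extChartAt I.tangent (fibreScale h w) ∘ fibreScale h ∘ (extChartAt I.tangent w).symm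
      =ᶠ[𝓝 (extChartAt I.tangent w w)] (ContinuousLinearMap.id ℝ F).prodMap
        (h • ContinuousLinearMap.id ℝ F) := by
    filter_upwards [extChartAt_target_mem_nhds (I := I.tangent) w] with y hy
    have h3 := extChartAt_fibreScale h w _ ((extChartAt I.tangent w).map_target hy)
    rw [(extChartAt I.tangent w).right_inv hy] at h3
    exact h3
  rw [h1, h2.fderiv_eq, ContinuousLinearMap.fderiv]
  rfl

variable [I.Boundaryless] [FiniteDimensional ℝ F]

theorem IsSubmanifold.image_fibreScale {h : ℝ} (hh : h ≠ 0) {d : ℕ} {S : Set (TangentBundle I M)}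
    (hS : IsSubmanifold I.tangent d S) :
    IsSubmanifold I.tangent d (fibreScale h '' S) ∧ ∀ w,
      tangentSpaceOf I.tangent (fibreScale h '' S) (fibreScale h w) =
        (tangentSpaceOf I.tangent S w).map
          (mfderiv I.tangent I.tangent (fibreScale h) w).toLinearMap := by
  let A : (F × F) ≃L[ℝ] (F × F) := (ContinuousLinearEquiv.refl ℝ F).prodCongr
    (ContinuousLinearEquiv.smulLeft (Units.mk0 h hh))
  have h1 := hS.image isOpen_univ (contMDiff_fibreScale h).contMDiffOn
    (injective_fibreScale hh).injOn (fun _ => A)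
    (fun w _ => ContinuousLinearMap.ext (coordDeriv_fibreScale h w))
  rw [inter_univ] at h1
  exact ⟨h1.1, fun w => h1.2 w (mem_univ w)⟩

end FibreScale

/-! ### Pontryagin's Hamiltonian and the dynamics in bundle charts. -/

namespace OptimalControlProblem

variable {E : Type*} [NormedAddCommGroup E] [NormedSpace ℝ E]
  {Q : Type*} [TopologicalSpace Q] [ChartedSpace E Q] [IsManifold 𝓘(ℝ, E) ∞ Q]
  {W : Type*} [NormedAddCommGroup W] [NormedSpace ℝ W] (O : OptimalControlProblem E Q W)

/-- The Hamiltonian in the bundle chart at `z₀`. -/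
def chartHamiltonian (z₀ : CotangentBundle 𝓘(ℝ, E) Q) (y : (E × (E →L[ℝ] ℝ)) × W) : ℝ :=
  O.hamiltonian ((extChartAt (cotangentModel 𝓘(ℝ, E)) z₀).symm y.1) y.2

/-- The domain of the Hamiltonian in the bundle chart at `z₀`. -/
def chartDomain (z₀ : CotangentBundle 𝓘(ℝ, E) Q) : Set ((E × (E →L[ℝ] ℝ)) × W) :=
  (extChartAt (cotangentModel 𝓘(ℝ, E)) z₀).target ×ˢ interior O.U

theorem isOpen_chartDomain (z₀ : CotangentBundle 𝓘(ℝ, E) Q) : IsOpen (O.chartDomain z₀) :=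
  (isOpen_extChartAt_target z₀).prod isOpen_interior

/-- The pairing `⟨p, X⟩` is rewritten in the coordinates of one chart, where both factors depend
smoothly on `(q, p, u)`. -/
theorem chartHamiltonian_eq (z₀ : CotangentBundle 𝓘(ℝ, E) Q) {y : (E × (E →L[ℝ] ℝ)) × W}
    (hy : y ∈ O.chartDomain z₀) :
    O.chartHamiltonian z₀ y = y.1.2 ((extChartAt 𝓘(ℝ, E).tangent
        (⟨z₀.proj, 0⟩ : TangentBundle 𝓘(ℝ, E) Q)
        ⟨((extChartAt (cotangentModel 𝓘(ℝ, E)) z₀).symm y.1).proj, O.X _ y.2⟩).2) -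
      O.F ((extChartAt (cotangentModel 𝓘(ℝ, E)) z₀).symm y.1).proj y.2 := by
  set z := (extChartAt (cotangentModel 𝓘(ℝ, E)) z₀).symm y.1 with hz
  have hs : z.proj ∈ (extChartAt 𝓘(ℝ, E) z₀.proj).source :=
    (mem_extChartAt_cotangent_source _ _).1 ((extChartAt _ _).map_target hy.1)
  have h1 := extChartAt_cotangent_snd_comp z₀ z hs
  rw [hz, (extChartAt _ _).right_inv hy.1, ← hz] at h1
  have h2 := extChartAt_tangent_apply (⟨z₀.proj, 0⟩ : TangentBundle 𝓘(ℝ, E) Q)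
    ⟨z.proj, O.X z.proj y.2⟩ hs
  have h3 : O.chartHamiltonian z₀ y = covec z (O.X z.proj y.2) - O.F z.proj y.2 := rfl
  rw [h3, h2, ← h1]
  rfl

theorem contDiffOn_chartHamiltonian (z₀ : CotangentBundle 𝓘(ℝ, E) Q) :
    ContDiffOn ℝ ∞ (O.chartHamiltonian z₀) (O.chartDomain z₀) := by
  rw [← contMDiffOn_iff_contDiffOn]
  have h1 : ContMDiffOn 𝓘(ℝ, (E × (E →L[ℝ] ℝ)) × W) 𝓘(ℝ, E) ∞
      (fun y : (E × (E →L[ℝ] ℝ)) × W =>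
        ((extChartAt (cotangentModel 𝓘(ℝ, E)) z₀).symm y.1).proj) (O.chartDomain z₀) :=
    (Bundle.contMDiff_proj _).comp_contMDiffOn ((contMDiffOn_extChartAt_symm z₀).comp
      contDiff_fst.contMDiff.contMDiffOn fun y hy => hy.1)
  have h2 : ContMDiffOn 𝓘(ℝ, (E × (E →L[ℝ] ℝ)) × W) (𝓘(ℝ, E).prod 𝓘(ℝ, W)) ∞
      (fun y : (E × (E →L[ℝ] ℝ)) × W =>
        (((extChartAt (cotangentModel 𝓘(ℝ, E)) z₀).symm y.1).proj, y.2)) (O.chartDomain z₀) :=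
    h1.prodMk contDiff_snd.contMDiff.contMDiffOn
  have h3 := O.smooth_X.comp h2 fun y hy => ⟨mem_univ _, hy.2⟩
  have h4 := O.smooth_F.comp h2 fun y hy => ⟨mem_univ _, hy.2⟩
  have h5 := (contMDiffOn_extChartAt (I := 𝓘(ℝ, E).tangent) (n := ∞)
    (x := (⟨z₀.proj, 0⟩ : TangentBundle 𝓘(ℝ, E) Q))).comp h3 fun y hy => by
      rw [← extChartAt_source 𝓘(ℝ, E).tangent, mem_preimage, mem_extChartAt_tangent_source]
      exact (mem_extChartAt_cotangent_source _ _).1 ((extChartAt _ _).map_target hy.1)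
  rw [contMDiffOn_iff_contDiffOn] at h4 h5 ⊢
  refine ContDiffOn.congr ?_ fun y hy => O.chartHamiltonian_eq z₀ hy
  exact ((contDiff_snd.comp contDiff_fst).contDiffOn.clm_apply
    (contDiff_snd.comp_contDiffOn h5)).sub h4

theorem differentiableAt_chartHamiltonian (z₀ : CotangentBundle 𝓘(ℝ, E) Q)
    {y : (E × (E →L[ℝ] ℝ)) × W} (hy : y ∈ O.chartDomain z₀) :
    DifferentiableAt ℝ (O.chartHamiltonian z₀) y :=
  ((O.contDiffOn_chartHamiltonian z₀).contDiffAt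
    ((O.isOpen_chartDomain z₀).mem_nhds hy)).differentiableAt (by simp)

theorem controlDeriv_chart (z₀ : CotangentBundle 𝓘(ℝ, E) Q) {y : (E × (E →L[ℝ] ℝ)) × W}
    (hy : y ∈ O.chartDomain z₀) :
    O.controlDeriv ((extChartAt (cotangentModel 𝓘(ℝ, E)) z₀).symm y.1) y.2 =
      (fderiv ℝ (O.chartHamiltonian z₀) y).comp
        (ContinuousLinearMap.inr ℝ (E × (E →L[ℝ] ℝ)) W) := by
  have h1 : HasFDerivAt (O.chartHamiltonian z₀ ∘ fun u => (y.1, u)) _ y.2 :=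
    HasFDerivAt.comp y.2 (O.differentiableAt_chartHamiltonian z₀ hy).hasFDerivAt
      (hasFDerivAt_prodMk_right y.1 y.2)
  exact h1.fderiv

/-- The differential of `∂H/∂u` on the manifold is the one in the chart composed with the
differential of the chart; surjectivity of a composite passes to its outer factor. -/
theorem surjective_fderiv_of_isMorseFamily (hMorse : O.IsMorseFamily)
    (z₀ : CotangentBundle 𝓘(ℝ, E) Q) {p : (E × (E →L[ℝ] ℝ)) × W} (hp : p ∈ O.chartDomain z₀)
    (h0 : (fderiv ℝ (O.chartHamiltonian z₀) p).comp
      (ContinuousLinearMap.inr ℝ (E × (E →L[ℝ] ℝ)) W) = 0) :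
    Function.Surjective (fderiv ℝ (fun q => (fderiv ℝ (O.chartHamiltonian z₀) q).comp
      (ContinuousLinearMap.inr ℝ (E × (E →L[ℝ] ℝ)) W)) p) := by
  set z := (extChartAt (cotangentModel 𝓘(ℝ, E)) z₀).symm p.1 with hz
  have hzs : z ∈ (extChartAt (cotangentModel 𝓘(ℝ, E)) z₀).source := (extChartAt _ _).map_target hp.1
  have hXz : extChartAt (cotangentModel 𝓘(ℝ, E)) z₀ z = p.1 := (extChartAt _ _).right_inv hp.1
  let g : CotangentBundle 𝓘(ℝ, E) Q × W → (W →L[ℝ] ℝ) := fun y => O.controlDeriv y.1 y.2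
  have h1 : Function.Surjective (coordDeriv ((cotangentModel 𝓘(ℝ, E)).prod 𝓘(ℝ, W))
      𝓘(ℝ, W →L[ℝ] ℝ) g (z, p.2)) :=
    hMorse z p.2 hp.2 (by rw [hz, O.controlDeriv_chart z₀ hp, h0])
  have hs : (z, p.2) ∈
      (extChartAt ((cotangentModel 𝓘(ℝ, E)).prod 𝓘(ℝ, W)) ((z₀, p.2) : _ × W)).source := by
    rw [extChartAt_prod]
    exact ⟨hzs, mem_extChartAt_source _⟩
  have h2 : extChartAt ((cotangentModel 𝓘(ℝ, E)).prod 𝓘(ℝ, W)) ((z₀, p.2) : _ × W) (z, p.2) = p := by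
    rw [extChartAt_prod]
    exact Prod.ext hXz rfl
  have h3 : g ∘ (extChartAt ((cotangentModel 𝓘(ℝ, E)).prod 𝓘(ℝ, W)) ((z₀, p.2) : _ × W)).symm
      =ᶠ[𝓝 p] fun q => (fderiv ℝ (O.chartHamiltonian z₀) q).comp
      (ContinuousLinearMap.inr ℝ (E × (E →L[ℝ] ℝ)) W) := by
    filter_upwards [(O.isOpen_chartDomain z₀).mem_nhds hp] with q hq
    rw [← O.controlDeriv_chart z₀ hq, extChartAt_prod]
    rfl
  have h4 : DifferentiableAt ℝ (fun q => (fderiv ℝ (O.chartHamiltonian z₀) q).comp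
      (ContinuousLinearMap.inr ℝ (E × (E →L[ℝ] ℝ)) W)) p := by
    have h5 := ((O.contDiffOn_chartHamiltonian z₀).fderiv_of_isOpen (m := ∞)
      (O.isOpen_chartDomain z₀) (by simp)).clm_comp
      (contDiffOn_const (c := ContinuousLinearMap.inr ℝ (E × (E →L[ℝ] ℝ)) W))
    exact (h5.contDiffAt ((O.isOpen_chartDomain z₀).mem_nhds hp)).differentiableAt (by simp)
  have h5 := coordDeriv_eq_fderiv_comp_chart (g := g) hs (by
    rw [h2]
    exact h4.congr_of_eventuallyEq h3)
  rw [h2, h3.fderiv_eq] at h5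
  rw [h5] at h1
  exact Function.Surjective.of_comp h1

/-- The canonical form is standard in every bundle chart, so `i_v ω = dH` keeps its shape in the
fixed chart at `z₀`. Criticality in `u` lets the full differential factor through the first
projection, as `isotropic_of_morse` requires. -/
theorem fderiv_chartHamiltonian_of_mem_dynamics (z₀ : CotangentBundle 𝓘(ℝ, E) Q) {s : TTStar E Q}
    (hs : s ∈ O.dynamics) (hz : s.proj ∈ (extChartAt (cotangentModel 𝓘(ℝ, E)) z₀).source) :
    ∃ u, (extChartAt (cotangentModel 𝓘(ℝ, E)) z₀ s.proj, u) ∈ O.chartDomain z₀ ∧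
      fderiv ℝ (O.chartHamiltonian z₀) (extChartAt (cotangentModel 𝓘(ℝ, E)) z₀ s.proj, u) =
      (standardForm E (coordDeriv (cotangentModel 𝓘(ℝ, E)) 𝓘(ℝ, E × (E →L[ℝ] ℝ))
        (extChartAt (cotangentModel 𝓘(ℝ, E)) z₀) s.proj (tangentVec s))).comp
        (ContinuousLinearMap.fst ℝ (E × (E →L[ℝ] ℝ)) W) := by
  obtain ⟨u, hu, hu0, hd⟩ := hs
  set X := extChartAt (cotangentModel 𝓘(ℝ, E)) z₀ with hX
  have hp : (X s.proj, u) ∈ O.chartDomain z₀ := ⟨X.map_source hz, hu⟩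
  refine ⟨u, hp, ?_⟩
  have hH := (O.differentiableAt_chartHamiltonian z₀ hp).hasFDerivAt
  have h1 : HasFDerivAt ((fun z => O.hamiltonian z u) ∘ X.symm)
      ((fderiv ℝ (O.chartHamiltonian z₀) (X s.proj, u)).comp
        (ContinuousLinearMap.inl ℝ (E × (E →L[ℝ] ℝ)) W)) (X s.proj) :=
    HasFDerivAt.comp (X s.proj) (g := O.chartHamiltonian z₀) (f := fun ζ => (ζ, u)) hH
      (hasFDerivAt_prodMk_left (X s.proj) u)
  have h2 : standardForm E (tangentVec s) = coordDeriv (cotangentModel 𝓘(ℝ, E)) 𝓘(ℝ, ℝ)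
      (fun z => O.hamiltonian z u) s.proj := hd
  rw [coordDeriv_eq_fderiv_comp_chart hz h1.differentiableAt, h1.fderiv] at h2
  have h3 := O.controlDeriv_chart z₀ hp
  change O.controlDeriv s.proj u = 0 at hu0
  rw [show (extChartAt (cotangentModel 𝓘(ℝ, E)) z₀).symm (X s.proj, u).1 = s.proj from
    X.left_inv hz, hu0] at h3
  refine ContinuousLinearMap.ext fun d => ?_
  have h4 : d = (ContinuousLinearMap.inl ℝ (E × (E →L[ℝ] ℝ)) W d.1) +
      (ContinuousLinearMap.inr ℝ (E × (E →L[ℝ] ℝ)) W d.2) := by simp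
  have h5 : fderiv ℝ (O.chartHamiltonian z₀) (X s.proj, u)
      (ContinuousLinearMap.inr ℝ (E × (E →L[ℝ] ℝ)) W d.2) = 0 := (DFunLike.congr_fun h3 d.2).symm
  have h6 := DFunLike.congr_fun h2 (coordDeriv 𝓘(ℝ, E × (E →L[ℝ] ℝ)) (cotangentModel 𝓘(ℝ, E))
    X.symm (X s.proj) d.1)
  simp only [ContinuousLinearMap.comp_apply] at h6
  rw [coordDeriv_chart_comp_symm hz] at h6
  have h7 := standardForm_chart_symm z₀ (X.map_source hz)
    (coordDeriv (cotangentModel 𝓘(ℝ, E)) 𝓘(ℝ, E × (E →L[ℝ] ℝ)) X s.proj (tangentVec s)) d.1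
  rw [coordDeriv_symm_comp_chart hz] at h7
  rw [h4, map_add, h5, add_zero, ← h6, ← h4]
  exact h7

end OptimalControlProblem

/-! ### Isotropy of submanifolds contained in the dynamics. -/

section Isotropy

variable {E : Type*} [NormedAddCommGroup E] [NormedSpace ℝ E] [FiniteDimensional ℝ E]
  {Q : Type*} [TopologicalSpace Q] [ChartedSpace E Q] [IsManifold 𝓘(ℝ, E) ∞ Q]
  {W : Type*} [NormedAddCommGroup W] [NormedSpace ℝ W] [FiniteDimensional ℝ W]

set_option maxHeartbeats 1000000 in
/-- A submanifold of `T T^* Q` contained in the dynamics is isotropic for the tangent lift of the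
canonical form. -/
theorem OptimalControlProblem.liftedForm_eq_zero (O : OptimalControlProblem E Q W)
    (hMorse : O.IsMorseFamily) {r : ℕ} {S : Set (TTStar E Q)}
    (hS : IsSubmanifold (cotangentModel 𝓘(ℝ, E)).tangent r S) (hSO : S ⊆ O.dynamics)
    {w : TTStar E Q} (hw : w ∈ S) {a b : (E × (E →L[ℝ] ℝ)) × (E × (E →L[ℝ] ℝ))}
    (ha : a ∈ tangentSpaceOf (cotangentModel 𝓘(ℝ, E)).tangent S w)
    (hb : b ∈ tangentSpaceOf (cotangentModel 𝓘(ℝ, E)).tangent S w) : liftedForm E a b = 0 := by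
  obtain ⟨K, hK, -, B, c, hB, h0, hc, hc0, hcd, hcS⟩ := hS.exists_parametrization hw
  have ha' : a ∈ K := by rw [hK]; exact ha
  have hb' : b ∈ K := by rw [hK]; exact hb
  set Φ := extChartAt (cotangentModel 𝓘(ℝ, E)).tangent w with hΦ
  have hB' : IsOpen (B ∩ c ⁻¹' Φ.source) :=
    hc.continuousOn.isOpen_inter_preimage hB (isOpen_extChartAt_source _)
  have h0' : (0 : K) ∈ B ∩ c ⁻¹' Φ.source := by
    refine ⟨h0, ?_⟩
    rw [mem_preimage, hc0]
    exact mem_extChartAt_source w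
  have hC : ContDiffOn ℝ ∞ (fun y => Φ (c y)) (B ∩ c ⁻¹' Φ.source) := by
    rw [← contMDiffOn_iff_contDiffOn]
    refine (contMDiffOn_extChartAt (n := ∞) (x := w)).comp (hc.mono inter_subset_left)
      fun y hy => ?_
    rw [← extChartAt_source (cotangentModel 𝓘(ℝ, E)).tangent]
    exact hy.2
  have hCd : HasFDerivAt (fun y => Φ (c y)) K.subtypeL 0 := by
    have h1 : MDifferentiableAt 𝓘(ℝ, K) (cotangentModel 𝓘(ℝ, E)).tangent c 0 :=
      (hc.contMDiffAt (hB.mem_nhds h0)).mdifferentiableAt (by simp)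
    have h2 := h1.mfderiv_eq_fderiv_of_model
    rw [hcd, hc0] at h2
    have h3 : DifferentiableAt ℝ (fun y => Φ (c y)) 0 :=
      (hC.contDiffAt (hB'.mem_nhds h0')).differentiableAt (by simp)
    have h4 := h3.hasFDerivAt
    rwa [show fderiv ℝ (fun y => Φ (c y)) 0 = K.subtypeL from h2.symm] at h4
  -- A control is available at each point separately, with no regularity in `y`;
  -- `isotropic_of_morse` asks for nothing more.
  have hex : ∀ y ∈ B ∩ c ⁻¹' Φ.source, ∃ u, ((Φ (c y)).1, u) ∈ O.chartDomain w.proj ∧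
      fderiv ℝ (O.chartHamiltonian w.proj) ((Φ (c y)).1, u) =
        (standardForm E (Φ (c y)).2).comp (ContinuousLinearMap.fst ℝ (E × (E →L[ℝ] ℝ)) W) := by
    intro y hy
    have h1 := (mem_extChartAt_tangent_source w (c y)).1 hy.2
    have h2 := O.fderiv_chartHamiltonian_of_mem_dynamics w.proj (hSO (hcS hy.1)) h1
    rw [show Φ (c y) = _ from extChartAt_tangent_apply w (c y) h1]
    exact h2
  have h1 := isotropic_of_morse (O.isOpen_chartDomain w.proj) (O.contDiffOn_chartHamiltonian w.proj)
    (fun p hp h => O.surjective_fderiv_of_isMorseFamily hMorse w.proj hp h) hB'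
    (contDiff_fst.comp_contDiffOn hC) (contDiff_snd.comp_contDiffOn hC) hex h0'
    (⟨a, ha'⟩ : K) ⟨b, hb'⟩
  have h2 : HasFDerivAt (Prod.fst ∘ fun y => Φ (c y)) _ 0 := hasFDerivAt_fst.comp 0 hCd
  have h3 : HasFDerivAt (Prod.snd ∘ fun y => Φ (c y)) _ 0 := hasFDerivAt_snd.comp 0 hCd
  rw [h2.fderiv, h3.fderiv] at h1
  change standardForm E a.2 b.1 = standardForm E b.2 a.1 at h1
  rw [liftedForm_apply, h1, standardForm_swap]
  ring

end Isotropy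

/-! ### The integrator as a Lagrangian submanifold, and the proposition. -/

section Integrator

variable {E : Type*} [NormedAddCommGroup E] [NormedSpace ℝ E]
  {Q : Type*} [TopologicalSpace Q] [ChartedSpace E Q] [IsManifold 𝓘(ℝ, E) ∞ Q]
  {D : Set (TangentBundle 𝓘(ℝ, E) Q)} {R : TangentBundle 𝓘(ℝ, E) Q → Q × Q}

/-- The fibres of `TP` are linear, so `S ⊆ TP` gives `h · S ⊆ TP`, and membership in the discrete
phase space becomes automatic. -/
theorem integrator_eq_image {P : Set (CotangentBundle 𝓘(ℝ, E) Q)} {S : Set (TTStar E Q)}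
    (hSP : S ⊆ tangentBundleOf (cotangentModel 𝓘(ℝ, E)) P) {h : ℝ} (hh : h ≠ 0) :
    integrator D R P S h = cotangentLift R '' (fibreScale h '' S ∩ cotangentLiftDomain D) := by
  ext y
  constructor
  · rintro ⟨-, w, hw, rfl, hS⟩
    exact ⟨w, ⟨⟨_, hS, fibreScale_inv hh w⟩, hw⟩, rfl⟩
  · rintro ⟨_, ⟨⟨s, hs, rfl⟩, hw⟩, rfl⟩
    have h2 : fibreScale h s ∈ tangentBundleOf (cotangentModel 𝓘(ℝ, E)) P :=
      ⟨(hSP hs).1, Submodule.smul_mem _ h (hSP hs).2⟩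
    refine ⟨⟨_, ⟨h2, hw⟩, rfl⟩, _, hw, rfl, ?_⟩
    have h1 := fibreScale_inv (inv_ne_zero hh) s
    rw [inv_inv] at h1
    change fibreScale h⁻¹ (fibreScale h s) ∈ S
    rwa [h1]

section Bilinear

variable {Z : Type*} [NormedAddCommGroup Z] [NormedSpace ℝ Z] (B : Z →L[ℝ] Z →L[ℝ] ℝ)

/-- `B₂ - B₁` on `Z × Z`. -/
def bilinDifference : (Z × Z) →ₗ[ℝ] (Z × Z) →ₗ[ℝ] ℝ :=
  LinearMap.mk₂ ℝ (fun a b => B a.2 b.2 - B a.1 b.1) (fun a b c => by simp; ring)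
    (fun t a b => by simp; ring) (fun a b c => by simp; ring) (fun t a b => by simp; ring)

theorem bilin_smul_add (h : ℝ) (a b : Z × Z) :
    B a.1 (h • b.2) + B (h • a.2) b.1 = h * (B a.1 b.2 + B a.2 b.1) := by
  simp
  ring

theorem bilin_zero_add (a b : Z) : B 0 b + B a 0 = 0 := by simp

end Bilinear

theorem liftedForm_smul (h : ℝ) (a b : (E × (E →L[ℝ] ℝ)) × (E × (E →L[ℝ] ℝ))) :
    liftedForm E (a.1, h • a.2) (b.1, h • b.2) = h * liftedForm E a b :=
  bilin_smul_add (standardForm E) h a b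

/-- Each term of the lifted form pairs a base component with a vertical one. Vertical vectors can
hence serve as the isotropic supplement in `finrank_lagrangian`. -/
theorem liftedForm_vertical (a b : E × (E →L[ℝ] ℝ)) : liftedForm E (0, a) (0, b) = 0 :=
  bilin_zero_add (standardForm E) a b

variable [FiniteDimensional ℝ E]

theorem IsSubmanifold.image_cotangentLift (hR : IsDiffeoOntoImage D R) {d : ℕ}
    {N : Set (TTStar E Q)} (hN : IsSubmanifold (cotangentModel 𝓘(ℝ, E)).tangent d N) :
    IsSubmanifold (pairModel E) d (cotangentLift R '' (N ∩ cotangentLiftDomain D)) ∧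
    ∀ w ∈ cotangentLiftDomain D,
      tangentSpaceOf (pairModel E) (cotangentLift R '' (N ∩ cotangentLiftDomain D))
        (cotangentLift R w) =
      (tangentSpaceOf (cotangentModel 𝓘(ℝ, E)).tangent N w).map
        (coordDeriv (cotangentModel 𝓘(ℝ, E)).tangent (pairModel E) (cotangentLift R) w).toLinearMap := by
  have h1 : ∀ w : TTStar E Q, ∃ A : ((E × (E →L[ℝ] ℝ)) × (E × (E →L[ℝ] ℝ))) ≃L[ℝ]
      ((E × (E →L[ℝ] ℝ)) × (E × (E →L[ℝ] ℝ))), w ∈ cotangentLiftDomain D →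
      coordDeriv (cotangentModel 𝓘(ℝ, E)).tangent (pairModel E) (cotangentLift R) w = A := by
    intro w
    by_cases hw : w ∈ cotangentLiftDomain D
    · obtain ⟨A, hA⟩ := exists_equiv_cotangentLift hR hw
      exact ⟨A, fun _ => hA⟩
    · exact ⟨ContinuousLinearEquiv.refl ℝ _, fun h => absurd h hw⟩
  choose A hA using h1
  exact hN.image (isOpen_cotangentLiftDomain hR.1) (contMDiffOn_cotangentLift hR)
    (injOn_cotangentLift hR) A hA

theorem tangentSpaceOf_integrator (hR : IsDiffeoOntoImage D R) {r : ℕ} {S : Set (TTStar E Q)}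
    (hS : IsSubmanifold (cotangentModel 𝓘(ℝ, E)).tangent r S) {h : ℝ} (hh : h ≠ 0)
    {s : TTStar E Q} (hs : fibreScale h s ∈ cotangentLiftDomain D)
    (a : (E × (E →L[ℝ] ℝ)) × (E × (E →L[ℝ] ℝ))) :
    a ∈ tangentSpaceOf (pairModel E) (cotangentLift R '' (fibreScale h '' S ∩ cotangentLiftDomain D))
        (cotangentLift R (fibreScale h s)) ↔
      ∃ b ∈ tangentSpaceOf (cotangentModel 𝓘(ℝ, E)).tangent S s,
        coordDeriv (cotangentModel 𝓘(ℝ, E)).tangent (pairModel E) (cotangentLift R)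
          (fibreScale h s) (b.1, h • b.2) = a := by
  have h1 := hS.image_fibreScale hh
  rw [(h1.1.image_cotangentLift hR).2 _ hs, h1.2]
  constructor
  · rintro ⟨_, ⟨b, hb, rfl⟩, rfl⟩
    exact ⟨b, hb, congrArg (coordDeriv (cotangentModel 𝓘(ℝ, E)).tangent (pairModel E)
      (cotangentLift R) (fibreScale h s)) (coordDeriv_fibreScale h s b).symm⟩
  · rintro ⟨b, hb, rfl⟩
    exact ⟨_, ⟨b, hb, rfl⟩, congrArg (coordDeriv (cotangentModel 𝓘(ℝ, E)).tangent (pairModel E)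
      (cotangentLift R) (fibreScale h s)) (coordDeriv_fibreScale h s b)⟩

/-- The integrator of an isotropic submanifold `S` that submerges onto `P` is Lagrangian. -/
theorem isLagrangianIn_integrator (hR : IsDiffeoOntoImage D R)
    {P : Set (CotangentBundle 𝓘(ℝ, E) Q)} {S : Set (TTStar E Q)} {m r : ℕ}
    (hP : IsSubmanifold (cotangentModel 𝓘(ℝ, E)) m P)
    (hS : IsSubmanifold (cotangentModel 𝓘(ℝ, E)).tangent r S)
    (hSP : S ⊆ tangentBundleOf (cotangentModel 𝓘(ℝ, E)) P)
    (hiso : ∀ s ∈ S, ∀ a ∈ tangentSpaceOf (cotangentModel 𝓘(ℝ, E)).tangent S s,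
      ∀ b ∈ tangentSpaceOf (cotangentModel 𝓘(ℝ, E)).tangent S s, liftedForm E a b = 0)
    (hsub : ∀ w ∈ S, tangentSpaceOf (cotangentModel 𝓘(ℝ, E)) P w.proj ≤
        (tangentSpaceOf (cotangentModel 𝓘(ℝ, E)).tangent S w).map
          (mfderiv (cotangentModel 𝓘(ℝ, E)).tangent (cotangentModel 𝓘(ℝ, E))
            (TotalSpace.proj : TTStar E Q → CotangentBundle 𝓘(ℝ, E) Q) w).toLinearMap)
    {h : ℝ} (hh : h ≠ 0) :
    IsLagrangianIn (Omega12 E Q) (discretePhaseSpace D R P) (integrator D R P S h) r := by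
  have hsubset : integrator D R P S h ⊆ discretePhaseSpace D R P := fun y hy => hy.1
  have hN := (hS.image_fibreScale hh).1.image_cotangentLift hR
  have hTP := hP.tangentBundleOf.image_cotangentLift hR
  have key : ∀ x ∈ integrator D R P S h, ∀ v ∈ tangentSpaceOf (pairModel E) (integrator D R P S h) x,
      ∀ w ∈ tangentSpaceOf (pairModel E) (integrator D R P S h) x, pairForm v w = 0 := by
    rw [integrator_eq_image hSP hh]
    rintro _ ⟨_, ⟨⟨s, hs, rfl⟩, hsD⟩, rfl⟩ v hv w hw
    obtain ⟨a, ha, rfl⟩ := (tangentSpaceOf_integrator hR hS hh hsD v).1 hv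
    obtain ⟨b, hb, rfl⟩ := (tangentSpaceOf_integrator hR hS hh hsD w).1 hw
    refine (pairForm_cotangentLift hR hsD _ _).trans ((liftedForm_smul h a b).trans ?_)
    exact (congrArg (h * ·) (hiso s hs a ha b hb)).trans (mul_zero h)
  refine ⟨hsubset, ?_, fun x hx v hv w hw => (omega12_apply x v w).trans (key x hx v hv w hw), ?_⟩
  · rw [integrator_eq_image hSP hh]
    exact hN.1
  · intro x hx
    have hr : Module.finrank ℝ (tangentSpaceOf (pairModel E) (integrator D R P S h) x) = r := by
      rw [integrator_eq_image hSP hh] at hx ⊢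
      exact hN.1.finrank_tangentSpaceOf hx
    rw [← hr]
    have hx' := hx
    rw [integrator_eq_image hSP hh] at hx'
    obtain ⟨_, ⟨⟨s, hs, rfl⟩, hsD⟩, rfl⟩ := hx'
    set dΨ := coordDeriv (cotangentModel 𝓘(ℝ, E)).tangent (pairModel E) (cotangentLift R)
      (fibreScale h s) with hdΨ
    -- The supplement `N` is the image under `dΨ` of all vertical vectors. It need not be tangent to
    -- the discrete phase space; only the differences `v - l` have to lie in it.
    refine finrank_lagrangian (σ := bilinDifference (standardForm E))
      (N := (LinearMap.range (LinearMap.inr ℝ (E × (E →L[ℝ] ℝ)) (E × (E →L[ℝ] ℝ)))).map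
        dΨ.toLinearMap) ?_ (tangentSpaceOf_mono hsubset _) (key _ hx) ?_ ?_ ?_
    · intro v w
      change pairForm v w = -pairForm w v
      rw [pairForm, pairForm, standardForm_swap v.2, standardForm_swap v.1]
      ring
    · rintro _ ⟨_, ⟨a, rfl⟩, rfl⟩ _ ⟨_, ⟨b, rfl⟩, rfl⟩
      exact (pairForm_cotangentLift hR hsD _ _).trans (liftedForm_vertical a b)
    · intro v hv
      rw [discretePhaseSpace, hTP.2 _ hsD] at hv
      obtain ⟨t, ht, rfl⟩ := hv
      have h1 : t.1 ∈ tangentSpaceOf (cotangentModel 𝓘(ℝ, E)) P s.proj := by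
        have h2 := map_tangentSpaceOf_le (N' := P) (x := fibreScale h s)
          (N := tangentBundleOf (cotangentModel 𝓘(ℝ, E)) P)
          (((Bundle.contMDiffAt_proj (TangentSpace (cotangentModel 𝓘(ℝ, E)))
            (n := 1)).mdifferentiableAt (by simp)) :
            MDifferentiableAt (cotangentModel 𝓘(ℝ, E)).tangent (cotangentModel 𝓘(ℝ, E))
              (TotalSpace.proj : TTStar E Q → CotangentBundle 𝓘(ℝ, E) Q) (fibreScale h s))
          (Eventually.of_forall fun y hy => hy.1) ⟨t, ht, rfl⟩
        have h3 := DFunLike.congr_fun (mfderiv_tangentBundle_proj (fibreScale h s)) t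
        exact (congrArg (fun v : E × (E →L[ℝ] ℝ) =>
          v ∈ tangentSpaceOf (cotangentModel 𝓘(ℝ, E)) P s.proj) h3).mp h2
      -- The base component of a tangent vector of `TP` is tangent to `P`, so the submersion lifts
      -- it to `l` tangent to `S`. After scaling by `h`, `l` has the same base component as `t`, and
      -- the difference is vertical.
      obtain ⟨l, hl, hlt⟩ := hsub s hs h1
      have hlt' : l.1 = t.1 :=
        (DFunLike.congr_fun (mfderiv_tangentBundle_proj s) l).symm.trans hlt
      refine ⟨dΨ (l.1, h • l.2), ?_, ?_⟩
      · rw [integrator_eq_image hSP hh]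
        exact (tangentSpaceOf_integrator hR hS hh hsD _).2 ⟨l, hl, rfl⟩
      · refine ⟨(0, t.2 - h • l.2), ⟨_, rfl⟩, ?_⟩
        have h4 : ((0, t.2 - h • l.2) : (E × (E →L[ℝ] ℝ)) × (E × (E →L[ℝ] ℝ))) =
            t - (l.1, h • l.2) := Prod.ext (by simp [hlt']) rfl
        exact (congrArg dΨ h4).trans (map_sub dΨ _ _)
    · intro v
      exact and_congr_right fun _ => forall₂_congr fun w _ =>
        Eq.congr_left (omega12_apply (cotangentLift R (fibreScale h s)) v w)

omit [FiniteDimensional ℝ E] in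
/-- A map whose graph over `A` lies in an isotropic subset preserves the canonical form along `A`. -/
theorem canonicalForm_preserved {L : Set (CotangentBundle 𝓘(ℝ, E) Q × CotangentBundle 𝓘(ℝ, E) Q)}
    (hL : ∀ y ∈ L, ∀ a ∈ tangentSpaceOf (pairModel E) L y,
      ∀ b ∈ tangentSpaceOf (pairModel E) L y, pairForm a b = 0)
    {A : Set (CotangentBundle 𝓘(ℝ, E) Q)}
    {φ : CotangentBundle 𝓘(ℝ, E) Q → CotangentBundle 𝓘(ℝ, E) Q} (hA : ∀ z ∈ A, (z, φ z) ∈ L)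
    {z : CotangentBundle 𝓘(ℝ, E) Q} (hz : z ∈ A)
    (hφ : MDifferentiableAt (cotangentModel 𝓘(ℝ, E)) (cotangentModel 𝓘(ℝ, E)) φ z)
    {v w : E × (E →L[ℝ] ℝ)} (hv : v ∈ tangentSpaceOf (cotangentModel 𝓘(ℝ, E)) A z)
    (hw : w ∈ tangentSpaceOf (cotangentModel 𝓘(ℝ, E)) A z) :
    standardForm E (coordDeriv (cotangentModel 𝓘(ℝ, E)) (cotangentModel 𝓘(ℝ, E)) φ z v)
      (coordDeriv (cotangentModel 𝓘(ℝ, E)) (cotangentModel 𝓘(ℝ, E)) φ z w) =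
      standardForm E v w := by
  have hid : MDifferentiableAt (cotangentModel 𝓘(ℝ, E)) (cotangentModel 𝓘(ℝ, E))
      (fun z : CotangentBundle 𝓘(ℝ, E) Q => z) z := mdifferentiableAt_id
  have h1 : ∀ v : E × (E →L[ℝ] ℝ), coordDeriv (cotangentModel 𝓘(ℝ, E)) (pairModel E)
      (fun z => (z, φ z)) z v =
      (v, coordDeriv (cotangentModel 𝓘(ℝ, E)) (cotangentModel 𝓘(ℝ, E)) φ z v) := fun v => by
    refine (DFunLike.congr_fun (mfderiv_prodMk hid hφ) v).trans (Prod.ext ?_ rfl)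
    exact DFunLike.congr_fun (mfderiv_id (I := cotangentModel 𝓘(ℝ, E)) (x := z)) v
  have h2 := map_tangentSpaceOf_le (hid.prodMk hφ) (Eventually.of_forall hA)
  have h3 : pairForm (coordDeriv (cotangentModel 𝓘(ℝ, E)) (pairModel E) (fun z => (z, φ z)) z v)
      (coordDeriv (cotangentModel 𝓘(ℝ, E)) (pairModel E) (fun z => (z, φ z)) z w) = 0 :=
    hL _ (hA z hz) _ (h2 ⟨v, hv, rfl⟩) _ (h2 ⟨w, hw, rfl⟩)
  rw [h1, h1] at h3
  exact sub_eq_zero.1 h3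

end Integrator

theorem mainTheorem2
    {E : Type*} [NormedAddCommGroup E] [NormedSpace ℝ E] [FiniteDimensional ℝ E]
    {Q : Type*} [TopologicalSpace Q] [ChartedSpace E Q] [IsManifold 𝓘(ℝ, E) ∞ Q]
    [T2Space Q] [SecondCountableTopology Q]
    {W : Type*} [NormedAddCommGroup W] [NormedSpace ℝ W] [FiniteDimensional ℝ W]
    (O : OptimalControlProblem E Q W) (hMorse : O.IsMorseFamily)
    -- the integrability algorithm stabilizes at step `kf`, with final submanifolds `P`, `S`
    (kf : ℕ) (hstab : O.S (kf + 1) = O.S kf) (m r : ℕ)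
    (hP : IsSubmanifold (cotangentModel 𝓘(ℝ, E)) m (O.P kf))
    (hS : IsSubmanifold (cotangentModel 𝓘(ℝ, E)).tangent r (O.S kf))
    -- the projection of `S` onto `P` is a submersion
    (hsub : ∀ w ∈ O.S kf,
      tangentSpaceOf (cotangentModel 𝓘(ℝ, E)) (O.P kf) w.proj ≤
        (tangentSpaceOf (cotangentModel 𝓘(ℝ, E)).tangent (O.S kf) w).map
          (mfderiv (cotangentModel 𝓘(ℝ, E)).tangent (cotangentModel 𝓘(ℝ, E))
            (TotalSpace.proj : TTStar E Q → CotangentBundle 𝓘(ℝ, E) Q) w).toLinearMap)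
    -- a discretization map `R` with domain `D`, a diffeomorphism onto its image
    (D : Set (TangentBundle 𝓘(ℝ, E) Q)) (R : TangentBundle 𝓘(ℝ, E) Q → Q × Q)
    (hR : IsDiscretizationMap D R) (hdiff : IsDiffeoOntoImage D R)
    (h : ℝ) (hh : h ≠ 0) :
    -- `P_d` is a submanifold, and the pullback of `Ω₁₂` to it is a presymplectic form
    IsSubmanifold (pairModel E) (2 * m) (discretePhaseSpace D R (O.P kf)) ∧
    IsPresymplecticOn (Omega12 E Q) (discretePhaseSpace D R (O.P kf)) ∧
    -- the integrator is a Lagrangian submanifold of `P_d`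
    IsLagrangianIn (Omega12 E Q) (discretePhaseSpace D R (O.P kf))
      (integrator D R (O.P kf) (O.S kf) h) r ∧
    -- every map that solves the integrator on a set `A` preserves the canonical form along `A`
    ∀ (A : Set (CotangentBundle 𝓘(ℝ, E) Q))
      (φ : CotangentBundle 𝓘(ℝ, E) Q → CotangentBundle 𝓘(ℝ, E) Q),
      (∀ z ∈ A, (z, φ z) ∈ integrator D R (O.P kf) (O.S kf) h) →
      ∀ z ∈ A, MDifferentiableAt (cotangentModel 𝓘(ℝ, E)) (cotangentModel 𝓘(ℝ, E)) φ z →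
      ∀ v ∈ tangentSpaceOf (cotangentModel 𝓘(ℝ, E)) A z,
      ∀ w ∈ tangentSpaceOf (cotangentModel 𝓘(ℝ, E)) A z,
        (canonicalForm 𝓘(ℝ, E) Q).pullback φ z v w = canonicalForm 𝓘(ℝ, E) Q z v w := by
  -- Since `S^{k+1} = TP^k ∩ S^k`, stabilization amounts to tangency of the final dynamics to the
  -- final phase space.
  have hSP : O.S kf ⊆ tangentBundleOf (cotangentModel 𝓘(ℝ, E)) (O.P kf) := fun s hs => by
    rw [← hstab] at hs
    exact hs.1
  have hSO : ∀ k, O.S k ⊆ O.dynamics := by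
    intro k
    induction k with
    | zero => exact subset_rfl
    | succ k ih => exact fun s hs => ih hs.2
  have hL := isLagrangianIn_integrator hdiff hP hS hSP (fun s hs a ha b hb =>
    O.liftedForm_eq_zero hMorse hS (hSO kf) hs ha hb) hsub hh
  refine ⟨(hP.tangentBundleOf.image_cotangentLift hdiff).1, isPresymplecticOn_omega12 _, hL, ?_⟩
  intro A φ hA z hz hφ v hv w hw
  exact canonicalForm_preserved (fun y hy a ha b hb => (omega12_apply y a b).symm.trans
    (hL.isotropic y hy a ha b hb)) hA hz hφ hv hw

end
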